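/- An instance of Stable Roommates with Incomplete Lists (SRI) consists of a set of agents $a_1,\dots,a_n$, each of whom strictly ranks a subset of the other agents (her preference list), such that $a_j$ is on the list of $a_i$ if and only if $a_i$ is on the list of $a_j$; such pairs are called acceptable. Every agent ranks herself after all agents on her list. A matching $M$ is a set of pairwise disjoint acceptable pairs; $M(a)$ is the partner of $a$, with $M(a)=a$ if $a$ is unmatched. A blocking pair of $M$ is a pair of distinct agents each of whom prefers the other to her own partner in $M$; $bp_a(M)$ is the set of blocking pairs of $M$ that contain $a$. $M$ is stable if it has no blocking pairs. Let $\mathcal M$ be the set of all matchings. A matching $M$ is optimal if $\max_a |bp_a(M)| = \min_{M'\in\mathcal M}\max_a |bp_a(M')|$ (a maximum over no agents being $0$). Consider the following Algorithm 1. If the instance has a stable matching, return one, found by Irving's algorithm. Otherwise take a maximum-cardinality matching $M$ (for lists of length at most $2$: every second edge of each path of the acceptability graph, starting from an endpoint, and every second edge of each cycle), and, as long as some agent $a_i$ has $|bp_{a_i}(M)|=2$, choose an agent $a_r$ that forms a blocking pair with $a_i$, match $a_i$ with $a_r$, and leave the former partner of $a_r$ unmatched. Return $M$. Theorem. There is a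 constant $C$ such that the following holds for every SRI instance with $n$ agents in which all preference lists have length at most $2$. 1. $\min_{M\in\mathcal M}\max_a |bp_a(M)|\le 1$. 2. Whatever choices are made (of the stable matching, of the maximum-cardinality matching, and of $a_i$ and $a_r$ in each iteration), each iteration of the loop yields a matching again, the loop stops after at most $n$ iterations, and the matching returned by Algorithm 1 is optimal. 3. Algorithm 1, implemented with both phases of Irving's algorithm (proposals and rotation eliminations), a walk along the paths and cycles for the maximum-cardinality matching, and a stack of the unmatched agents for the loop, makes at most $C\,(n+1)$ steps on a unit-cost random access machine whose only arithmetic operations are adding and subtracting $1$, and outputs an optimal matching that is a possible result of Algorithm 1. In particular it solves the problem in $O(n)$ time. -/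

import Mathlib

/-! ## Stable Roommates with Incomplete Lists -/

/-- An instance with agents `Fin n`: every agent strictly ranks a set of other agents, given as a
list from most to least preferred; acceptability is symmetric. -/
structure SRI (n : ℕ) where
  pref : Fin n → List (Fin n)
  nodup : ∀ a, (pref a).Nodup
  irrefl : ∀ a, a ∉ pref a
  symm : ∀ a b, b ∈ pref a → a ∈ pref b

namespace SRI

variable {n : ℕ}

/-- `I.Prefers a b c`: agent `a` prefers `b` to `c`. `List.idxOf` is the length of the list for
agents that are not on it, so `a` ranks herself after everybody on her list. -/
def Prefers (I : SRI n) (a b c : Fin n) : Prop :=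
  (I.pref a).idxOf b < (I.pref a).idxOf c

/-- A matching (a set of disjoint acceptable pairs), given by its partner map `a ↦ M(a)`, where
`M(a) = a` means that `a` is unmatched. -/
@[ext]
structure Matching (I : SRI n) where
  partner : Fin n → Fin n
  involutive : ∀ a, partner (partner a) = a
  acceptable : ∀ a, partner a ≠ a → partner a ∈ I.pref a

/-- The empty matching. -/
instance (I : SRI n) : Inhabited I.Matching :=
  ⟨⟨id, fun _ => rfl, fun _ h => absurd rfl h⟩⟩

namespace Matching

variable {I : SRI n}

open Classical in
/-- The set of unordered pairs that make up the matching. -/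
noncomputable def pairs (M : I.Matching) : Finset (Sym2 (Fin n)) :=
  Finset.univ.filter fun e => ∃ a, M.partner a ≠ a ∧ e = s(a, M.partner a)

def IsMaximumCardinality (M : I.Matching) : Prop :=
  ∀ M' : I.Matching, M'.pairs.card ≤ M.pairs.card

/-- The two agents block the matching. -/
def Blocks (M : I.Matching) (a b : Fin n) : Prop :=
  a ≠ b ∧ I.Prefers a b (M.partner a) ∧ I.Prefers b a (M.partner b)

open Classical in
/-- `bp(M)`: the set of blocking pairs. -/
noncomputable def bp (M : I.Matching) : Finset (Sym2 (Fin n)) :=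
  Finset.univ.filter fun e => ∃ a b, e = s(a, b) ∧ M.Blocks a b

open Classical in
/-- `bp_a(M)`: the set of blocking pairs that involve the agent `a`. -/
noncomputable def bpOf (M : I.Matching) (a : Fin n) : Finset (Sym2 (Fin n)) :=
  M.bp.filter fun e => a ∈ e

def IsStable (M : I.Matching) : Prop := M.bp = ∅

/-- The maximum number of blocking pairs that any agent is in (`0` if there are no agents). -/
noncomputable def worst (M : I.Matching) : ℕ :=
  Finset.univ.sup fun a => (M.bpOf a).card

end Matching

/-- The minimum, over all matchings, of the maximum number of blocking pairs of an agent. There is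
at least one matching, so that the minimum is attained. -/
noncomputable def minimax (I : SRI n) : ℕ := ⨅ M : I.Matching, M.worst

/-- `M` is a solution of the minimax almost-stable matching problem. -/
def IsOptimal (I : SRI n) (M : I.Matching) : Prop := M.worst = I.minimax

def Solvable (I : SRI n) : Prop := ∃ M : I.Matching, M.IsStable

/-! ## The algorithm as pseudocode, with all its choices left open -/

/-- The rematching step: match `i` and `r`, and leave the partner of `r` unmatched. -/
def Rematches (I : SRI n) (M : I.Matching) (i r : Fin n) (M' : I.Matching) : Prop :=
  M'.partner = Function.update (Function.update (Function.update M.partner i r) r i)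
    (M.partner r) (M.partner r)

/-- One iteration of the rematching loop: choose an agent `i` in two blocking pairs and an agent
`r` that blocks with `i`, and rematch them. -/
def RematchStep (I : SRI n) (M M' : I.Matching) : Prop :=
  ∃ i r, (M.bpOf i).card = 2 ∧ M.Blocks i r ∧ I.Rematches M i r M'

/-- The loop condition is violated. -/
def RematchDone (I : SRI n) (M : I.Matching) : Prop := ∀ i, (M.bpOf i).card ≠ 2

/-- `M` can be returned on the input `I`: if there is a stable matching, `M` is one; otherwise `M`
is what the rematching loop leaves behind when it stops, having started at some
maximum-cardinality matching. -/
def CanReturn (I : SRI n) (M : I.Matching) : Prop :=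
  M.IsStable ∨
    (¬ I.Solvable ∧ ∃ M₀ : I.Matching, M₀.IsMaximumCardinality ∧
      Relation.ReflTransGen I.RematchStep M₀ M ∧ I.RematchDone M)

end SRI

/-! ## A random access machine with unit costs

Programs over finitely many registers and finitely many arrays of natural numbers. Registers and
array cells are accessed directly. The only arithmetic is to add or subtract `1`, so that all
numbers stay of linear size in the input and the number of steps made. -/

namespace Ram

/-- The registers. -/
inductive Reg
  | n | s | x | y | z | p | q | r | k | f | c | go | ok | top | stamp
  deriving DecidableEq

/-- The one-dimensional arrays. -/
inductive Vec
  | len | lm | rm | held | mark | sec | nxt | mate | vis | stk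
  deriving DecidableEq

/-- The two-dimensional arrays. -/
inductive Tab
  | pref | cross
  deriving DecidableEq

/-- The memory. -/
structure Store where
  reg : Reg → ℕ
  vec : Vec → ℕ → ℕ
  tab : Tab → ℕ → ℕ → ℕ

inductive Exp
  | num (m : ℕ)
  | reg (v : Reg)
  | vec (a : Vec) (i : Exp)
  | tab (t : Tab) (i j : Exp)
  | succ (e : Exp)
  | pred (e : Exp)

inductive Test
  | eq (e e' : Exp)
  | lt (e e' : Exp)
  | not (b : Test)
  | and (b b' : Test)

inductive Com
  | skip
  | set (v : Reg) (e : Exp)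
  | put (a : Vec) (i e : Exp)
  | putTab (t : Tab) (i j e : Exp)
  | seq (c d : Com)
  | ite (b : Test) (c d : Com)
  | while (b : Test) (c : Com)

def Exp.eval (σ : Store) : Exp → ℕ
  | num m => m
  | reg v => σ.reg v
  | vec a i => σ.vec a (i.eval σ)
  | tab t i j => σ.tab t (i.eval σ) (j.eval σ)
  | succ e => e.eval σ + 1
  | pred e => e.eval σ - 1

/-- Every operation inside an expression is one step. -/
def Exp.cost : Exp → ℕ
  | num _ => 1
  | reg _ => 1
  | vec _ i => i.cost + 1
  | tab _ i j => i.cost + j.cost + 1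
  | succ e => e.cost + 1
  | pred e => e.cost + 1

def Test.eval (σ : Store) : Test → Bool
  | eq e e' => decide (e.eval σ = e'.eval σ)
  | lt e e' => decide (e.eval σ < e'.eval σ)
  | not b => !b.eval σ
  | and b b' => b.eval σ && b'.eval σ

def Test.cost : Test → ℕ
  | eq e e' => e.cost + e'.cost + 1
  | lt e e' => e.cost + e'.cost + 1
  | not b => b.cost + 1
  | and b b' => b.cost + b'.cost + 1

def Store.set (σ : Store) (v : Reg) (m : ℕ) : Store :=
  { σ with reg := Function.update σ.reg v m }

def Store.put (σ : Store) (a : Vec) (i m : ℕ) : Store :=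
  { σ with vec := Function.update σ.vec a (Function.update (σ.vec a) i m) }

def Store.putTab (σ : Store) (t : Tab) (i j m : ℕ) : Store :=
  { σ with
    tab := Function.update σ.tab t
      (Function.update (σ.tab t) i (Function.update (σ.tab t i) j m)) }

/-- `Run c σ t σ'`: started in the memory `σ`, the program `c` halts after exactly `t` steps, and
leaves the memory `σ'`. -/
inductive Run : Com → Store → ℕ → Store → Prop
  | skip (σ) : Run .skip σ 1 σ
  | set (v e σ) : Run (.set v e) σ (e.cost + 1) (σ.set v (e.eval σ))
  | put (a i e σ) :
      Run (.put a i e) σ (i.cost + e.cost + 1) (σ.put a (i.eval σ) (e.eval σ))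
  | putTab (a i j e σ) :
      Run (.putTab a i j e) σ (i.cost + j.cost + e.cost + 1)
        (σ.putTab a (i.eval σ) (j.eval σ) (e.eval σ))
  | seq {c d σ σ₁ σ₂ t₁ t₂} : Run c σ t₁ σ₁ → Run d σ₁ t₂ σ₂ → Run (.seq c d) σ (t₁ + t₂) σ₂
  | iteTrue {b c d σ σ' t} : b.eval σ = true → Run c σ t σ' →
      Run (.ite b c d) σ (b.cost + t) σ'
  | iteFalse {b c d σ σ' t} : b.eval σ = false → Run d σ t σ' →
      Run (.ite b c d) σ (b.cost + t) σ'
  | whileFalse {b c σ} : b.eval σ = false → Run (.while b c) σ b.cost σ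
  | whileTrue {b c σ σ₁ σ₂ t₁ t₂} : b.eval σ = true → Run c σ t₁ σ₁ →
      Run (.while b c) σ₁ t₂ σ₂ → Run (.while b c) σ (b.cost + t₁ + t₂) σ₂

instance : Coe Reg Exp := ⟨Exp.reg⟩
instance (m : ℕ) : OfNat Exp m := ⟨Exp.num m⟩
instance : CoeFun Vec (fun _ => Exp → Exp) := ⟨Exp.vec⟩
instance : CoeFun Tab (fun _ => Exp → Exp → Exp) := ⟨Exp.tab⟩

end Ram

/-- The memory that holds the preference lists of `I`, and `0` everywhere else: the number of
agents in the register `n`, the length of the list of agent `i` in `len[i]`, and the agent in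
position `p` of that list in `pref[i][p]`. -/
def SRI.load {n : ℕ} (I : SRI n) : Ram.Store where
  reg v := if v = .n then n else 0
  vec a i := if a = .len then (if h : i < n then (I.pref ⟨i, h⟩).length else 0) else 0
  tab t i p := if t = .pref then
      (if h : i < n then ((I.pref ⟨i, h⟩)[p]?.map Fin.val).getD 0 else 0) else 0

/-! ## The algorithm as a program -/

namespace AlmostStable

section

open Ram Reg Vec Tab Exp Test Com

local infixr:30 " ;; " => Com.seq
local infix:40 " ::= " => Com.set
local infix:50 " =? " => Test.eq
local infix:50 " <? " => Test.lt

/-- `for v = 0, …, n - 1 do body`. -/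
def forAgents (v : Reg) (body : Com) : Com :=
  v ::= 0 ;;
  Com.while (v <? n) (
    body ;;
    v ::= succ v)

/-- Compute `cross[x][p]`, the position of `x` on the list of the agent in position `p` of the
list of `x`. -/
def crossPositions : Com :=
  forAgents x (
    p ::= 0 ;;
    Com.while (p <? len x) (
      y ::= pref x p ;;
      q ::= 0 ;;
      Com.while (Test.not (pref y q =? x)) (q ::= succ q) ;;
      putTab cross x p q ;;
      p ::= succ p))

/-- First phase of Irving's algorithm (proposals). The reduced list of `x` consists of the entries
in the positions from `lm[x]` to `rm[x] - 1`, without the agents `y` on whose list `x` has a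
position `≥ rm[y]`. If `held[y] = 1`, then `y` holds a proposal from the agent in position
`rm[y] - 1` of the list of `y`. -/
def phaseOne : Com :=
  forAgents x (put lm x 0 ;; put rm x (len x) ;; put held x 0 ;; put mark x 0) ;;
  forAgents s (
    x ::= s ;;
    go ::= 1 ;;
    Com.while (go =? 1) (
      Com.ite (lm x <? rm x) (
        y ::= pref x (lm x) ;;
        q ::= cross x (lm x) ;;
        Com.ite (q <? rm y) (
          z ::= pref y (pred (rm y)) ;;
          put rm y (succ q) ;;
          Com.ite (held y =? 1) (
            x ::= z ;;
            put lm x (succ (lm x))) (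
            put held y 1 ;;
            go ::= 0)) (
          put lm x (succ (lm x)))) (
        go ::= 0)))

/-- Walk along `x ↦ last (second x)`, starting at `s`, up to the first repetition; then `x` is
on an exposed rotation. The position of `second x` is stored in `sec[x]`, and the next agent
of the walk in `nxt[x]`. -/
def findRotation : Com :=
  stamp ::= succ stamp ;;
  x ::= s ;;
  Com.while (Test.not (mark x =? stamp)) (
    put mark x stamp ;;
    p ::= succ (lm x) ;;
    Com.while (Test.not (cross x p <? rm (pref x p))) (p ::= succ p) ;;
    y ::= pref x p ;;
    z ::= pref y (pred (rm y)) ;;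
    put sec x p ;;
    put nxt x z ;;
    x ::= z)

/-- Eliminate the rotation through `x`: every agent on it moves on to her second choice, who
rejects everybody worse. Then set `ok` to `0` if this has emptied a list. -/
def eliminateRotation : Com :=
  r ::= x ;;
  go ::= 1 ;;
  Com.while (go =? 1) (
    p ::= sec x ;;
    put lm x p ;;
    put rm (pref x p) (succ (cross x p)) ;;
    x ::= nxt x ;;
    Com.ite (x =? r) (go ::= 0) skip) ;;
  go ::= 1 ;;
  Com.while (go =? 1) (
    Com.ite (lm x <? rm x) skip (ok ::= 0) ;;
    x ::= nxt x ;;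
    Com.ite (x =? r) (go ::= 0) skip)

/-- Second phase of Irving's algorithm: eliminate rotations as long as some reduced list has two
entries and none has become empty. -/
def phaseTwo : Com :=
  stamp ::= 0 ;;
  ok ::= 1 ;;
  s ::= 0 ;;
  Com.while (Test.and (s <? n) (ok =? 1)) (
    Com.ite (succ (lm s) <? rm s)
      (findRotation ;; eliminateRotation)
      (s ::= succ s))

/-- Irving's algorithm: `ok` says whether there is a stable matching, and if so, one is stored
in `mate`. -/
def irving : Com :=
  crossPositions ;;
  phaseOne ;;
  phaseTwo ;;
  Com.ite (ok =? 1) (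
    forAgents x (
      Com.ite (lm x <? rm x) (put mate x (pref x (lm x))) (put mate x x))) skip

/-- If `x` has an unvisited neighbour, set `f` to `1` and `y` to such a neighbour, and otherwise
set `f` to `0`. -/
def freeNeighbour : Com :=
  f ::= 0 ;;
  p ::= 0 ;;
  Com.while (p <? len x) (
    Com.ite (vis (pref x p) =? 0) (y ::= pref x p ;; f ::= 1) skip ;;
    p ::= succ p)

/-- Walk from `s` along a path or cycle and take every second edge. -/
def walk : Com :=
  x ::= s ;;
  go ::= 1 ;;
  Com.while (go =? 1) (
    put vis x 1 ;;
    freeNeighbour ;;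
    Com.ite (f =? 1) (
      put mate x y ;;
      put mate y x ;;
      x ::= y ;;
      put vis x 1 ;;
      freeNeighbour ;;
      Com.ite (f =? 1) (x ::= y) (go ::= 0)) (
      go ::= 0))

/-- A maximum-cardinality matching if no list has more than two entries: first walk along the
paths, each from one of its endpoints, and then along the cycles. -/
def maxCard : Com :=
  forAgents x (put mate x x ;; put vis x 0) ;;
  forAgents s (Com.ite (Test.and (len s =? 1) (vis s =? 0)) walk skip) ;;
  forAgents s (Com.ite (vis s =? 0) walk skip)

/-- Count in `c` the blocking pairs of the unmatched agent `x`, and let `r` be an agent in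
one of them, if there are any. -/
def countBlocking : Com :=
  c ::= 0 ;;
  p ::= 0 ;;
  Com.while (p <? len x) (
    y ::= pref x p ;;
    q ::= 0 ;;
    Com.while (Test.and (q <? cross x p) (Test.not (pref y q =? mate y))) (q ::= succ q) ;;
    Com.ite (q =? cross x p) (c ::= succ c ;; r ::= y) skip ;;
    p ::= succ p)

/-- The rematching procedure, with a stack of the unmatched agents. -/
def rematch : Com :=
  top ::= 0 ;;
  forAgents x (Com.ite (mate x =? x) (put stk top x ;; top ::= succ top) skip) ;;
  Com.while (0 <? top) (
    top ::= pred top ;;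
    x ::= stk top ;;
    countBlocking ;;
    Com.ite (c =? 2) (
      k ::= mate r ;;
      put mate x r ;;
      put mate r x ;;
      put mate k k) skip)

/-- The whole algorithm. The output is the array `mate`. -/
def algorithm : Com :=
  irving ;;
  Com.ite (ok =? 1) skip (maxCard ;; rematch)

end

end AlmostStable

/-! With lists of length at most two, an agent in two blocking pairs blocks with everybody on her
list, so she is unmatched. Let `M` have maximum cardinality, let `i` be such an agent, and let `r`
block with her. Then `r` is matched, say to `k`, since otherwise the pair could be added to `M`.
Matching `i` with `r` instead of `k` keeps the cardinality, and it puts nobody new into two blocking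
pairs (`Rematches.card_bpOf_eq_two`): `k` has `r` on her list, and `r` now prefers her partner to
`k`; every other candidate is unmatched and has only neighbours whose partners did not change. Since
`i` drops out, there are at most `n` iterations (`rematch_terminates`), and in the end everybody is
in at most one blocking pair. If there is no stable matching, every matching has a blocking pair, so
this is optimal (`CanReturn.isOptimal`).

The program is verified in a logic with time credits: in `Exec` the remaining budget is part of the
state, so correctness and the linear bound are proved together by invariants that carry a potential.
In Irving's algorithm, the first phase ends in a state `Reduced`. There the agents with two
remaining entries form cycles on which first and second choice are inverse to each other. A rotation
is half of an even cycle or the whole of an odd one. Eliminating it settles an even cycle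
(`Eliminated.reduced`). On an odd cycle it empties a list, and the cycle itself rules out a stable
matching, because agents matched to their second choices would have to alternate with those who are
not (`OddParty.exists_blocksAt`). A rotation costs time proportional to its length and retires its
agents, so that all rotations together are linear.

The walks along paths and cycles leave at most one unmatched agent in each component, which is best
possible by parity (`Matching.isMaximumCardinality_of_connected`). One pass over the stack of
unmatched agents suffices for the loop, because no agent ever enters two blocking pairs later
(`Stacked.rematch`). -/

namespace SRI

variable {n : ℕ} {I : SRI n}

/-! ### Blocking pairs, unmatched agents and maximum cardinality -/

theorem Prefers.mem {a b c : Fin n} (h : I.Prefers a b c) : b ∈ I.pref a :=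
  List.idxOf_lt_length_iff.1 (h.trans_le List.idxOf_le_length)

namespace Matching

variable {M : I.Matching}

theorem Blocks.symm {a b : Fin n} (h : M.Blocks a b) : M.Blocks b a :=
  ⟨h.1.symm, h.2.2, h.2.1⟩

theorem Blocks.mem {a b : Fin n} (h : M.Blocks a b) : b ∈ I.pref a := h.2.1.mem

theorem mem_bpOf {e : Sym2 (Fin n)} {a : Fin n} :
    e ∈ M.bpOf a ↔ ∃ b, M.Blocks a b ∧ e = s(a, b) := by
  classical
  simp only [bpOf, bp, Finset.mem_filter, Finset.mem_univ, true_and]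
  constructor
  · rintro ⟨⟨c, d, rfl, h⟩, ha⟩
    rcases Sym2.mem_iff.1 ha with rfl | rfl
    · exact ⟨d, h, rfl⟩
    · exact ⟨c, h.symm, Sym2.eq_swap⟩
  · rintro ⟨b, h, rfl⟩
    exact ⟨⟨a, b, rfl, h⟩, Sym2.mem_mk_left a b⟩

open Classical in
theorem card_bpOf (M : I.Matching) (a : Fin n) :
    (M.bpOf a).card = ((I.pref a).toFinset.filter (M.Blocks a)).card := by
  have : M.bpOf a = ((I.pref a).toFinset.filter (M.Blocks a)).image fun b => s(a, b) := by
    ext e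
    simp only [mem_bpOf, Finset.mem_image, Finset.mem_filter, List.mem_toFinset]
    exact ⟨fun ⟨b, h, e⟩ => ⟨b, ⟨h.mem, h⟩, e.symm⟩, fun ⟨b, h, e⟩ => ⟨b, h.2, e.symm⟩⟩
  rw [this, Finset.card_image_of_injective]
  exact fun b c h => Sym2.congr_right.1 h

theorem card_bpOf_le (M : I.Matching) (a : Fin n) : (M.bpOf a).card ≤ (I.pref a).length := by
  classical
  rw [card_bpOf]
  exact (Finset.card_filter_le _ _).trans (List.toFinset_card_le _)

theorem card_bpOf_eq_two_iff (M : I.Matching) {a : Fin n} (ha : (I.pref a).length ≤ 2) :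
    (M.bpOf a).card = 2 ↔ (I.pref a).length = 2 ∧ ∀ b ∈ I.pref a, M.Blocks a b := by
  classical
  have hc : (I.pref a).toFinset.card = (I.pref a).length :=
    List.toFinset_card_of_nodup (I.nodup a)
  constructor
  · intro h
    have hl : (I.pref a).length = 2 := le_antisymm ha (h ▸ M.card_bpOf_le a)
    refine ⟨hl, fun b hb => ?_⟩
    rw [card_bpOf] at h
    have := Finset.eq_of_subset_of_card_le
      (Finset.filter_subset (M.Blocks a) (I.pref a).toFinset) (by rw [h, hc, hl])
    exact (Finset.mem_filter.1 (this ▸ List.mem_toFinset.2 hb)).2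
  · rintro ⟨hl, h⟩
    rw [card_bpOf, Finset.filter_true_of_mem fun b hb => h b (List.mem_toFinset.1 hb), hc, hl]

/-- She blocks with everybody on her list, but a partner would be on the list and cannot be
preferred to herself. -/
theorem partner_eq_self_of_card_bpOf {a : Fin n} (ha : (I.pref a).length ≤ 2)
    (h : (M.bpOf a).card = 2) : M.partner a = a := by
  by_contra hne
  exact lt_irrefl _ (((M.card_bpOf_eq_two_iff ha).1 h).2 _ (M.acceptable a hne)).2.1

/-- The unmatched agents. -/
def single (M : I.Matching) : Finset (Fin n) := Finset.univ.filter fun a => M.partner a = a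

theorem mem_single {a : Fin n} : a ∈ M.single ↔ M.partner a = a := by simp [single]

/-- Each pair is hit by exactly two matched agents. This turns maximum cardinality into having the
fewest unmatched agents, which is how it is used below. -/
theorem card_pairs (M : I.Matching) : 2 * M.pairs.card + M.single.card = n := by
  classical
  set S := Finset.univ.filter fun a => M.partner a ≠ a with hS
  have h1 : S.card = ∑ e ∈ M.pairs, (S.filter fun a => s(a, M.partner a) = e).card :=
    Finset.card_eq_sum_card_fiberwise fun a ha => by
      simp only [pairs, Finset.coe_filter, Set.mem_ofPred_eq, Finset.mem_univ, true_and]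
      exact ⟨a, by simpa [hS] using ha, rfl⟩
  have h2 : ∀ e ∈ M.pairs, (S.filter fun a => s(a, M.partner a) = e).card = 2 := by
    intro e he
    simp only [pairs, Finset.mem_filter, Finset.mem_univ, true_and] at he
    obtain ⟨a, ha, rfl⟩ := he
    have : (S.filter fun b => s(b, M.partner b) = s(a, M.partner a)) = {a, M.partner a} := by
      ext b
      simp only [hS, Finset.mem_filter, Finset.mem_univ, true_and, Finset.mem_insert,
        Finset.mem_singleton]
      constructor
      · rintro ⟨-, h⟩
        exact Sym2.mem_iff.1 (h ▸ Sym2.mem_mk_left b (M.partner b))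
      · rintro (rfl | rfl)
        · exact ⟨ha, rfl⟩
        · rw [M.involutive]
          exact ⟨ha.symm, Sym2.eq_swap⟩
    rw [this, Finset.card_pair ha.symm]
  rw [Finset.sum_congr rfl h2, Finset.sum_const, smul_eq_mul, mul_comm] at h1
  rw [← h1, hS, single, add_comm, Finset.card_filter_add_card_filter_not, Finset.card_univ,
    Fintype.card_fin]

theorem isMaximumCardinality_iff :
    M.IsMaximumCardinality ↔ ∀ M' : I.Matching, M.single.card ≤ M'.single.card := by
  refine forall_congr' fun M' => ?_
  have := M.card_pairs
  have := M'.card_pairs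
  omega

/-- Two acceptable agents who are both unmatched could be added as a pair, leaving fewer agents
unmatched. -/
theorem IsMaximumCardinality.ne_of_mem (hM : M.IsMaximumCardinality) {a b : Fin n}
    (hab : b ∈ I.pref a) (ha : M.partner a = a) : M.partner b ≠ b := by
  intro hb
  have hne : b ≠ a := fun h => I.irrefl a (h ▸ hab)
  let M' : I.Matching :=
    { partner := Function.update (Function.update M.partner a b) b a
      involutive := fun c => by
        have h1 := M.involutive c
        simp only [Function.update_apply]
        grind
      acceptable := fun c => by
        have h1 := M.acceptable c
        have h2 := I.symm a b hab
        simp only [Function.update_apply]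
        grind }
  have h : M'.single ⊂ M.single := by
    refine Finset.ssubset_iff_subset_ne.2 ⟨fun c hc => ?_, fun h => ?_⟩
    · simp only [mem_single, M', Function.update_apply] at hc ⊢
      grind
    · have : a ∈ M'.single := h ▸ mem_single.2 ha
      simp only [mem_single, M', Function.update_apply] at this
      grind
  exact (Finset.card_lt_card h).not_ge (isMaximumCardinality_iff.1 hM M')

end Matching

theorem eq_of_mem_of_length_le_two {α : Type*} {l : List α} (hl : l.length ≤ 2) {a b c : α}
    (ha : a ∈ l) (hb : b ∈ l) (hc : c ∈ l) : a = b ∨ b = c ∨ a = c := by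
  match l, hl with
  | [], _ => simp at ha
  | [x], _ => simp_all
  | [x, y], _ =>
    simp only [List.mem_cons, List.not_mem_nil, or_false] at ha hb hc
    grind

/-! ### The rematching loop: invariants, termination, optimality -/

section Rematch

theorem rematches_iff {M M' : I.Matching} {i r : Fin n} :
    I.Rematches M i r M' ↔ ∀ c, M'.partner c = if c = M.partner r then M.partner r else
      if c = r then i else if c = i then r else M.partner c := by
  rw [Rematches, funext_iff]
  simp only [Function.update_apply]

variable (hI : ∀ a, (I.pref a).length ≤ 2) {M M' : I.Matching}
include hI

theorem exists_rematches (hM : M.IsMaximumCardinality) {i r : Fin n}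
    (hi : (M.bpOf i).card = 2) (hir : M.Blocks i r) : ∃ M' : I.Matching, I.Rematches M i r M' := by
  have h1 := Matching.partner_eq_self_of_card_bpOf (hI i) hi
  have h2 := hM.ne_of_mem hir.mem h1
  have h3 := M.involutive r
  refine ⟨⟨fun c => if c = M.partner r then M.partner r else if c = r then i else
    if c = i then r else M.partner c, ?_, ?_⟩, rematches_iff.2 fun _ => rfl⟩
  · intro c
    have := M.involutive c
    have := hir.1
    grind
  · intro c
    have := M.acceptable c
    have := hir.mem
    have := hir.symm.mem
    grind

/-- Among the unmatched agents, the former partner of `r` merely takes the place of `i`. -/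
theorem Rematches.isMaximumCardinality (hM : M.IsMaximumCardinality) {i r : Fin n}
    (hi : (M.bpOf i).card = 2) (hir : M.Blocks i r) (h : I.Rematches M i r M') :
    M'.IsMaximumCardinality := by
  have h1 := Matching.partner_eq_self_of_card_bpOf (hI i) hi
  have h2 := hM.ne_of_mem hir.mem h1
  have h3 := M.involutive r
  have h4 := hir.1
  have : M'.single = insert (M.partner r) (M.single.erase i) := by
    ext c
    simp only [Matching.mem_single, Finset.mem_insert, Finset.mem_erase]
    rw [rematches_iff.1 h]
    grind
  have hc : M'.single.card = M.single.card := by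
    have hk : M.partner r ∉ M.single.erase i := by
      simp only [Matching.mem_single, Finset.mem_erase]
      grind
    rw [this, Finset.card_insert_of_notMem hk,
      Finset.card_erase_add_one (Matching.mem_single.2 h1)]
  rw [Matching.isMaximumCardinality_iff] at hM ⊢
  rwa [hc]

/-- The heart of termination: the set of agents in two blocking pairs only loses members, and it
loses `i`. An agent `a` who is in two blocking pairs afterwards is none of `i`, `r` and the former
partner of `r`, and none of these is on her list. So nothing that concerns her pairs has changed. -/
theorem Rematches.card_bpOf_eq_two (hM : M.IsMaximumCardinality) {i r : Fin n}
    (hi : (M.bpOf i).card = 2) (hir : M.Blocks i r) (h : I.Rematches M i r M') {a : Fin n}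
    (ha : (M'.bpOf a).card = 2) : a ≠ i ∧ (M.bpOf a).card = 2 := by
  have h1 := Matching.partner_eq_self_of_card_bpOf (hI i) hi
  have h2 := hM.ne_of_mem hir.mem h1
  have h3 := M.involutive r
  have h4 := hir.1
  have hM' := h.isMaximumCardinality hI hM hi hir
  have ha1 := Matching.partner_eq_self_of_card_bpOf (hI a) ha
  have hp := rematches_iff.1 h
  have hai : a ≠ i := by
    rintro rfl
    rw [hp] at ha1
    grind
  have har : a ≠ r := by
    rintro rfl
    rw [hp] at ha1
    grind
  obtain ⟨hl, hb⟩ := (M'.card_bpOf_eq_two_iff (hI a)).1 ha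
  -- The former partner has `r` on her list, but `r` moved to somebody better and no longer blocks
  -- with her.
  have hak : a ≠ M.partner r := by
    rintro rfl
    have h5 := (hb r (I.symm _ _ (M.acceptable r h2))).2.2
    have h6 := hir.2.2
    rw [hp, if_neg h2.symm, if_pos rfl] at h5
    exact lt_asymm h5 h6
  refine ⟨hai, (M.card_bpOf_eq_two_iff (hI a)).2 ⟨hl, fun b hba => ?_⟩⟩
  have hb' := hb b hba
  have ha2 : M.partner a = a := by
    rw [hp] at ha1
    grind
  -- The list of `r` already contains `i` and the former partner of `r`, so there is no room for
  -- `a`.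
  have hbr : b ≠ r := by
    rintro rfl
    rcases eq_of_mem_of_length_le_two (hI b) (I.symm _ _ hba) hir.symm.mem (M.acceptable b h2)
      with h | h | h
    · exact hai h
    · rw [← h] at h3
      exact h4 (h1 ▸ h3)
    · exact hak h
  have hbi : b ≠ i := by
    rintro rfl
    exact hM.ne_of_mem hba ha2 h1
  have hbk : b ≠ M.partner r := by
    rintro rfl
    refine hM'.ne_of_mem hba ha1 ?_
    rw [hp, if_pos rfl]
  have hpb : M'.partner b = M.partner b := by rw [hp]; simp [hbr, hbi, hbk]
  refine ⟨hb'.1, ?_, ?_⟩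
  · rw [ha2]
    have := hb'.2.1
    rwa [ha1] at this
  · rw [← hpb]
    exact hb'.2.2

theorem card_bpOf_le_one_of_rematchDone (h : I.RematchDone M) (a : Fin n) :
    (M.bpOf a).card ≤ 1 := by
  have := h a
  have := (M.card_bpOf_le a).trans (hI a)
  omega

/-- The potential is the number of agents in two blocking pairs: at most `n` at the start, and
strictly smaller after each iteration. -/
theorem rematch_terminates {M : ℕ → I.Matching} {m : ℕ} (h0 : (M 0).IsMaximumCardinality)
    (h : ∀ j < m, I.RematchStep (M j) (M (j + 1))) : (M m).IsMaximumCardinality ∧ m ≤ n := by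
  classical
  suffices ∀ j ≤ m, (M j).IsMaximumCardinality ∧
      j + (Finset.univ.filter fun a => ((M j).bpOf a).card = 2).card ≤ n by
    have := this m le_rfl
    exact ⟨this.1, by omega⟩
  intro j
  induction j with
  | zero =>
    intro _
    refine ⟨h0, ?_⟩
    rw [zero_add]
    exact (Finset.card_le_univ _).trans_eq (Fintype.card_fin n)
  | succ j ih =>
    intro hj
    obtain ⟨h1, h2⟩ := ih (by omega)
    obtain ⟨i, r, hi, hir, hr⟩ := h j (by omega)
    refine ⟨hr.isMaximumCardinality hI h1 hi hir, ?_⟩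
    have : (Finset.univ.filter fun a => ((M (j + 1)).bpOf a).card = 2) ⊂
        Finset.univ.filter fun a => ((M j).bpOf a).card = 2 := by
      refine Finset.ssubset_iff_subset_ne.2 ⟨fun a ha => ?_, fun he => ?_⟩
      · simp only [Finset.mem_filter, Finset.mem_univ, true_and] at ha ⊢
        exact (hr.card_bpOf_eq_two hI h1 hi hir ha).2
      · have : i ∈ Finset.univ.filter fun a => ((M (j + 1)).bpOf a).card = 2 := by
          rw [he]
          simpa using hi
        exact (hr.card_bpOf_eq_two hI h1 hi hir (by simpa using this)).1 rfl
    have := Finset.card_lt_card this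
    omega

theorem CanReturn.worst_le_one (h : I.CanReturn M) : M.worst ≤ 1 := by
  refine Finset.sup_le fun a _ => ?_
  rcases h with h | ⟨-, -, -, -, h⟩
  · rw [Matching.bpOf, show M.bp = ∅ from h]
    simp
  · exact card_bpOf_le_one_of_rematchDone hI h a

/-- A stable matching has value zero. Without one, every matching has a blocking pair and hence
value at least one, which the result of the loop does not exceed. -/
theorem CanReturn.isOptimal (h : I.CanReturn M) : I.IsOptimal M := by
  refine le_antisymm (le_ciInf fun M' => ?_) (ciInf_le' _ M)
  have h1 := h.worst_le_one hI
  rcases h with h | ⟨h, -⟩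
  · have : M.worst = 0 := by
      refine Nat.le_zero.1 (Finset.sup_le fun a _ => ?_)
      rw [Matching.bpOf, show M.bp = ∅ from h]
      simp
    omega
  · refine h1.trans ?_
    obtain ⟨e, he⟩ : M'.bp.Nonempty := by
      rw [Finset.nonempty_iff_ne_empty]
      exact fun h' => h ⟨M', h'⟩
    classical
    obtain ⟨a, b, rfl, hab⟩ := (Finset.mem_filter.1 he).2
    refine le_trans ?_ (Finset.le_sup (f := fun a => (M'.bpOf a).card) (Finset.mem_univ a))
    exact Finset.card_pos.2 ⟨_, Matching.mem_bpOf.2 ⟨b, hab, rfl⟩⟩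

end Rematch

end SRI

/-! ### A program logic with time credits -/

namespace Ram

/-- Started in the memory `σ` with the budget `k`, the program `c` halts within the budget, and the
remaining budget and the final memory satisfy `Q`. -/
def Exec (c : Com) (Q : ℕ → Store → Prop) (k : ℕ) (σ : Store) : Prop :=
  ∃ t k' σ', Run c σ t σ' ∧ k = t + k' ∧ Q k' σ'

theorem Exec.mono {c : Com} {Q Q' : ℕ → Store → Prop} {k : ℕ} {σ : Store}
    (h : Exec c Q k σ) (hQ : ∀ k σ, Q k σ → Q' k σ) : Exec c Q' k σ := by
  obtain ⟨t, k', σ', h1, h2, h3⟩ := h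
  exact ⟨t, k', σ', h1, h2, hQ _ _ h3⟩

/-- This and the following equivalences compute weakest preconditions. Rewriting with them executes
straight-line code symbolically and leaves inequalities between budgets. -/
theorem exec_skip {Q : ℕ → Store → Prop} {k : ℕ} {σ : Store} :
    Exec .skip Q k σ ↔ 1 ≤ k ∧ Q (k - 1) σ := by
  constructor
  · rintro ⟨t, k', σ', h, rfl, hQ⟩
    cases h
    exact ⟨by omega, by rwa [Nat.add_sub_cancel_left]⟩
  · rintro ⟨h, hQ⟩
    exact ⟨1, k - 1, σ, .skip σ, by omega, hQ⟩

theorem exec_set {v : Reg} {e : Exp} {Q : ℕ → Store → Prop} {k : ℕ} {σ : Store} :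
    Exec (.set v e) Q k σ ↔
      e.cost + 1 ≤ k ∧ Q (k - (e.cost + 1)) (σ.set v (e.eval σ)) := by
  constructor
  · rintro ⟨t, k', σ', h, rfl, hQ⟩
    cases h
    exact ⟨by omega, by rwa [Nat.add_sub_cancel_left]⟩
  · rintro ⟨h, hQ⟩
    exact ⟨_, _, _, .set v e σ, by omega, hQ⟩

theorem exec_put {a : Vec} {i e : Exp} {Q : ℕ → Store → Prop} {k : ℕ} {σ : Store} :
    Exec (.put a i e) Q k σ ↔
      i.cost + e.cost + 1 ≤ k ∧
        Q (k - (i.cost + e.cost + 1)) (σ.put a (i.eval σ) (e.eval σ)) := by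
  constructor
  · rintro ⟨t, k', σ', h, rfl, hQ⟩
    cases h
    exact ⟨by omega, by rwa [Nat.add_sub_cancel_left]⟩
  · rintro ⟨h, hQ⟩
    exact ⟨_, _, _, .put a i e σ, by omega, hQ⟩

theorem exec_putTab {a : Tab} {i j e : Exp} {Q : ℕ → Store → Prop} {k : ℕ} {σ : Store} :
    Exec (.putTab a i j e) Q k σ ↔
      i.cost + j.cost + e.cost + 1 ≤ k ∧
        Q (k - (i.cost + j.cost + e.cost + 1))
          (σ.putTab a (i.eval σ) (j.eval σ) (e.eval σ)) := by
  constructor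
  · rintro ⟨t, k', σ', h, rfl, hQ⟩
    cases h
    exact ⟨by omega, by rwa [Nat.add_sub_cancel_left]⟩
  · rintro ⟨h, hQ⟩
    exact ⟨_, _, _, .putTab a i j e σ, by omega, hQ⟩

theorem exec_seq {c d : Com} {Q : ℕ → Store → Prop} {k : ℕ} {σ : Store} :
    Exec (.seq c d) Q k σ ↔ Exec c (Exec d Q) k σ := by
  constructor
  · rintro ⟨t, k', σ', h, rfl, hQ⟩
    cases h with
    | seq h1 h2 => exact ⟨_, _, _, h1, Nat.add_assoc _ _ _, _, _, _, h2, rfl, hQ⟩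
  · rintro ⟨t₁, k₁, σ₁, h1, rfl, t₂, k₂, σ₂, h2, rfl, hQ⟩
    exact ⟨_, _, _, .seq h1 h2, (Nat.add_assoc _ _ _).symm, hQ⟩

theorem exec_ite {b : Test} {c d : Com} {Q : ℕ → Store → Prop} {k : ℕ} {σ : Store} :
    Exec (.ite b c d) Q k σ ↔ b.cost ≤ k ∧
      (b.eval σ = true → Exec c Q (k - b.cost) σ) ∧
      (¬ b.eval σ = true → Exec d Q (k - b.cost) σ) := by
  constructor
  · rintro ⟨t, k', σ', h, rfl, hQ⟩
    cases h with
    | iteTrue hb h =>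
      exact ⟨by omega, fun _ => ⟨_, _, _, h, by omega, hQ⟩, fun hb' => by simp [hb] at hb'⟩
    | iteFalse hb h =>
      exact ⟨by omega, fun hb' => by simp [hb] at hb', fun _ => ⟨_, _, _, h, by omega, hQ⟩⟩
  · rintro ⟨hk, h1, h2⟩
    cases hb : b.eval σ with
    | true =>
      obtain ⟨t, k', σ', h, he, hQ⟩ := h1 hb
      exact ⟨_, _, _, .iteTrue hb h, by omega, hQ⟩
    | false =>
      obtain ⟨t, k', σ', h, he, hQ⟩ := h2 (by simp [hb])
      exact ⟨_, _, _, .iteFalse hb h, by omega, hQ⟩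

theorem Exp.one_le_cost (e : Exp) : 1 ≤ e.cost := by cases e <;> simp [Exp.cost]

theorem Test.one_le_cost (b : Test) : 1 ≤ b.cost := by cases b <;> simp [Test.cost]

/-- The budget serves as the termination measure of the loop. -/
theorem Exec.while {b : Test} {c : Com} {Q : ℕ → Store → Prop} (Inv : ℕ → Store → Prop)
    {k : ℕ} {σ : Store} (h0 : Inv k σ)
    (h : ∀ k σ, Inv k σ → b.cost ≤ k ∧ (b.eval σ = true → Exec c Inv (k - b.cost) σ) ∧
      (¬ b.eval σ = true → Q (k - b.cost) σ)) :
    Exec (.while b c) Q k σ := by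
  induction k using Nat.strong_induction_on generalizing σ with
  | _ k ih =>
    obtain ⟨hk, h1, h2⟩ := h k σ h0
    cases hb : b.eval σ with
    | true =>
      obtain ⟨t, k', σ', hr, he, hI⟩ := h1 hb
      have := b.one_le_cost
      obtain ⟨t', k'', σ'', hr', he', hQ⟩ := ih k' (by omega) hI
      exact ⟨_, _, _, .whileTrue hb hr hr', by omega, hQ⟩
    | false => exact ⟨_, _, _, .whileFalse hb, by omega, h2 (by simp [hb])⟩

@[simp] theorem Exp.eval_ofNat (σ : Store) (m : ℕ) :
    Exp.eval σ (@OfNat.ofNat Exp m (instOfNatExp m)) = @OfNat.ofNat ℕ m (instOfNatNat m) := rfl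

@[simp] theorem Exp.cost_ofNat (m : ℕ) :
    Exp.cost (@OfNat.ofNat Exp m (instOfNatExp m)) = 1 := rfl

attribute [simp] Exp.eval Exp.cost Test.cost

@[simp] theorem Test.eval_eq {σ : Store} {e e' : Exp} :
    (Test.eq e e').eval σ = true ↔ e.eval σ = e'.eval σ := by simp [Test.eval]

@[simp] theorem Test.eval_lt {σ : Store} {e e' : Exp} :
    (Test.lt e e').eval σ = true ↔ e.eval σ < e'.eval σ := by simp [Test.eval]

@[simp] theorem Test.eval_not {σ : Store} {b : Test} :
    (Test.not b).eval σ = true ↔ ¬ b.eval σ = true := by simp [Test.eval]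

@[simp] theorem Test.eval_and {σ : Store} {b b' : Test} :
    (Test.and b b').eval σ = true ↔ b.eval σ = true ∧ b'.eval σ = true := by simp [Test.eval]

@[simp] theorem Store.reg_set (σ : Store) (v w : Reg) (m : ℕ) :
    (σ.set v m).reg w = if w = v then m else σ.reg w := by
  simp [Store.set, Function.update_apply]

@[simp] theorem Store.vec_set (σ : Store) (v : Reg) (m : ℕ) : (σ.set v m).vec = σ.vec := rfl

@[simp] theorem Store.tab_set (σ : Store) (v : Reg) (m : ℕ) : (σ.set v m).tab = σ.tab := rfl

@[simp] theorem Store.reg_put (σ : Store) (a : Vec) (i m : ℕ) : (σ.put a i m).reg = σ.reg := rfl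

@[simp] theorem Store.vec_put (σ : Store) (a b : Vec) (i m : ℕ) :
    (σ.put a i m).vec b = if b = a then Function.update (σ.vec a) i m else σ.vec b := by
  simp [Store.put, Function.update_apply]

@[simp] theorem Store.tab_put (σ : Store) (a : Vec) (i m : ℕ) : (σ.put a i m).tab = σ.tab := rfl

@[simp] theorem Store.reg_putTab (σ : Store) (t : Tab) (i j m : ℕ) :
    (σ.putTab t i j m).reg = σ.reg := rfl

@[simp] theorem Store.vec_putTab (σ : Store) (t : Tab) (i j m : ℕ) :
    (σ.putTab t i j m).vec = σ.vec := rfl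

@[simp] theorem Store.tab_putTab (σ : Store) (t u : Tab) (i j m : ℕ) :
    (σ.putTab t i j m).tab u =
      if u = t then Function.update (σ.tab t) i (Function.update (σ.tab t i) j m)
      else σ.tab u := by
  simp [Store.putTab, Function.update_apply]

end Ram

open Ram in
/-- A loop over all agents, with an invariant that may also mention the number of iterations. -/
theorem AlmostStable.exec_forAgents {v : Reg} {body : Com} {Q : ℕ → Store → Prop} {N : ℕ}
    (hv : v ≠ .n) (Inv : ℕ → ℕ → Store → Prop) {k : ℕ} {σ : Store} (hn : σ.reg .n = N)
    (hk : 6 * N + 5 ≤ k) (h0 : Inv 0 (k - (6 * N + 5)) (σ.set v 0))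
    (hbody : ∀ i < N, ∀ k σ, σ.reg v = i → σ.reg .n = N → Inv i k σ →
      Exec body (fun k σ => σ.reg v = i ∧ σ.reg .n = N ∧ Inv (i + 1) k (σ.set v (i + 1))) k σ)
    (hQ : ∀ k σ, σ.reg .n = N → Inv N k σ → Q k σ) :
    Exec (forAgents v body) Q k σ := by
  -- The initialisation costs `2`, every iteration `3` for the guard and `3` for the increment, and
  -- the failing guard `3`: in total `6 * N + 5` besides the bodies. The invariant sets aside what
  -- is still to be paid and shows `Inv` only the rest.
  rw [forAgents, exec_seq, exec_set]
  refine ⟨by simp; omega, ?_⟩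
  refine Exec.while (fun k σ => ∃ i ≤ N, σ.reg v = i ∧ σ.reg .n = N ∧ 6 * (N - i) + 3 ≤ k ∧
    Inv i (k - (6 * (N - i) + 3)) σ) ?_ ?_
  · refine ⟨0, by omega, by simp, by simp [hv.symm, hn], by simp; omega, ?_⟩
    have : k - (Exp.cost 0 + 1) - (6 * (N - 0) + 3) = k - (6 * N + 5) := by simp; omega
    rw [this]
    exact h0
  · rintro k σ ⟨i, hi, hvi, hn, hk, hI⟩
    refine ⟨by simp; omega, fun hb => ?_, fun hb => ?_⟩
    · have hi' : i < N := by simpa [hvi, hn] using hb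
      rw [exec_seq]
      obtain ⟨t, k', σ', hr, he, h1, h2, h3⟩ := hbody i hi' _ σ hvi hn hI
      refine ⟨t, k' + 6 * (N - i), σ', hr, by simp; omega, ?_⟩
      rw [exec_set]
      refine ⟨by simp; omega, i + 1, hi', by simp [h1], by simp [hv.symm, h2], ?_, ?_⟩
      · simp; omega
      · have : k' + 6 * (N - i) - ((Exp.reg v).succ.cost + 1) - (6 * (N - (i + 1)) + 3) = k' := by
          simp; omega
        rw [this]
        simpa [h1] using h3
    · have hi' : i = N := by
        have : ¬ i < N := by simpa [hvi, hn] using hb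
        omega
      subst hi'
      refine hQ _ _ hn ?_
      convert hI using 1
      simp

/-! ### Preference lists in memory and the cross positions -/

namespace AlmostStable

open Ram

/-- Symmetric lists of length at most two: `P a p` is the agent in position `p` of the list of
`a`, which has length `L a`. -/
structure Lists (n : ℕ) (L : ℕ → ℕ) (P : ℕ → ℕ → ℕ) : Prop where
  len_le : ∀ a < n, L a ≤ 2
  lt : ∀ a < n, ∀ p < L a, P a p < n
  ne : ∀ a < n, ∀ p < L a, P a p ≠ a
  inj : ∀ a < n, ∀ p < L a, ∀ q < L a, P a p = P a q → p = q
  symm : ∀ a < n, ∀ p < L a, ∃ q < L (P a p), P (P a p) q = a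

/-- `X a p` is the position of `a` on the list of `P a p`. -/
structure CrossLists (n : ℕ) (L : ℕ → ℕ) (P X : ℕ → ℕ → ℕ) : Prop extends Lists n L P where
  X_lt : ∀ a < n, ∀ p < L a, X a p < L (P a p)
  P_X : ∀ a < n, ∀ p < L a, P (P a p) (X a p) = a

theorem CrossLists.X_X {n : ℕ} {L : ℕ → ℕ} {P X : ℕ → ℕ → ℕ} (h : CrossLists n L P X) {a p : ℕ}
    (ha : a < n) (hp : p < L a) : X (P a p) (X a p) = p := by
  have h1 := h.lt a ha p hp
  have h2 := h.X_lt a ha p hp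
  have h3 := h.P_X a ha p hp
  have h4 := h.X_lt _ h1 _ h2
  have h5 := h.P_X _ h1 _ h2
  rw [h3] at h4 h5
  exact h.inj a ha _ h4 _ hp h5

/-- The memory holds the lists and the positions on them. -/
structure Env (n : ℕ) (L : ℕ → ℕ) (P X : ℕ → ℕ → ℕ) (σ : Store) : Prop where
  reg_n : σ.reg .n = n
  vec_len : σ.vec .len = L
  tab_pref : σ.tab .pref = P
  tab_cross : σ.tab .cross = X

section

variable {n : ℕ} {L : ℕ → ℕ} {P X : ℕ → ℕ → ℕ} {σ : Store}

@[simp] theorem env_set {v : Reg} {m : ℕ} (hv : v ≠ .n) :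
    Env n L P X (σ.set v m) ↔ Env n L P X σ :=
  ⟨fun h => ⟨by simpa [hv.symm] using h.1, h.2, h.3, h.4⟩,
    fun h => ⟨by simpa [hv.symm] using h.1, h.2, h.3, h.4⟩⟩

@[simp] theorem env_put {a : Vec} {i m : ℕ} (ha : a ≠ .len) :
    Env n L P X (σ.put a i m) ↔ Env n L P X σ :=
  ⟨fun h => ⟨h.1, by simpa [ha.symm] using h.2, h.3, h.4⟩,
    fun h => ⟨h.1, by simpa [ha.symm] using h.2, h.3, h.4⟩⟩

theorem Env.putTab (h : Env n L P X σ) (i j m : ℕ) :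
    Env n L P (Function.update X i (Function.update (X i) j m)) (σ.putTab .cross i j m) :=
  ⟨h.1, h.2, by simpa using h.3, by simp [h.4]⟩

/-- The positions have been computed for the first `i` agents, and the first `p` entries of the
list of agent `i`. -/
def CrossUpTo (L : ℕ → ℕ) (P X : ℕ → ℕ → ℕ) (i p : ℕ) : Prop :=
  ∀ a q, q < L a → a < i ∨ a = i ∧ q < p → X a q < L (P a q) ∧ P (P a q) (X a q) = a

theorem exec_crossPositions (hL : Lists n L P) {k k' : ℕ} (hk : k' + 100 * n + 100 ≤ k)
    (hσ : Env n L P X σ) :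
    Exec crossPositions (fun k σ => k' ≤ k ∧ ∃ X, CrossLists n L P X ∧ Env n L P X σ) k σ := by
  refine exec_forAgents (N := n) (by simp) (fun i k σ => k' + 80 * (n - i) ≤ k ∧
    ∃ X, Env n L P X σ ∧ CrossUpTo L P X i 0) hσ.reg_n (by omega) ?_ ?_ ?_
  · exact ⟨by omega, X, by simpa using hσ, by simp [CrossUpTo]⟩
  · rintro i hi k σ hx hn ⟨hk, X, hσ, hX⟩
    rw [exec_seq, exec_set]
    refine ⟨by simp; omega, ?_⟩
    refine Exec.while (fun k σ => σ.reg .x = i ∧ σ.reg .p ≤ L i ∧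
      k' + 80 * (n - (i + 1)) + 4 + 34 * (L i - σ.reg .p) ≤ k ∧
      ∃ X, Env n L P X σ ∧ CrossUpTo L P X i (σ.reg .p)) ?_ ?_
    · have := hL.len_le i hi
      refine ⟨by simpa using hx, by simp, by simp; omega, X, by simpa using hσ, by simpa using hX⟩
    · rintro k σ ⟨hx, hp, hk, X, hσ, hX⟩
      refine ⟨by simp; omega, fun hb => ?_, fun hb => ?_⟩
      · have hp' : σ.reg .p < L i := by simpa [hσ.vec_len, hx] using hb
        obtain ⟨q₀, hq₀, hPq⟩ := hL.symm i hi _ hp'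
        have hy := hL.lt i hi _ hp'
        have hLy := hL.len_le _ hy
        simp only [exec_seq, exec_set]
        refine ⟨by simp; omega, by simp; omega, ?_⟩
        -- By symmetry `i` occurs on the list of the other agent at some position `q₀`. The search
        -- cannot pass it, so `q₀ - q` bounds what remains to be done.
        refine Exec.while (fun k τ => τ.reg .x = i ∧ τ.reg .y = P i (σ.reg .p) ∧
          τ.reg .p = σ.reg .p ∧ τ.reg .q ≤ q₀ ∧ Env n L P X τ ∧
          k' + 80 * (n - (i + 1)) + 4 + 34 * (L i - (σ.reg .p + 1)) + 14 + 9 * (q₀ - τ.reg .q)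
            ≤ k) ?_ ?_
        · refine ⟨by simpa using hx, by simp [hσ.tab_pref, hx], by simp, by simp,
            by simpa using hσ, by simp; omega⟩
        · rintro k τ ⟨hx, hy, hp, hq, hτ, hk⟩
          refine ⟨by simp; omega, fun hb => ?_, fun hb => ?_⟩
          · have hne : P (P i (σ.reg .p)) (τ.reg .q) ≠ i := by
              simpa [hτ.tab_pref, hy, hx] using hb
            have : τ.reg .q ≠ q₀ := fun h => hne (h ▸ hPq)
            rw [exec_set]
            exact ⟨by simp; omega, by simpa using hx, by simpa using hy, by simpa using hp,
              by simp; omega, by simpa using hτ, by simp; omega⟩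
          · have he : P (P i (σ.reg .p)) (τ.reg .q) = i := by
              simpa [hτ.tab_pref, hy, hx] using hb
            simp only [exec_seq, exec_set, exec_putTab]
            refine ⟨by simp; omega, by simp; omega, by simpa using hx, by simp; omega,
              by simp; omega,
              Function.update X i (Function.update (X i) (σ.reg .p) (τ.reg .q)), ?_, ?_⟩
            · simpa [hx, hp] using hτ.putTab i (σ.reg .p) (τ.reg .q)
            · intro a q hqa h
              simp only [Exp.eval, hx, hp, Store.reg_putTab, Store.reg_set, if_true] at h ⊢
              by_cases hap : a = i ∧ q = σ.reg .p
              · obtain ⟨rfl, rfl⟩ := hap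
                simp only [Function.update_self]
                exact ⟨by omega, he⟩
              · have : Function.update X i (Function.update (X i) (σ.reg .p) (τ.reg .q)) a q =
                    X a q := by
                  simp only [Function.update_apply]
                  grind
                rw [this]
                exact hX a q hqa (by omega)
      · have hp' : σ.reg .p = L i := by
          have : ¬ σ.reg .p < L i := by simpa [hσ.vec_len, hx] using hb
          omega
        refine ⟨hx, hσ.reg_n, by simp; omega, X, by simpa using hσ, fun a q hqa h => ?_⟩
        refine hX a q hqa ?_
        by_cases ha : a = i
        · subst ha; omega
        · omega
  · rintro k σ hn ⟨hk, X, hσ, hX⟩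
    refine ⟨by omega, X, ⟨hL, fun a ha p hp => (hX a p hp (.inl ha)).1,
      fun a ha p hp => (hX a p hp (.inl ha)).2⟩, hσ⟩

end

end AlmostStable

/-! ### First phase of Irving's algorithm: proposals -/

namespace AlmostStable

open Ram

section

variable {n : ℕ} {L : ℕ → ℕ} {P X : ℕ → ℕ → ℕ}

/-- The state of the first phase of Irving's algorithm, where the agents in `U` still have to
propose. -/
structure Proposals (n : ℕ) (L : ℕ → ℕ) (P X : ℕ → ℕ → ℕ) (lm rm held : ℕ → ℕ) (U : ℕ → Prop) :
    Prop where
  lm_le : ∀ a < n, lm a ≤ L a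
  rm_le : ∀ a < n, rm a ≤ L a
  rejected : ∀ a < n, ∀ p < lm a, rm (P a p) ≤ X a p
  free : ∀ a < n, held a ≠ 1 → rm a = L a
  hold : ∀ a < n, held a = 1 → 0 < rm a ∧ lm (P a (rm a - 1)) = X a (rm a - 1) ∧
    lm (P a (rm a - 1)) < rm (P a (rm a - 1)) ∧ ¬ U (P a (rm a - 1))
  proposed : ∀ a < n, ¬ U a → lm a < rm a →
    held (P a (lm a)) = 1 ∧ rm (P a (lm a)) = X a (lm a) + 1

/-- The state after the first phase and between the rotations of the second phase of Irving's
algorithm: every agent with a nonempty reduced list is held by her first choice on it, and holds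
her last choice on it. -/
structure Reduced (n : ℕ) (L : ℕ → ℕ) (P X : ℕ → ℕ → ℕ) (lm rm : ℕ → ℕ) : Prop where
  lm_le : ∀ a < n, lm a ≤ L a
  rm_le : ∀ a < n, rm a ≤ L a
  rejected : ∀ a < n, ∀ p < lm a, rm (P a p) ≤ X a p
  full : ∀ a < n, rm a ≤ lm a → rm a = L a
  first : ∀ a < n, lm a < rm a →
    rm (P a (lm a)) = X a (lm a) + 1 ∧ lm (P a (lm a)) < rm (P a (lm a))
  last : ∀ a < n, lm a < rm a → lm (P a (rm a - 1)) = X a (rm a - 1) ∧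
    lm (P a (rm a - 1)) < rm (P a (rm a - 1))

namespace Proposals

variable {lm rm held : ℕ → ℕ} {U U' : ℕ → Prop}

theorem init (hlm : ∀ a < n, lm a = 0) (hrm : ∀ a < n, rm a = L a) (hheld : ∀ a < n, held a = 0)
    (hU : ∀ a < n, U a) : Proposals n L P X lm rm held U where
  lm_le a ha := by simp [hlm a ha]
  rm_le a ha := (hrm a ha).le
  rejected a ha p hp := by simp [hlm a ha] at hp
  free a ha _ := hrm a ha
  hold a ha h := by simp [hheld a ha] at h
  proposed a ha h := absurd (hU a ha) h

/-- Besides renaming the set of proposers, this allows an agent to retire from it once her reduced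
list is empty. -/
theorem mono (h : Proposals n L P X lm rm held U) (h1 : ∀ a < n, U' a → U a)
    (h2 : ∀ a < n, U a → U' a ∨ rm a ≤ lm a) (hL : CrossLists n L P X) :
    Proposals n L P X lm rm held U' where
  lm_le := h.lm_le
  rm_le := h.rm_le
  rejected := h.rejected
  free := h.free
  hold a ha h' := by
    obtain ⟨h3, h4, h5, h6⟩ := h.hold a ha h'
    have := h.rm_le a ha
    exact ⟨h3, h4, h5, fun h7 => h6 (h1 _ (hL.lt a ha _ (by omega)) h7)⟩
  proposed a ha hU hlt := by
    refine h.proposed a ha (fun h3 => ?_) hlt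
    rcases h2 a ha h3 with h4 | h4
    · exact hU h4
    · omega

/-- The agent `x` makes her next proposal. -/
structure Proposing (n : ℕ) (P X : ℕ → ℕ → ℕ) (lm rm : ℕ → ℕ) (U : ℕ → Prop) (x y q : ℕ) :
    Prop where
  lt : x < n
  mem : U x
  lm_lt : lm x < rm x
  eq_P : y = P x (lm x)
  eq_X : q = X x (lm x)

variable {x y q : ℕ}

/-- The last inequality says that `y` has not moved past `x`. Otherwise `rejected`, read from the
side of `y`, would make the reduced list of `x` empty. -/
theorem lm_le_of_proposing (h : Proposals n L P X lm rm held U) (hL : CrossLists n L P X)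
    (hx : Proposing n P X lm rm U x y q) :
    y < n ∧ y ≠ x ∧ q < L y ∧ P y q = x ∧ X y q = lm x ∧ lm y ≤ q := by
  obtain ⟨hxn, hxU, hlt, rfl, rfl⟩ := hx
  have h1 : lm x < L x := hlt.trans_le (h.rm_le x hxn)
  have h2 := hL.lt x hxn _ h1
  have h3 := hL.P_X x hxn _ h1
  have h4 := hL.X_X hxn h1
  refine ⟨h2, hL.ne x hxn _ h1, hL.X_lt x hxn _ h1, h3, h4, ?_⟩
  by_contra hc
  have := h.rejected _ h2 _ (not_le.1 hc)
  rw [h3, h4] at this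
  omega

theorem accept (h : Proposals n L P X lm rm held U) (hL : CrossLists n L P X)
    (hx : Proposing n P X lm rm U x y q) (hq : q < rm y) (hy : held y ≠ 1)
    (hU' : ∀ a, U' a ↔ U a ∧ a ≠ x) :
    Proposals n L P X lm (Function.update rm y (q + 1)) (Function.update held y 1) U' := by
  obtain ⟨h1, h2, h3, h4, h5, h6⟩ := h.lm_le_of_proposing hL hx
  obtain ⟨hxn, hxU, hlt, hP, hX⟩ := hx
  have hle : ∀ a, Function.update rm y (q + 1) a ≤ rm a := fun a => by
    simp only [Function.update_apply]
    split_ifs with e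
    · subst e; omega
    · exact le_rfl
  refine ⟨h.lm_le, fun a ha => (hle a).trans (h.rm_le a ha),
    fun a ha p hp => (hle _).trans (h.rejected a ha p hp), fun a ha h' => ?_,
    fun a ha h' => ?_, fun a ha hUa hla => ?_⟩
  · by_cases e : a = y
    · simp [e] at h'
    · simp only [Function.update_apply, if_neg e] at h' ⊢
      exact h.free a ha h'
  · by_cases e : a = y
    · subst e
      simp only [Function.update_self, Nat.add_sub_cancel, h4, h5]
      rw [Function.update_of_ne h2.symm]
      exact ⟨by omega, trivial, hlt, by simp [hU']⟩
    · simp only [Function.update_apply, if_neg e] at h' ⊢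
      obtain ⟨g1, g2, g3, g4⟩ := h.hold a ha h'
      refine ⟨g1, g2, ?_, fun g => g4 ((hU' _).1 g).1⟩
      split_ifs with e'
      · rw [e']; omega
      · exact g3
  · by_cases e : a = x
    · subst e
      rw [← hP, ← hX]
      simp
    · obtain ⟨g1, g2⟩ := h.proposed a ha (fun g => hUa ((hU' a).2 ⟨g, e⟩)) (hla.trans_le (hle a))
      have : P a (lm a) ≠ y := fun e' => hy (e' ▸ g1)
      simp only [Function.update_of_ne this]
      exact ⟨g1, g2⟩

/-- The displaced agent `z` was not waiting to propose, while `x` was, so they differ. Hence `x`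
stands strictly before `z` on the list of `y`, cutting the list behind `x` removes `z`, and `z`
takes over the role of proposer. -/
theorem replace (h : Proposals n L P X lm rm held U) (hL : CrossLists n L P X)
    (hx : Proposing n P X lm rm U x y q) (hq : q < rm y) (hy : held y = 1) {z : ℕ}
    (hz : z = P y (rm y - 1)) (hU' : ∀ a, U' a ↔ a = z ∨ U a ∧ a ≠ x) :
    z < n ∧ lm z < L z ∧ ¬ U z ∧ Proposals n L P X (Function.update lm z (lm z + 1))
      (Function.update rm y (q + 1)) held U' := by
  obtain ⟨h1, h2, h3, h4, h5, h6⟩ := h.lm_le_of_proposing hL hx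
  obtain ⟨hxn, hxU, hlt, hP, hX⟩ := hx
  obtain ⟨f1, f2, f3, f4⟩ := h.hold y h1 hy
  have f5 : rm y - 1 < L y := by have := h.rm_le y h1; omega
  have hzn := hL.lt y h1 _ f5
  have hzy := hL.ne y h1 _ f5
  have hPz := hL.P_X y h1 _ f5
  have hXz := hL.X_X h1 f5
  rw [← hz] at f2 f3 f4 hzn hzy hPz hXz
  rw [← f2] at hPz hXz
  have hzx : x ≠ z := fun e => f4 (e ▸ hxU)
  have hq' : q + 1 < rm y := by
    by_contra hc
    have : q = rm y - 1 := by omega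
    rw [this, ← hz] at h4
    exact hzx h4.symm
  have hlz : lm z < L z := f3.trans_le (h.rm_le z hzn)
  have hle : ∀ a, Function.update rm y (q + 1) a ≤ rm a := fun a => by
    simp only [Function.update_apply]
    split_ifs with e
    · subst e; omega
    · exact le_rfl
  refine ⟨hzn, hlz, f4, fun a ha => ?_, fun a ha => (hle a).trans (h.rm_le a ha),
    fun a ha p hp => ?_, fun a ha h' => ?_, fun a ha h' => ?_, fun a ha hUa hla => ?_⟩
  · simp only [Function.update_apply]
    split_ifs with e
    · subst e; omega
    · exact h.lm_le a ha
  · by_cases hp' : p < lm a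
    · exact (hle _).trans (h.rejected a ha p hp')
    · have e : a = z := by
        by_contra e
        rw [Function.update_of_ne e] at hp
        exact hp' hp
      subst e
      rw [Function.update_self] at hp
      have : p = lm a := by omega
      rw [this, hPz, hXz, Function.update_self]
      omega
  · by_cases e : a = y
    · exact absurd (e ▸ hy) h'
    · simp only [Function.update_apply, if_neg e]
      exact h.free a ha h'
  · by_cases e : a = y
    · subst e
      simp only [Function.update_self, Nat.add_sub_cancel, h4, h5]
      rw [Function.update_of_ne h2.symm, Function.update_of_ne hzx]
      exact ⟨by omega, rfl, hlt, by simp [hU', hzx]⟩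
    · rw [Function.update_of_ne e]
      obtain ⟨g1, g2, g3, g4⟩ := h.hold a ha h'
      have g5 := hL.P_X a ha (rm a - 1) (by have := h.rm_le a ha; omega)
      have g6 : P a (rm a - 1) ≠ z := fun e' => by
        rw [← g2, e', hPz] at g5
        exact e g5.symm
      rw [Function.update_of_ne g6]
      refine ⟨g1, g2, ?_, fun g => ?_⟩
      · simp only [Function.update_apply]
        split_ifs with e'
        · rw [e']; omega
        · exact g3
      · rcases (hU' _).1 g with g | g
        · exact g6 g
        · exact g4 g.1
  · have hUa' : a ≠ z ∧ (U a → a = x) := by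
      rw [hU'] at hUa
      tauto
    rw [Function.update_of_ne hUa'.1] at hla ⊢
    by_cases e : a = x
    · subst e
      rw [← hP, ← hX]
      simp [hy]
    · obtain ⟨g1, g2⟩ := h.proposed a ha (fun g => e (hUa'.2 g)) (hla.trans_le (hle a))
      have : P a (lm a) ≠ y := fun e' => by
        have g3 := hL.P_X a ha (lm a) (by have := h.rm_le a ha; have := hle a; omega)
        rw [e'] at g2 g3
        have g4 : rm y - 1 = X a (lm a) := by omega
        rw [g4, g3] at hz
        exact hUa'.1 hz.symm
      rw [Function.update_of_ne this]
      exact ⟨g1, g2⟩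

theorem refuse (h : Proposals n L P X lm rm held U)
    (hx : Proposing n P X lm rm U x y q) (hq : rm y ≤ q) :
    lm x < L x ∧ Proposals n L P X (Function.update lm x (lm x + 1)) rm held U := by
  obtain ⟨hxn, hxU, hlt, hP, hX⟩ := hx
  have hlx : lm x < L x := hlt.trans_le (h.rm_le x hxn)
  refine ⟨hlx, fun a ha => ?_, h.rm_le, fun a ha p hp => ?_, h.free, fun a ha h' => ?_,
    fun a ha hUa hla => ?_⟩
  · simp only [Function.update_apply]
    split_ifs with e
    · subst e; omega
    · exact h.lm_le a ha
  · by_cases hp' : p < lm a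
    · exact h.rejected a ha p hp'
    · have e : a = x := by
        by_contra e
        rw [Function.update_of_ne e] at hp
        exact hp' hp
      subst e
      rw [Function.update_self] at hp
      have : p = lm a := by omega
      rwa [this, ← hP, ← hX]
  · obtain ⟨g1, g2, g3, g4⟩ := h.hold a ha h'
    rw [Function.update_of_ne fun e : P a (rm a - 1) = x => g4 (e.symm ▸ hxU)]
    exact ⟨g1, g2, g3, g4⟩
  · have e : a ≠ x := fun e => hUa (e ▸ hxU)
    rw [Function.update_of_ne e] at hla ⊢
    exact h.proposed a ha hUa hla

/-- Sending an agent to her first choice maps the agents with nonempty reduced lists injectively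
into themselves: the first choice holds only one proposal, and whoever holds one has a nonempty
list. By finiteness the map is onto, so each of these agents holds a proposal, which gives `last`.
An agent with an empty list holds none, so she has not cut her list off at the end, which gives
`full`. -/
theorem reduced (h : Proposals n L P X lm rm held U) (hL : CrossLists n L P X)
    (hU : ∀ a < n, ¬ U a) : Reduced n L P X lm rm := by
  -- If the list of `a` were empty, `a` would have moved past the agent she holds. By `rejected` the
  -- list of that agent would be empty too, against `hold`.
  have hne : ∀ a < n, held a = 1 → lm a < rm a := by
    intro a ha h'
    obtain ⟨g1, g2, g3, -⟩ := h.hold a ha h'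
    by_contra hc
    have := h.rejected a ha (rm a - 1) (by omega)
    omega
  have hlt : ∀ a < n, lm a < rm a → lm a < L a := fun a ha h' => h'.trans_le (h.rm_le a ha)
  have hmaps : Set.MapsTo (fun a => P a (lm a)) ((Finset.range n).filter fun a => lm a < rm a)
      ((Finset.range n).filter fun a => lm a < rm a) := by
    intro a ha
    simp only [Finset.coe_filter, Finset.mem_range, Set.mem_ofPred_eq] at ha ⊢
    have := hL.lt a ha.1 _ (hlt a ha.1 ha.2)
    exact ⟨this, hne _ this (h.proposed a ha.1 (hU a ha.1) ha.2).1⟩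
  have hinj : Set.InjOn (fun a => P a (lm a)) ((Finset.range n).filter fun a => lm a < rm a) := by
    intro a ha b hb hab
    simp only [Finset.coe_filter, Finset.mem_range, Set.mem_ofPred_eq] at ha hb hab
    have g1 := (h.proposed a ha.1 (hU a ha.1) ha.2).2
    have g2 := (h.proposed b hb.1 (hU b hb.1) hb.2).2
    have g3 := hL.P_X a ha.1 _ (hlt a ha.1 ha.2)
    have g4 := hL.P_X b hb.1 _ (hlt b hb.1 hb.2)
    rw [hab, g2] at g1
    rw [hab, ← Nat.add_right_cancel g1] at g3
    exact g3.symm.trans g4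
  have hsurj := Finset.surjOn_of_injOn_of_card_le _ hmaps hinj le_rfl
  have hheld : ∀ a < n, lm a < rm a → held a = 1 := by
    intro a ha h'
    obtain ⟨b, hb, rfl⟩ := hsurj (show a ∈ (Finset.range n).filter fun a => lm a < rm a by
      simp [ha, h'])
    simp only [Finset.coe_filter, Finset.mem_range, Set.mem_ofPred_eq] at hb
    exact (h.proposed b hb.1 (hU b hb.1) hb.2).1
  refine ⟨h.lm_le, h.rm_le, h.rejected, fun a ha h' => h.free a ha fun h1 => ?_,
    fun a ha h' => ?_, fun a ha h' => ?_⟩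
  · have := hne a ha h1
    omega
  · have g := h.proposed a ha (hU a ha) h'
    exact ⟨g.2, hne _ (hL.lt a ha _ (hlt a ha h')) g.1⟩
  · have g := h.hold a ha (hheld a ha h')
    exact ⟨g.2.1, g.2.2.1⟩

end Proposals

/-- The number of rejections that are still possible. -/
def slack (n : ℕ) (lm : ℕ → ℕ) : ℕ := ∑ a ∈ Finset.range n, (2 - lm a)

theorem slack_update {lm : ℕ → ℕ} {x : ℕ} (hx : x < n) (h : lm x < 2) :
    slack n (Function.update lm x (lm x + 1)) + 1 = slack n lm := by
  have hx' : x ∈ Finset.range n := Finset.mem_range.2 hx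
  rw [slack, slack, ← Finset.add_sum_erase _ _ hx', ← Finset.add_sum_erase _ (fun a => 2 - lm a) hx',
    Finset.sum_congr rfl fun a ha => by rw [Function.update_of_ne (Finset.ne_of_mem_erase ha)],
    Function.update_self]
  omega

theorem slack_le (n : ℕ) (lm : ℕ → ℕ) : slack n lm ≤ 2 * n := by
  refine (Finset.sum_le_sum fun a _ => Nat.sub_le 2 (lm a)).trans ?_
  simp [mul_comm]

theorem exec_phaseOne (hL : CrossLists n L P X) {σ : Store} {k k' : ℕ}
    (hk : k' + 300 * n + 100 ≤ k) (hσ : Env n L P X σ) :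
    Exec phaseOne (fun k σ => k' ≤ k ∧ Env n L P X σ ∧ (∀ a < n, σ.vec .mark a = 0) ∧
      Reduced n L P X (σ.vec .lm) (σ.vec .rm)) k σ := by
  rw [phaseOne, exec_seq]
  refine exec_forAgents (N := n) (by simp) (fun i k σ => k' + 230 * n + 50 + 20 * (n - i) ≤ k ∧
    Env n L P X σ ∧ ∀ a < i, σ.vec .mark a = 0 ∧ σ.vec .lm a = 0 ∧ σ.vec .rm a = L a ∧
      σ.vec .held a = 0) hσ.reg_n (by omega) ⟨by omega, by simpa using hσ, by simp⟩ ?_ ?_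
  · rintro i hi k σ hx hn ⟨hk, hσ, h⟩
    simp only [exec_seq, exec_put]
    refine ⟨by simp; omega, by simp; omega, by simp; omega, by simp; omega, by simpa using hx,
      by simpa using hn, by simp; omega, by simpa using hσ, fun a ha => ?_⟩
    simp [Function.update_apply, hx, hσ.vec_len]
    by_cases e : a = i
    · simp [e]
    · simpa [e] using h a (by omega)
  · rintro k σ hn ⟨hk, hσ, h⟩
    -- Each pass of the inner loop either ends the search for this `s` or advances some `lm` by one.
    -- The latter is paid for by `slack`, which is at most `2 * n` at the start.
    refine exec_forAgents (N := n) (by simp) (fun i k σ => k' + 62 * (n - i) +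
        70 * slack n (σ.vec .lm) ≤ k ∧ Env n L P X σ ∧ (∀ a < n, σ.vec .mark a = 0) ∧
        Proposals n L P X (σ.vec .lm) (σ.vec .rm) (σ.vec .held) (fun a => i ≤ a))
      hσ.reg_n (by omega) ?_ ?_ ?_
    · refine ⟨?_, by simpa using hσ, by simpa using fun a ha => (h a ha).1,
        .init (by simpa using fun a ha => (h a ha).2.1) (by simpa using fun a ha => (h a ha).2.2.1)
          (by simpa using fun a ha => (h a ha).2.2.2) (by simp)⟩
      have := slack_le n (σ.vec .lm)
      simp
      omega
    · rintro i hi k σ hs hn ⟨hk, hσ, hm, h⟩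
      simp only [exec_seq, exec_set]
      refine ⟨by simp; omega, by simp; omega, ?_⟩
      refine Exec.while (fun k σ => σ.reg .s = i ∧ Env n L P X σ ∧ (∀ a < n, σ.vec .mark a = 0) ∧
        (σ.reg .go = 1 ∧ σ.reg .x < n ∧ σ.reg .x ≤ i ∧
          k' + 62 * (n - (i + 1)) + 70 * slack n (σ.vec .lm) + 56 ≤ k ∧
          Proposals n L P X (σ.vec .lm) (σ.vec .rm) (σ.vec .held)
            (fun a => a = σ.reg .x ∨ i + 1 ≤ a) ∨
        σ.reg .go = 0 ∧ k' + 62 * (n - (i + 1)) + 70 * slack n (σ.vec .lm) + 3 ≤ k ∧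
          Proposals n L P X (σ.vec .lm) (σ.vec .rm) (σ.vec .held) (fun a => i + 1 ≤ a))) ?_ ?_
      · refine ⟨by simpa using hs, by simpa using hσ, by simpa using hm, .inl ⟨by simp,
          by simpa [hs], by simp [hs], by simp; omega, ?_⟩⟩
        simp [hs]
        exact h.mono (fun a _ => by omega) (fun a _ => by omega) hL
      · rintro k σ ⟨hs, hσ, hm, ⟨hgo, hx, hxi, hk, h⟩ | ⟨hgo, hk, h⟩⟩
        · refine ⟨by simp; omega, fun _ => ?_, fun hb => by simp [hgo] at hb⟩
          simp only [exec_ite, exec_seq, exec_set, exec_put]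
          refine ⟨by simp; omega, fun hb => ?_, fun hb => ?_⟩
          · have hlt : σ.vec .lm (σ.reg .x) < σ.vec .rm (σ.reg .x) := by simpa using hb
            set x := σ.reg .x with hx_def
            have hpr : Proposals.Proposing n P X (σ.vec .lm) (σ.vec .rm)
                (fun a => a = x ∨ i + 1 ≤ a) x (P x (σ.vec .lm x)) (X x (σ.vec .lm x)) :=
              ⟨hx, .inl rfl, hlt, rfl, rfl⟩
            have hLx := hL.len_le x hx
            refine ⟨by simp; omega, by simp; omega, by simp; omega, fun hb => ?_, fun hb => ?_⟩
            · have hq : X x (σ.vec .lm x) < σ.vec .rm (P x (σ.vec .lm x)) := by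
                simpa [hσ.tab_pref, hσ.tab_cross, ← hx_def] using hb
              refine ⟨by simp; omega, by simp; omega, by simp; omega, fun hb => ?_, fun hb => ?_⟩
              · have hy : σ.vec .held (P x (σ.vec .lm x)) = 1 := by
                  simpa [hσ.tab_pref, hσ.tab_cross, ← hx_def] using hb
                obtain ⟨h1, h2, h3, h4⟩ := h.replace hL hpr hq hy rfl
                  (U' := fun a => a = P (P x (σ.vec .lm x))
                    (σ.vec .rm (P x (σ.vec .lm x)) - 1) ∨ i + 1 ≤ a) (fun a => by
                      constructor
                      · rintro (h | h)
                        · exact .inl h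
                        · exact .inr ⟨.inr h, by omega⟩
                      · rintro (h | ⟨h | h, h'⟩)
                        · exact .inl h
                        · exact absurd h h'
                        · exact .inr h)
                have h5 := slack_update h1 (h2.trans_le (hL.len_le _ h1))
                refine ⟨by simp; omega, by simp; omega, by simpa using hs, by simpa using hσ,
                  by simpa using hm, .inl ⟨by simpa using hgo, ?_⟩⟩
                simp [hσ.tab_pref, hσ.tab_cross, ← hx_def]
                exact ⟨h1, by omega, by omega, h4⟩
              · have hy : σ.vec .held (P x (σ.vec .lm x)) ≠ 1 := by
                  simpa [hσ.tab_pref, hσ.tab_cross, ← hx_def] using hb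
                have h4 := h.accept hL hpr hq hy (U' := fun a => i + 1 ≤ a) (fun a => by omega)
                refine ⟨by simp; omega, by simp; omega, by simpa using hs, by simpa using hσ,
                  by simpa using hm, .inr ⟨by simp, ?_⟩⟩
                simp [hσ.tab_pref, hσ.tab_cross, ← hx_def]
                exact ⟨by omega, h4⟩
            · have hq : σ.vec .rm (P x (σ.vec .lm x)) ≤ X x (σ.vec .lm x) := by
                simpa [hσ.tab_pref, hσ.tab_cross, ← hx_def] using hb
              obtain ⟨h2, h4⟩ := h.refuse hpr hq
              have h5 := slack_update hx (h2.trans_le hLx)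
              refine ⟨by simp; omega, by simpa using hs, by simpa using hσ,
                  by simpa using hm, .inl ⟨by simpa using hgo, ?_⟩⟩
              simp [← hx_def]
              exact ⟨by omega, by omega, by omega, h4⟩
          · have hge : σ.vec .rm (σ.reg .x) ≤ σ.vec .lm (σ.reg .x) := by simpa using hb
            refine ⟨by simp; omega, by simpa using hs, by simpa using hσ, by simpa using hm,
              .inr ⟨by simp, by simp; omega, ?_⟩⟩
            simp
            refine h.mono (fun a _ => .inr) (fun a _ h => ?_) hL
            rcases h with rfl | h
            · exact .inr hge
            · exact .inl h
        · refine ⟨by simp; omega, fun hb => by simp [hgo] at hb, fun _ => ?_⟩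
          exact ⟨hs, hσ.reg_n, by simp; omega, by simpa using hσ, by simpa using hm,
            by simpa using h⟩
    · rintro k σ hn ⟨hk, hσ, hm, h⟩
      exact ⟨by omega, hσ, hm, h.reduced hL (by simp)⟩

end

end AlmostStable

/-! ### Second phase of Irving's algorithm: rotations -/

namespace AlmostStable

open Ram

section

variable {n : ℕ} {L : ℕ → ℕ} {P X : ℕ → ℕ → ℕ} {lm rm lm' rm' : ℕ → ℕ}

/-- The reduced list of `a` has at least two entries. -/
def Active (n : ℕ) (lm rm : ℕ → ℕ) (a : ℕ) : Prop := a < n ∧ lm a + 1 < rm a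

/-- The number of agents whose reduced lists have at least two entries. -/
def activeCard (n : ℕ) (lm rm : ℕ → ℕ) : ℕ :=
  ((Finset.range n).filter fun a => lm a + 1 < rm a).card

theorem Reduced.active (h : Reduced n L P X lm rm) (hL : CrossLists n L P X) {a : ℕ}
    (ha : Active n lm rm a) : lm a = 0 ∧ rm a = 2 ∧ L a = 2 := by
  have := ha.2
  have := h.rm_le a ha.1
  have := hL.len_le a ha.1
  omega

/-- The second choice of `a` has `a` as her first choice. If she had no other entry left, `a` would
also be her last one, and then she would be the first choice of `a`. So she is active as well, and
on active agents first choice undoes second choice: they form disjoint cycles. -/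
theorem Reduced.active_second (h : Reduced n L P X lm rm) (hL : CrossLists n L P X) {a : ℕ}
    (ha : Active n lm rm a) :
    Active n lm rm (P a 1) ∧ P (P a 1) 0 = a ∧ X a 1 = 0 ∧ X (P a 1) 0 = 1 := by
  obtain ⟨h1, h2, h3⟩ := h.active hL ha
  have h4 := hL.lt a ha.1 1 (by omega)
  have h5 := hL.P_X a ha.1 1 (by omega)
  have h6 := hL.X_X ha.1 (show 1 < L a by omega)
  have h7 := h.last a ha.1 (by omega)
  simp only [h2, Nat.add_one_sub_one] at h7
  have h8 := h.rm_le _ h4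
  have h9 := hL.len_le _ h4
  have h10 := h.last _ h4 h7.2
  have h11 : lm (P a 1) ≠ rm (P a 1) - 1 := fun e => by
    rw [← e, h7.1, h5, h6] at h10
    omega
  have h12 : X a 1 = 0 := by omega
  rw [h12] at h5 h6
  exact ⟨⟨h4, by omega⟩, h5, h12, h6⟩

/-- The agent two places before `a` on a cycle on which everybody's first choice is the next
agent. -/
def twoBack (P : ℕ → ℕ → ℕ) (a : ℕ) : ℕ := P (P a 1) 1

theorem Reduced.active_twoBack (h : Reduced n L P X lm rm) (hL : CrossLists n L P X) {a : ℕ}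
    (ha : Active n lm rm a) : Active n lm rm (twoBack P a) :=
  (h.active_second hL (h.active_second hL ha).1).1

theorem Reduced.active_iterate (h : Reduced n L P X lm rm) (hL : CrossLists n L P X) {s : ℕ}
    (hs : Active n lm rm s) (i : ℕ) : Active n lm rm ((twoBack P)^[i] s) := by
  induction i with
  | zero => exact hs
  | succ i ih =>
    rw [Function.iterate_succ_apply']
    exact h.active_twoBack hL ih

theorem Reduced.twoBack_inj (h : Reduced n L P X lm rm) (hL : CrossLists n L P X) {a b : ℕ}
    (ha : Active n lm rm a) (hb : Active n lm rm b) (hab : twoBack P a = twoBack P b) : a = b := by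
  have ha1 := h.active_second hL ha
  have hb1 := h.active_second hL hb
  have ha2 := h.active_second hL ha1.1
  have hb2 := h.active_second hL hb1.1
  unfold twoBack at hab
  rw [← ha1.2.1, ← hb1.2.1, ← ha2.2.1, ← hb2.2.1, hab]

/-- The first `i` agents on the walk from `s` are distinct. -/
def DistinctUpTo (P : ℕ → ℕ → ℕ) (s i : ℕ) : Prop :=
  ∀ a < i, ∀ b < i, (twoBack P)^[a] s = (twoBack P)^[b] s → a = b

/-- The walk follows an injective map, so a repetition away from `s` could be pulled back by one
step. The walk therefore has no tail and closes up at its start. -/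
theorem Reduced.iterate_eq (h : Reduced n L P X lm rm) (hL : CrossLists n L P X) {s i j : ℕ}
    (hs : Active n lm rm s) (hd : DistinctUpTo P s i) (hj : j < i)
    (hij : (twoBack P)^[i] s = (twoBack P)^[j] s) : (twoBack P)^[i] s = s := by
  match i, j, hj with
  | _, 0, _ => exact hij
  | i + 1, j + 1, hj =>
    simp only [Function.iterate_succ_apply'] at hij
    have := hd _ (by omega) _ (by omega)
      (h.twoBack_inj hL (h.active_iterate hL hs i) (h.active_iterate hL hs j) hij)
    omega

theorem Reduced.image_subset (h : Reduced n L P X lm rm) (hL : CrossLists n L P X) {s : ℕ}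
    (hs : Active n lm rm s) (i : ℕ) : (Finset.range i).image (fun j => (twoBack P)^[j] s) ⊆
      (Finset.range n).filter fun a => lm a + 1 < rm a := by
  intro a ha
  obtain ⟨j, -, rfl⟩ := Finset.mem_image.1 ha
  have := h.active_iterate hL hs j
  exact Finset.mem_filter.2 ⟨Finset.mem_range.2 this.1, this.2⟩

theorem card_image_of_distinctUpTo {s i : ℕ} (hd : DistinctUpTo P s i) :
    ((Finset.range i).image fun j => (twoBack P)^[j] s).card = i := by
  rw [Finset.card_image_of_injOn, Finset.card_range]
  intro a ha b hb hab
  exact hd a (by simpa using ha) b (by simpa using hb) hab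

theorem Reduced.le_activeCard (h : Reduced n L P X lm rm) (hL : CrossLists n L P X) {s i : ℕ}
    (hs : Active n lm rm s) (hd : DistinctUpTo P s i) : i ≤ activeCard n lm rm := by
  rw [← card_image_of_distinctUpTo hd]
  exact Finset.card_le_card (h.image_subset hL hs i)

/-- The effect of moving the first `i` agents on the walk from `s` on to their second choices. -/
structure Eliminated (P : ℕ → ℕ → ℕ) (lm rm : ℕ → ℕ) (s i : ℕ) (lm' rm' : ℕ → ℕ) : Prop where
  lm_eq : ∀ j < i, lm' ((twoBack P)^[j] s) = 1
  lm_ne : ∀ a, (∀ j < i, a ≠ (twoBack P)^[j] s) → lm' a = lm a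
  rm_eq : ∀ j < i, rm' (P ((twoBack P)^[j] s) 1) = 1
  rm_ne : ∀ a, (∀ j < i, a ≠ P ((twoBack P)^[j] s) 1) → rm' a = rm a

theorem Eliminated.zero (s : ℕ) : Eliminated P lm rm s 0 lm rm :=
  ⟨by simp, by simp, by simp, by simp⟩

theorem Eliminated.succ {s i : ℕ} (h : Eliminated P lm rm s i lm' rm') :
    Eliminated P lm rm s (i + 1) (Function.update lm' ((twoBack P)^[i] s) 1)
      (Function.update rm' (P ((twoBack P)^[i] s) 1) 1) where
  lm_eq j hj := by
    rw [Function.update_apply]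
    split_ifs with e
    · rfl
    · exact h.lm_eq j ((Nat.lt_succ_iff_lt_or_eq.1 hj).resolve_right fun e' => e (e' ▸ rfl))
  lm_ne a ha := by
    rw [Function.update_of_ne (ha i i.lt_succ_self)]
    exact h.lm_ne a fun j hj => ha j (hj.trans i.lt_succ_self)
  rm_eq j hj := by
    rw [Function.update_apply]
    split_ifs with e
    · rfl
    · exact h.rm_eq j ((Nat.lt_succ_iff_lt_or_eq.1 hj).resolve_right fun e' => e (e' ▸ rfl))
  rm_ne a ha := by
    rw [Function.update_of_ne (ha i i.lt_succ_self)]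
    exact h.rm_ne a fun j hj => ha j (hj.trans i.lt_succ_self)

section

variable {s m : ℕ} (hL : CrossLists n L P X) (h : Reduced n L P X lm rm) (hs : Active n lm rm s)
  (hm : 0 < m) (hsm : (twoBack P)^[m] s = s) (hE : Eliminated P lm rm s m lm' rm')
include hL h hs hE

theorem Eliminated.le {a : ℕ} (ha : a < n) : lm a ≤ lm' a ∧ rm' a ≤ rm a := by
  constructor
  · by_cases hO : ∃ j < m, a = (twoBack P)^[j] s
    · obtain ⟨j, hj, rfl⟩ := hO
      rw [hE.lm_eq j hj, (h.active hL (h.active_iterate hL hs j)).1]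
      omega
    · push Not at hO
      exact (hE.lm_ne a hO).ge
  · by_cases hQ : ∃ j < m, a = P ((twoBack P)^[j] s) 1
    · obtain ⟨j, hj, rfl⟩ := hQ
      rw [hE.rm_eq j hj,
        (h.active hL (h.active_second hL (h.active_iterate hL hs j)).1).2.1]
      omega
    · push Not at hQ
      exact (hE.rm_ne a hQ).le

/-- The `m` distinct agents on the walk cease to be active because their `lm` becomes one, and
nobody becomes active. This pays for the time spent on the rotation. -/
theorem Eliminated.activeCard_le (hd : DistinctUpTo P s m) :
    activeCard n lm' rm' + m ≤ activeCard n lm rm := by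
  have h1 := h.image_subset hL hs m
  have h2 := card_image_of_distinctUpTo hd
  have h3 := Finset.card_sdiff_add_card_eq_card h1
  rw [h2] at h3
  rw [activeCard, activeCard, ← h3]
  refine Nat.add_le_add_right (Finset.card_le_card fun a ha => ?_) _
  simp only [Finset.mem_filter, Finset.mem_range, Finset.mem_sdiff, Finset.mem_image] at ha ⊢
  have h4 := hE.le hL h hs ha.1
  refine ⟨⟨ha.1, by omega⟩, ?_⟩
  rintro ⟨j, hj, rfl⟩
  have h5 := hE.lm_eq j hj
  have h6 := (h.active hL (h.active_iterate hL hs j)).2.1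
  omega

include hm hsm

/-- Let `O` be the agents on the rotation and `Q` their second choices. An agent in both would have
an empty list, which `hne` excludes, so the cycle is even and `O` and `Q` alternate on it. Agents of
`O` keep just their second choice, in `Q`, and agents of `Q` just their first choice, in `O`. Nobody
off the cycle has a remaining first or last choice on it. -/
theorem Eliminated.reduced
    (hne : ∀ j < m, lm' ((twoBack P)^[j] s) < rm' ((twoBack P)^[j] s)) :
    Reduced n L P X lm' rm' := by
  set O : ℕ → Prop := fun a => ∃ j < m, a = (twoBack P)^[j] s
  set Q : ℕ → Prop := fun a => ∃ j < m, a = P ((twoBack P)^[j] s) 1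
  have hact := h.active_iterate hL hs
  have hOQ : ∀ a, O a → ¬ Q a := by
    rintro a ⟨j, hj, e⟩ ⟨i, hi, e'⟩
    have h1 := hne j hj
    rw [hE.lm_eq j hj, ← e, e', hE.rm_eq i hi] at h1
    omega
  have hsucc : ∀ j, twoBack P ((twoBack P)^[j] s) = (twoBack P)^[j + 1] s := fun j =>
    (Function.iterate_succ_apply' (twoBack P) j s).symm
  have hO1 : ∀ a, O a → O (twoBack P a) := by
    rintro a ⟨j, hj, rfl⟩
    rw [hsucc]
    rcases Nat.lt_or_ge (j + 1) m with h1 | h1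
    · exact ⟨j + 1, h1, rfl⟩
    · have : j + 1 = m := by omega
      exact ⟨0, hm, by rw [this, hsm]; rfl⟩
  have hO2 : ∀ a, O a → ∃ b, O b ∧ twoBack P b = a := by
    rintro a ⟨j, hj, rfl⟩
    obtain rfl | hj0 := Nat.eq_zero_or_pos j
    · refine ⟨_, ⟨m - 1, by omega, rfl⟩, ?_⟩
      rw [hsucc, Nat.sub_add_cancel hm, hsm]
      rfl
    · refine ⟨_, ⟨j - 1, by omega, rfl⟩, ?_⟩
      rw [hsucc, Nat.sub_add_cancel hj0]
  have hOa : ∀ a, O a → Active n lm rm a := by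
    rintro a ⟨j, -, rfl⟩
    exact hact j
  have hO : ∀ a, O a → Active n lm rm a ∧ Q (P a 1) ∧ Q (P a 0) ∧ X a 0 = 1 ∧ X a 1 = 0 ∧
      lm' a = 1 ∧ rm' a = 2 := by
    intro a ha
    have h1 := hOa a ha
    obtain ⟨b, hb, rfl⟩ := hO2 a ha
    have h2 := h.active_second hL (hOa b hb)
    have h3 := h.active_second hL h2.1
    have h4 := h.active_second hL h1
    refine ⟨h1, ?_, ?_, h3.2.2.2, h4.2.2.1, ?_, ?_⟩
    · obtain ⟨j, hj, e⟩ := ha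
      exact ⟨j, hj, by rw [e]⟩
    · obtain ⟨j, hj, rfl⟩ := hb
      exact ⟨j, hj, h3.2.1⟩
    · obtain ⟨j, hj, e⟩ := ha
      rw [e, hE.lm_eq j hj]
    · rw [hE.rm_ne, (h.active hL h1).2.1]
      exact fun j hj e => hOQ _ ha ⟨j, hj, e⟩
  have hQ : ∀ a, Q a → Active n lm rm a ∧ O (P a 1) ∧ O (P a 0) ∧ X a 0 = 1 ∧ X a 1 = 0 ∧
      lm' a = 0 ∧ rm' a = 1 := by
    intro a ha
    have ha' := ha
    obtain ⟨j, hj, rfl⟩ := ha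
    have h2 := h.active_second hL (hact j)
    have h3 := h.active_second hL h2.1
    have hj' : O ((twoBack P)^[j] s) := ⟨j, hj, rfl⟩
    refine ⟨h2.1, hO1 _ hj', by rwa [h2.2.1], h2.2.2.2, h3.2.2.1, ?_, hE.rm_eq j hj⟩
    rw [hE.lm_ne, (h.active hL h2.1).1]
    exact fun i hi e => hOQ _ ⟨i, hi, e⟩ ha'
  have hlm : ∀ a, ¬ O a → lm' a = lm a := fun a ha =>
    hE.lm_ne a fun j hj e => ha ⟨j, hj, e⟩
  have hrm : ∀ a, ¬ Q a → rm' a = rm a := fun a ha =>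
    hE.rm_ne a fun j hj e => ha ⟨j, hj, e⟩
  have hle : ∀ a < n, rm' a ≤ rm a := fun a ha => (hE.le hL h hs ha).2
  clear_value O Q
  refine ⟨fun a ha => ?_, fun a ha => (hle a ha).trans (h.rm_le a ha), fun a ha p hp => ?_,
    fun a ha hla => ?_, fun a ha hla => ?_, fun a ha hla => ?_⟩
  · by_cases ho : O a
    · obtain ⟨h1, -, -, -, -, h2, -⟩ := hO a ho
      rw [h2, (h.active hL h1).2.2]
      omega
    · rw [hlm a ho]
      exact h.lm_le a ha
  · by_cases ho : O a
    · obtain ⟨h1, -, h3, h4, -, h2, -⟩ := hO a ho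
      have : p = 0 := by omega
      rw [this, h4, (hQ _ h3).2.2.2.2.2.2]
    · rw [hlm a ho] at hp
      have h1 := h.lm_le a ha
      exact (hle _ (hL.lt a ha p (by omega))).trans (h.rejected a ha p hp)
  · by_cases ho : O a
    · have := hO a ho; omega
    by_cases hq : Q a
    · have := hQ a hq; omega
    rw [hlm a ho, hrm a hq] at hla
    rw [hrm a hq]
    exact h.full a ha hla
  · by_cases ho : O a
    · obtain ⟨h1, h2, -, -, h3, h4, h5⟩ := hO a ho
      have h6 := hQ _ h2
      rw [h4]
      omega
    by_cases hq : Q a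
    · obtain ⟨h1, -, h2, h3, -, h4, h5⟩ := hQ a hq
      have h6 := hO _ h2
      rw [h4]
      omega
    rw [hlm a ho, hrm a hq] at hla
    rw [hlm a ho]
    obtain ⟨h1, h2⟩ := h.first a ha hla
    by_cases ho' : O (P a (lm a))
    · obtain ⟨h3, -, -, -, -, h4, h5⟩ := hO _ ho'
      have := h.active hL h3
      omega
    rw [hlm _ ho']
    by_cases hq' : Q (P a (lm a))
    · obtain ⟨h3, h4, -⟩ := hQ _ hq'
      have h5 := h.active hL h3
      have h6 := hL.P_X a ha (lm a) (by have := h.rm_le a ha; omega)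
      have h7 : X a (lm a) = 1 := by omega
      rw [h7] at h6
      exact absurd (h6 ▸ h4) ho
    rw [hrm _ hq']
    exact ⟨h1, h2⟩
  · by_cases ho : O a
    · obtain ⟨h1, h2, -, -, h3, h4, h5⟩ := hO a ho
      have h6 := hQ _ h2
      rw [h5]
      simp only [Nat.add_one_sub_one]
      omega
    by_cases hq : Q a
    · obtain ⟨h1, -, h2, h3, -, h4, h5⟩ := hQ a hq
      have h6 := hO _ h2
      rw [h5]
      simp only [Nat.sub_self]
      omega
    rw [hlm a ho, hrm a hq] at hla
    rw [hrm a hq]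
    obtain ⟨h1, h2⟩ := h.last a ha hla
    by_cases ho' : O (P a (rm a - 1))
    · obtain ⟨h3, -, h4, -⟩ := hO _ ho'
      have h5 := h.active hL h3
      have h6 := hL.P_X a ha (rm a - 1) (by have := h.rm_le a ha; omega)
      have h7 : X a (rm a - 1) = 0 := by omega
      rw [h7] at h6
      exact absurd (h6 ▸ h4) hq
    rw [hlm _ ho']
    by_cases hq' : Q (P a (rm a - 1))
    · have := hQ _ hq'
      have := hlm _ ho'
      omega
    rw [hrm _ hq']
    exact ⟨h1, h2⟩

end

/-- There is a cycle of odd length on which everybody's first choice is the next agent, and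
everybody's second choice is the previous one. -/
def OddParty (n : ℕ) (L : ℕ → ℕ) (P : ℕ → ℕ → ℕ) : Prop :=
  ∃ A : ℕ → Prop, (∀ a, A a → a < n ∧ L a = 2 ∧ A (P a 1) ∧ P (P a 1) 0 = a) ∧
    ∃ s i j, A s ∧ (twoBack P)^[i] s = P ((twoBack P)^[j] s) 1

/-- An emptied list belongs to an agent who is both on the walk and the second choice of somebody on
it. She is reached from `s` by an even and by an odd number of second choices. -/
theorem Eliminated.oddParty {s m : ℕ} (hL : CrossLists n L P X) (h : Reduced n L P X lm rm)
    (hs : Active n lm rm s) (hE : Eliminated P lm rm s m lm' rm') {i : ℕ} (hi : i < m)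
    (hne : rm' ((twoBack P)^[i] s) ≤ lm' ((twoBack P)^[i] s)) : OddParty n L P := by
  refine ⟨Active n lm rm, fun a ha => ?_, s, i, ?_⟩
  · have h1 := h.active hL ha
    have h2 := h.active_second hL ha
    exact ⟨ha.1, h1.2.2, h2.1, h2.2.1⟩
  · by_contra hc
    rw [hE.lm_eq i hi, hE.rm_ne _ fun j _ e => hc ⟨j, hs, e⟩,
      (h.active hL (h.active_iterate hL hs i)).2.1] at hne
    omega

theorem exec_while_false {b : Test} {c : Com} {Q : ℕ → Store → Prop} {k : ℕ} {σ : Store}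
    (hb : ¬ b.eval σ = true) (hk : b.cost ≤ k) (hQ : Q (k - b.cost) σ) :
    Exec (.while b c) Q k σ :=
  ⟨_, k - b.cost, _, .whileFalse (by simpa using hb), by omega, hQ⟩

/-- What the second phase keeps fixed while it searches and eliminates a rotation. -/
structure Fixed (n : ℕ) (L : ℕ → ℕ) (P X : ℕ → ℕ → ℕ) (s : ℕ) (σ : Store) : Prop where
  env : Env n L P X σ
  reg_s : σ.reg .s = s
  mark_le : ∀ a < n, σ.vec .mark a ≤ σ.reg .stamp

theorem exec_findRotation (hL : CrossLists n L P X) (h : Reduced n L P X lm rm) {s : ℕ}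
    (hs : Active n lm rm s) {σ : Store} {k k' : ℕ} (hk : k' + 60 * activeCard n lm rm + 20 ≤ k)
    (hσ : Fixed n L P X s σ) (hlm : σ.vec .lm = lm) (hrm : σ.vec .rm = rm)
    (hok : σ.reg .ok = 1) :
    Exec findRotation (fun k σ => ∃ m, 0 < m ∧ (twoBack P)^[m] s = s ∧ DistinctUpTo P s m ∧
      k' + 60 * (activeCard n lm rm - m) ≤ k ∧ Fixed n L P X s σ ∧ σ.vec .lm = lm ∧
      σ.vec .rm = rm ∧ σ.reg .ok = 1 ∧ σ.reg .x = s ∧ ∀ j < m,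
        σ.vec .sec ((twoBack P)^[j] s) = 1 ∧
        σ.vec .nxt ((twoBack P)^[j] s) = (twoBack P)^[j + 1] s) k σ := by
  simp only [findRotation, exec_seq, exec_set]
  refine ⟨by simp; omega, by simp; omega, ?_⟩
  refine Exec.while (fun k σ => ∃ i, DistinctUpTo P s i ∧
    k' + 60 * (activeCard n lm rm - i) + 5 ≤ k ∧ Fixed n L P X s σ ∧ σ.vec .lm = lm ∧
      σ.vec .rm = rm ∧ σ.reg .ok = 1 ∧ σ.reg .x = (twoBack P)^[i] s ∧
      (∀ a < n, σ.vec .mark a = σ.reg .stamp ↔ ∃ j < i, a = (twoBack P)^[j] s) ∧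
      ∀ j < i, σ.vec .sec ((twoBack P)^[j] s) = 1 ∧
        σ.vec .nxt ((twoBack P)^[j] s) = (twoBack P)^[j + 1] s) ?_ ?_
  -- All marks are at most the old value of `stamp`, so after the increment nobody counts as marked
  -- and the array need not be cleared.
  · refine ⟨0, by simp [DistinctUpTo], by simp; omega,
      ⟨by simpa using hσ.env, by simpa using hσ.reg_s, fun a ha => ?_⟩, by simpa using hlm,
      by simpa using hrm, by simpa using hok, by simpa using hσ.reg_s, fun a ha => ?_, by simp⟩
    · have := hσ.mark_le a ha
      simp
      omega
    · have := hσ.mark_le a ha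
      simp
      omega
  · rintro k σ ⟨i, hd, hk, hσ, hlm, hrm, hok, hx, hm, hi⟩
    have hact := h.active_iterate hL hs i
    refine ⟨by simp; omega, fun hb => ?_, fun hb => ?_⟩
    · have hne : ∀ j < i, (twoBack P)^[i] s ≠ (twoBack P)^[j] s := fun j hj e => by
        have := (hm _ hact.1).2 ⟨j, hj, e⟩
        rw [← hx] at this
        exact absurd this (by simpa using hb)
      have hd' : DistinctUpTo P s (i + 1) := by
        intro a ha b hb hab
        rcases Nat.lt_succ_iff_lt_or_eq.1 ha with ha | rfl <;>
          rcases Nat.lt_succ_iff_lt_or_eq.1 hb with hb | rfl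
        · exact hd a ha b hb hab
        · exact absurd hab.symm (hne a ha)
        · exact absurd hab (hne b hb)
        · rfl
      have hcard := h.le_activeCard hL hs hd'
      have h1 := h.active hL hact
      have h2 := h.active_second hL hact
      have h3 := h.active hL h2.1
      simp only [exec_seq, exec_set, exec_put]
      -- For an active agent, position `1` is still on the reduced list, so the search for the
      -- second choice stops at once.
      refine ⟨by simp; omega, by simp; omega, exec_while_false ?_ (by simp; omega) ?_⟩
      · simp [hlm, hrm, hx, hσ.env.tab_cross, hσ.env.tab_pref, h1, h2, h3]
      · simp only [exec_seq, exec_set, exec_put]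
        refine ⟨by simp; omega, by simp; omega, by simp; omega, by simp; omega, by simp; omega,
          i + 1, hd', by simp; omega, ⟨by simpa using hσ.env, by simpa using hσ.reg_s, ?_⟩,
          by simpa using hlm, by simpa using hrm, by simpa using hok, ?_, ?_, ?_⟩
        · intro a ha
          have := hσ.mark_le a ha
          simp only [Function.update_apply, Store.vec_set, Store.vec_put, Store.reg_set,
            Store.reg_put, reduceCtorEq, if_false, if_true, Exp.eval]
          split_ifs <;> omega
        · simp [hlm, hrm, hx, hσ.env.tab_pref, h1, h3, Function.iterate_succ_apply']
          rfl
        · intro a ha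
          have := hm a ha
          simp only [Function.update_apply, Store.vec_set, Store.vec_put, Store.reg_set,
            Store.reg_put, reduceCtorEq, if_false, if_true, Exp.eval, hx]
          constructor
          · intro h4
            split_ifs at h4 with e
            · exact ⟨i, by omega, e⟩
            · obtain ⟨j, hj, e⟩ := this.1 h4
              exact ⟨j, by omega, e⟩
          · rintro ⟨j, hj, e⟩
            split_ifs with e'
            · rfl
            · refine this.2 ⟨j, (Nat.lt_succ_iff_lt_or_eq.1 hj).resolve_right fun e'' => ?_, e⟩
              exact e' (e'' ▸ e)
        · intro j hj
          rcases Nat.lt_succ_iff_lt_or_eq.1 hj with hj | rfl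
          · have := hi j hj
            simpa [hx, (hne j hj).symm] using this
          · simp [hlm, hrm, hx, hσ.env.tab_pref, h1, h3, Function.iterate_succ_apply']
            rfl
    · have hb' : σ.vec .mark (σ.reg .x) = σ.reg .stamp := by simpa using hb
      rw [hx] at hb'
      obtain ⟨j, hj, e⟩ := (hm _ hact.1).1 hb'
      have hxs := h.iterate_eq hL hs hd hj e
      exact ⟨i, by omega, hxs, hd, by simp; omega, hσ, hlm, hrm, hok, hx.trans hxs, hi⟩

/-- The check for empty lists has been made for the first `i` agents on the walk from `s`. -/
def Checked (P : ℕ → ℕ → ℕ) (s m i : ℕ) (σ : Store) : Prop :=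
  σ.reg .ok = 1 ∧
    (∀ j < i, σ.vec .lm ((twoBack P)^[j] s) < σ.vec .rm ((twoBack P)^[j] s)) ∨
  σ.reg .ok = 0 ∧ ∃ j < m, σ.vec .rm ((twoBack P)^[j] s) ≤ σ.vec .lm ((twoBack P)^[j] s)

/-- The common end of the two branches of the emptiness check: move to the next agent, and stop on
returning to `s`. -/
theorem exec_checkNext {s m i k' : ℕ} (hi : i < m) (hnext : (twoBack P)^[i + 1] s = s ↔ i + 1 = m)
    {k : ℕ} {σ : Store} (hσ : Fixed n L P X s σ) (hr : σ.reg .r = s)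
    (hE : Eliminated P lm rm s m (σ.vec .lm) (σ.vec .rm))
    (hnxt : ∀ j < m, σ.vec .nxt ((twoBack P)^[j] s) = (twoBack P)^[j + 1] s)
    (hgo : σ.reg .go = 1) (hx : σ.reg .x = (twoBack P)^[i] s) (hk : k' + 25 * (m - i) - 10 ≤ k)
    (hok : Checked P s m (i + 1) σ) :
    Exec (Com.seq (Com.set .x (Exp.vec .nxt (Exp.reg .x)))
      (Com.ite (Test.eq (Exp.reg .x) (Exp.reg .r)) (Com.set .go 0) .skip))
      (fun k σ => Fixed n L P X s σ ∧ σ.reg .r = s ∧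
        Eliminated P lm rm s m (σ.vec .lm) (σ.vec .rm) ∧
        (∀ j < m, σ.vec .nxt ((twoBack P)^[j] s) = (twoBack P)^[j + 1] s) ∧
        ∃ i ≤ m, (σ.reg .go = 1 ∧ i < m ∧ σ.reg .x = (twoBack P)^[i] s ∧
            k' + 25 * (m - i) + 3 ≤ k ∨ σ.reg .go = 0 ∧ i = m ∧ k' + 3 ≤ k) ∧
          Checked P s m i σ) k σ := by
  have h3 := hnxt i hi
  simp only [exec_seq, exec_set, exec_ite, exec_skip]
  refine ⟨by simp; omega, by simp; omega, fun hb => ?_, fun hb => ?_⟩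
  · have hb' : (twoBack P)^[i + 1] s = s := by simpa [hx, h3, hr] using hb
    exact ⟨by simp; omega, ⟨by simpa using hσ.env, by simpa using hσ.reg_s,
      by simpa using hσ.mark_le⟩, by simpa using hr, by simpa using hE,
      by simpa using hnxt, i + 1, hi, .inr ⟨by simp, hnext.1 hb', by simp; omega⟩,
      by simpa [Checked] using hok⟩
  · have hb' : ¬ (twoBack P)^[i + 1] s = s := by simpa [hx, h3, hr] using hb
    have hi' : i + 1 < m := by
      have := mt hnext.2 hb'
      omega
    exact ⟨by simp; omega, ⟨by simpa using hσ.env, by simpa using hσ.reg_s,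
      by simpa using hσ.mark_le⟩, by simpa using hr, by simpa using hE,
      by simpa using hnxt, i + 1, hi, .inl ⟨by simpa using hgo, hi', by simp [hx, h3],
        by simp; omega⟩, by simpa [Checked] using hok⟩

theorem exec_eliminateRotation (hL : CrossLists n L P X) (h : Reduced n L P X lm rm) {s m : ℕ}
    (hs : Active n lm rm s) (hm : 0 < m) (hsm : (twoBack P)^[m] s = s)
    (hd : DistinctUpTo P s m) {σ : Store} {k k' : ℕ} (hk : k' + 60 * m + 20 ≤ k)
    (hσ : Fixed n L P X s σ) (hlm : σ.vec .lm = lm) (hrm : σ.vec .rm = rm)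
    (hok : σ.reg .ok = 1) (hx : σ.reg .x = s)
    (hnxt : ∀ j < m, σ.vec .sec ((twoBack P)^[j] s) = 1 ∧
        σ.vec .nxt ((twoBack P)^[j] s) = (twoBack P)^[j + 1] s) :
    Exec eliminateRotation (fun k σ => k' ≤ k ∧ Fixed n L P X s σ ∧
      Eliminated P lm rm s m (σ.vec .lm) (σ.vec .rm) ∧ Checked P s m m σ) k σ := by
  have hnext : ∀ j < m, (twoBack P)^[j + 1] s = s ↔ j + 1 = m := by
    intro j hj
    constructor
    · intro e
      by_contra hc
      have := hd (j + 1) (by omega) 0 hm e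
      omega
    · rintro rfl
      exact hsm
  simp only [eliminateRotation, exec_seq, exec_set]
  refine ⟨by simp; omega, by simp; omega, ?_⟩
  -- The eliminating round is charged `35` per agent. The part `25 * m` stays reserved for the
  -- second round, which looks for empty lists.
  refine Exec.while (fun k σ => Fixed n L P X s σ ∧ σ.reg .ok = 1 ∧ σ.reg .r = s ∧
    (∀ j < m, σ.vec .sec ((twoBack P)^[j] s) = 1 ∧
        σ.vec .nxt ((twoBack P)^[j] s) = (twoBack P)^[j + 1] s) ∧
    ((σ.reg .go = 1 ∧ ∃ i < m, σ.reg .x = (twoBack P)^[i] s ∧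
      k' + 25 * m + 35 * (m - i) + 10 ≤ k ∧
      Eliminated P lm rm s i (σ.vec .lm) (σ.vec .rm)) ∨
    (σ.reg .go = 0 ∧ σ.reg .x = s ∧ k' + 25 * m + 10 ≤ k ∧
      Eliminated P lm rm s m (σ.vec .lm) (σ.vec .rm)))) ?_ ?_
  · refine ⟨⟨by simpa using hσ.env, by simpa using hσ.reg_s, by simpa using hσ.mark_le⟩,
      by simpa using hok, by simpa using hx, by simpa using hnxt,
      .inl ⟨by simp, 0, hm, by simpa using hx, by simp; omega, ?_⟩⟩
    simp [hlm, hrm]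
    exact .zero s
  · rintro k σ ⟨hσ, hok, hr, hnxt, ⟨hgo, i, hi, hx, hk, hE⟩ | ⟨hgo, hx, hk, hE⟩⟩
    · refine ⟨by simp; omega, fun _ => ?_, fun hb => by simp [hgo] at hb⟩
      have h2 := h.active_second hL (h.active_iterate hL hs i)
      have h3 := hnxt i hi
      have h4 := hnext i hi
      simp only [exec_seq, exec_set, exec_put, exec_ite, exec_skip]
      have hE' := hE.succ
      refine ⟨by simp; omega, by simp; omega, by simp; omega, by simp; omega, by simp; omega,
        fun hb => ?_, fun hb => ?_⟩
      · have hb' : (twoBack P)^[i + 1] s = s := by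
          simpa [hσ.env.tab_pref, hσ.env.tab_cross, hx, h3.1, h3.2, h2.2.2.1, hr] using hb
        refine ⟨by simp; omega, ⟨by simpa using hσ.env, by simpa using hσ.reg_s,
          by simpa using hσ.mark_le⟩, by simpa using hok, by simpa using hr, by simpa using hnxt,
          .inr ⟨by simp, by simpa [hx, h3.2] using hb', by simp; omega, ?_⟩⟩
        rw [h4.1 hb'] at hE'
        simpa [hσ.env.tab_pref, hσ.env.tab_cross, hx, h3.1, h3.2, h2.2.2.1] using hE'
      · have hb' : ¬ (twoBack P)^[i + 1] s = s := by
          simpa [hσ.env.tab_pref, hσ.env.tab_cross, hx, h3.1, h3.2, h2.2.2.1, hr] using hb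
        have hi' : i + 1 < m := by
          have := mt h4.2 hb'
          omega
        refine ⟨by simp; omega, ⟨by simpa using hσ.env, by simpa using hσ.reg_s,
          by simpa using hσ.mark_le⟩, by simpa using hok, by simpa using hr, by simpa using hnxt,
          .inl ⟨by simpa using hgo, i + 1, hi', by simp [hx, h3.2], by simp; omega, ?_⟩⟩
        simpa [hσ.env.tab_pref, hσ.env.tab_cross, hx, h3.1, h3.2, h2.2.2.1] using hE'
    · refine ⟨by simp; omega, fun hb => by simp [hgo] at hb, fun _ => ?_⟩
      simp only [exec_seq, exec_set]
      refine ⟨by simp; omega, ?_⟩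
      refine Exec.while (fun k σ => Fixed n L P X s σ ∧ σ.reg .r = s ∧
        Eliminated P lm rm s m (σ.vec .lm) (σ.vec .rm) ∧
        (∀ j < m, σ.vec .nxt ((twoBack P)^[j] s) = (twoBack P)^[j + 1] s) ∧
        ∃ i ≤ m, (σ.reg .go = 1 ∧ i < m ∧ σ.reg .x = (twoBack P)^[i] s ∧
            k' + 25 * (m - i) + 3 ≤ k ∨ σ.reg .go = 0 ∧ i = m ∧ k' + 3 ≤ k) ∧
          Checked P s m i σ) ?_ ?_
      · exact ⟨⟨by simpa using hσ.env, by simpa using hσ.reg_s, by simpa using hσ.mark_le⟩,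
          by simpa using hr, by simpa using hE, by simpa using fun j hj => (hnxt j hj).2,
          0, by omega, .inl ⟨by simp, hm, by simpa using hx, by simp; omega⟩,
          .inl ⟨by simpa using hok, by simp⟩⟩
      · rintro k σ ⟨hσ, hr, hE, hnxt, i, -, ⟨hgo, hi, hx, hk⟩ | ⟨hgo, hi, hk⟩, hok⟩
        · refine ⟨by simp; omega, fun _ => ?_, fun hb => by simp [hgo] at hb⟩
          have h3 := hnxt i hi
          have h4 := hnext i hi
          rw [exec_seq, exec_ite, exec_skip, exec_set]
          refine ⟨by simp; omega, fun hb => ?_, fun hb => ?_⟩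
          · have hb' : σ.vec .lm ((twoBack P)^[i] s) < σ.vec .rm ((twoBack P)^[i] s) := by
              simpa [hx] using hb
            refine ⟨by simp; omega, exec_checkNext hi h4 hσ hr hE hnxt hgo hx (by simp; omega) ?_⟩
            refine hok.imp_left fun hok => ⟨hok.1, fun j hj => ?_⟩
            rcases Nat.lt_succ_iff_lt_or_eq.1 hj with hj | rfl
            · exact hok.2 j hj
            · exact hb'
          · have hb' : σ.vec .rm ((twoBack P)^[i] s) ≤ σ.vec .lm ((twoBack P)^[i] s) := by
              simpa [hx] using hb
            exact ⟨by simp; omega, exec_checkNext hi h4 ⟨by simpa using hσ.env, by simpa using hσ.reg_s,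
                by simpa using hσ.mark_le⟩ (by simpa using hr) (by simpa using hE)
                (by simpa using hnxt) (by simpa using hgo) (by simpa using hx) (by simp; omega)
                (.inr ⟨by simp, i, hi, by simpa using hb'⟩)⟩
        · refine ⟨by simp; omega, fun hb => by simp [hgo] at hb, fun _ => ?_⟩
          subst hi
          exact ⟨by simp; omega, hσ, hE, hok⟩

theorem activeCard_le (n : ℕ) (lm rm : ℕ → ℕ) : activeCard n lm rm ≤ n :=
  (Finset.card_filter_le _ _).trans (Finset.card_range n).le

theorem exec_phaseTwo (hL : CrossLists n L P X) {σ : Store} {k k' : ℕ}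
    (hk : k' + 400 * n + 100 ≤ k) (hσ : Env n L P X σ) (hmark : ∀ a < n, σ.vec .mark a = 0)
    (h : Reduced n L P X (σ.vec .lm) (σ.vec .rm)) :
    Exec phaseTwo (fun k σ => k' ≤ k ∧ Env n L P X σ ∧
      (σ.reg .ok = 1 ∧ Reduced n L P X (σ.vec .lm) (σ.vec .rm) ∧
        (∀ a < n, σ.vec .rm a ≤ σ.vec .lm a + 1) ∨
      σ.reg .ok = 0 ∧ OddParty n L P)) k σ := by
  simp only [phaseTwo, exec_seq, exec_set]
  refine ⟨by simp; omega, by simp; omega, by simp; omega, ?_⟩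
  -- Either `s` advances, or a rotation of length `m` is eliminated and `activeCard` falls by at
  -- least `m`. The two summands of the potential pay for these two cases.
  refine Exec.while (fun k σ => (∃ s ≤ n, Fixed n L P X s σ ∧
    (k' + 30 * (n - s) + 280 * activeCard n (σ.vec .lm) (σ.vec .rm) + 10 ≤ k ∧
      σ.reg .ok = 1 ∧ Reduced n L P X (σ.vec .lm) (σ.vec .rm) ∧
      (∀ a < s, σ.vec .rm a ≤ σ.vec .lm a + 1) ∨
      k' + 10 ≤ k ∧ σ.reg .ok = 0 ∧ OddParty n L P))) ?_ ?_
  · have := activeCard_le n (σ.vec .lm) (σ.vec .rm)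
    exact ⟨0, by omega, ⟨by simpa using hσ, by simp, by simpa using hmark⟩,
      .inl ⟨by simp; omega, by simp, by simpa using h, by simp⟩⟩
  · rintro k σ ⟨s, hsn, hσ, ⟨hk, hok, h, hs⟩ | ⟨hk, hok, h⟩⟩
    · refine ⟨by simp; omega, fun hb => ?_, fun hb => ?_⟩
      · have hsn' : s < n := by simpa [hσ.env.reg_n, hσ.reg_s, hok] using hb
        rw [exec_ite]
        refine ⟨by simp; omega, fun hb => ?_, fun hb => ?_⟩
        · have hb' : σ.vec .lm s + 1 < σ.vec .rm s := by simpa [hσ.reg_s] using hb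
          have hact : Active n (σ.vec .lm) (σ.vec .rm) s := ⟨hsn', hb'⟩
          generalize hlm : σ.vec .lm = lm at *
          generalize hrm : σ.vec .rm = rm at *
          have hpos : 1 ≤ activeCard n lm rm := h.le_activeCard hL hact (i := 1)
            fun a ha b hb _ => by omega
          rw [exec_seq]
          -- The `40` covers guards and overheads. The subtraction is not truncated, because `s`
          -- itself is active.
          refine (exec_findRotation hL h hact (k' := k' + 30 * (n - s) + 10 +
            220 * activeCard n lm rm - 40) (by simp; omega) hσ hlm hrm hok).mono ?_
          rintro k σ ⟨m, hm, hsm, hd, hk, hσ, hlm, hrm, hok, hx, hnxt⟩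
          have hmle := h.le_activeCard hL hact hd
          refine (exec_eliminateRotation hL h hact hm hsm hd (k' := k' + 30 * (n - s) + 10 +
            280 * (activeCard n lm rm - m)) (by omega) hσ hlm hrm hok hx hnxt).mono ?_
          rintro k σ ⟨hk, hσ, hE, ⟨hok, hne⟩ | ⟨hok, j, hj, hne⟩⟩
          · have hcard := hE.activeCard_le hL h hact hd
            refine ⟨s, hsn, hσ, .inl ⟨by omega, hok, hE.reduced hL h hact hm hsm hne,
              fun a ha => ?_⟩⟩
            have h1 := hE.le hL h hact (ha.trans hsn')
            have h2 := hs a ha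
            omega
          · exact ⟨s, hsn, hσ, .inr ⟨by omega, hok, hE.oddParty hL h hact hj hne⟩⟩
        · have hb' : σ.vec .rm s ≤ σ.vec .lm s + 1 := by simpa [hσ.reg_s] using hb
          rw [exec_set]
          refine ⟨by simp; omega, s + 1, hsn', ⟨by simpa using hσ.env, by simpa using hσ.reg_s,
            by simpa using hσ.mark_le⟩, .inl ⟨by simp; omega, by simpa using hok,
            by simpa using h, fun a ha => ?_⟩⟩
          rcases Nat.lt_succ_iff_lt_or_eq.1 ha with ha | rfl
          · simpa using hs a ha
          · simpa using hb'
      · have hsn' : s = n := by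
          have : ¬ s < n := by simpa [hσ.env.reg_n, hσ.reg_s, hok] using hb
          omega
        exact ⟨by simp; omega, hσ.env, .inl ⟨hok, h, hsn' ▸ hs⟩⟩
    · exact ⟨by simp; omega, fun hb => by simp [hok] at hb,
        fun _ => ⟨by simp; omega, hσ.env, .inr ⟨hok, h⟩⟩⟩

end

end AlmostStable

/-! ### The outcome of Irving's algorithm: a stable matching or an odd cycle -/

namespace AlmostStable

open Ram

section

variable {n : ℕ} {L : ℕ → ℕ} {P X : ℕ → ℕ → ℕ}

/-- `f` is the partner map of a matching. -/
structure IsMate (n : ℕ) (L : ℕ → ℕ) (P : ℕ → ℕ → ℕ) (f : ℕ → ℕ) : Prop where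
  lt : ∀ a < n, f a < n
  involutive : ∀ a < n, f (f a) = a
  acceptable : ∀ a < n, f a ≠ a → ∃ p < L a, P a p = f a

/-- The agent `a` and the agent in position `p` of her list block the matching. -/
def BlocksAt (P X : ℕ → ℕ → ℕ) (f : ℕ → ℕ) (a p : ℕ) : Prop :=
  (∀ q ≤ p, P a q ≠ f a) ∧ ∀ q ≤ X a p, P (P a p) q ≠ f (P a p)

/-- The matching that pairs everybody with the first choice on her reduced list. -/
def reducedMate (P : ℕ → ℕ → ℕ) (lm rm : ℕ → ℕ) (a : ℕ) : ℕ :=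
  if lm a < rm a then P a (lm a) else a

section

variable {lm rm : ℕ → ℕ} (hL : CrossLists n L P X) (h : Reduced n L P X lm rm)
include hL h

/-- Once every reduced list has at most one entry, first and last choice coincide, so being the
first choice is mutual. -/
theorem Reduced.isMate (hle : ∀ a < n, rm a ≤ lm a + 1) : IsMate n L P (reducedMate P lm rm) := by
  have hlt : ∀ a < n, lm a < rm a → lm a < L a := fun a ha h' => h'.trans_le (h.rm_le a ha)
  refine ⟨fun a ha => ?_, fun a ha => ?_, fun a ha hne => ?_⟩
  · unfold reducedMate
    split_ifs with h'
    · exact hL.lt a ha _ (hlt a ha h')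
    · exact ha
  · by_cases h' : lm a < rm a
    · have h1 := h.first a ha h'
      have h2 := hle _ (hL.lt a ha _ (hlt a ha h'))
      have h3 : lm (P a (lm a)) = X a (lm a) := by omega
      simp only [reducedMate, if_pos h', if_pos h1.2]
      rw [h3]
      exact hL.P_X a ha _ (hlt a ha h')
    · simp only [reducedMate, if_neg h']
  · by_cases h' : lm a < rm a
    · exact ⟨lm a, hlt a ha h', by simp only [reducedMate, if_pos h']⟩
    · simp only [reducedMate, if_neg h', ne_eq, not_true_eq_false] at hne

/-- Somebody whom `a` prefers to her partner lies before `lm a`, hence has cut `a` off. By `full`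
this agent has a nonempty list, so her own partner comes before `a` on it. -/
theorem Reduced.not_blocksAt {a p : ℕ} (ha : a < n) (hp : p < L a) :
    ¬ BlocksAt P X (reducedMate P lm rm) a p := by
  rintro ⟨h1, h2⟩
  have hpa : p < lm a := by
    by_cases h' : lm a < rm a
    · by_contra hc
      refine h1 (lm a) (not_lt.1 hc) ?_
      simp only [reducedMate, if_pos h']
    · have := h.full a ha (not_lt.1 h')
      omega
  have hb := hL.lt a ha p hp
  have h3 := h.rejected a ha p hpa
  have h4 := hL.X_lt a ha p hp
  have h5 : lm (P a p) < rm (P a p) := by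
    by_contra hc
    have := h.full _ hb (not_lt.1 hc)
    omega
  refine h2 (lm (P a p)) (by omega) ?_
  simp only [reducedMate, if_pos h5]

end

/-- In a stable matching everybody on the cycle is matched, as an unmatched `a` would block with her
second choice, who ranks `a` first. -/
theorem OddParty.exists_blocksAt (hL : CrossLists n L P X) (h : OddParty n L P) {f : ℕ → ℕ}
    (hf : IsMate n L P f) : ∃ a < n, ∃ p < L a, BlocksAt P X f a p := by
  by_contra! hb
  obtain ⟨A, hA, s, i, j, hs, hij⟩ := h
  have hmatched : ∀ a, A a → f a ≠ a := by
    intro a ha hfa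
    obtain ⟨h1, h2, h3, h4⟩ := hA a ha
    obtain ⟨g1, g2, -, -⟩ := hA _ h3
    refine hb _ g1 0 (by omega) ⟨fun q hq => ?_, fun q hq => ?_⟩
    · rw [Nat.le_zero.1 hq, h4]
      intro e
      have := hf.involutive _ g1
      rw [← e, hfa] at this
      exact hL.ne a h1 1 (by omega) this.symm
    · have hx := hL.X_lt _ g1 0 (by omega)
      rw [h4] at hx ⊢
      rw [hfa]
      exact hL.ne a h1 q (by omega)
  -- The second choice of `a` is matched either to `a`, her first choice, or to her own second
  -- choice. So being matched to one's second choice alternates along the cycle, which is impossible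
  -- if the cycle is odd.
  have hback : ∀ a, A a → (f (P a 1) = P (P a 1) 1 ↔ ¬ f a = P a 1) := by
    intro a ha
    obtain ⟨h1, h2, h3, h4⟩ := hA a ha
    obtain ⟨g1, g2, -, -⟩ := hA _ h3
    constructor
    · intro e e'
      have h5 := hf.involutive a h1
      rw [e', e, ← h4] at h5
      have := hL.inj _ g1 1 (by omega) 0 (by omega) (by rwa [h4] at h5 ⊢)
      omega
    · intro e
      obtain ⟨p, hp, hp'⟩ := hf.acceptable _ g1 (hmatched _ h3)
      obtain rfl | rfl : p = 0 ∨ p = 1 := by omega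
      · rw [h4] at hp'
        have := hf.involutive _ g1
        rw [← hp'] at this
        exact absurd this e
      · exact hp'.symm
  have hit : ∀ i, A ((twoBack P)^[i] s) ∧
      (f ((twoBack P)^[i] s) = P ((twoBack P)^[i] s) 1 ↔ f s = P s 1) := by
    intro i
    induction i with
    | zero => exact ⟨hs, Iff.rfl⟩
    | succ i ih =>
      rw [Function.iterate_succ_apply']
      have h1 := (hA _ ih.1).2.2.1
      refine ⟨(hA _ h1).2.2.1, ?_⟩
      rw [← ih.2, twoBack, hback _ h1, hback _ ih.1, not_not]
  have h1 := (hit i).2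
  rw [hij, hback _ (hit j).1, (hit j).2] at h1
  tauto

theorem exec_irving (hL : Lists n L P) {σ : Store} {k k' : ℕ}
    (hk : k' + 1000 * n + 1000 ≤ k) (hσ : Env n L P X σ) :
    Exec irving (fun k σ => k' ≤ k ∧ ∃ X, CrossLists n L P X ∧ Env n L P X σ ∧
      (σ.reg .ok = 1 ∧ IsMate n L P (σ.vec .mate) ∧
        (∀ a < n, ∀ p < L a, ¬ BlocksAt P X (σ.vec .mate) a p) ∨
      σ.reg .ok = 0 ∧ OddParty n L P)) k σ := by
  rw [irving, exec_seq]
  refine (exec_crossPositions hL (k' := k' + 900 * n + 900) (by omega) hσ).mono ?_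
  rintro k σ ⟨hk, X, hX, hσ⟩
  rw [exec_seq]
  refine Exec.mono (exec_phaseOne hX (k' := k' + 600 * n + 800) (by omega) hσ) ?_
  rintro k σ ⟨hk, hσ, hm, h⟩
  rw [exec_seq]
  refine Exec.mono (exec_phaseTwo hX (k' := k' + 100 * n + 100) (by omega) hσ hm h) ?_
  rintro k σ ⟨hk, hσ, ⟨hok, h, hle⟩ | ⟨hok, h⟩⟩
  · rw [exec_ite]
    refine ⟨by simp; omega, fun _ => ?_, fun hb => by simp [hok] at hb⟩
    generalize hlm : σ.vec .lm = lm at *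
    generalize hrm : σ.vec .rm = rm at *
    refine exec_forAgents (N := n) (by simp) (fun i k σ => k' + 20 * (n - i) ≤ k ∧
      Env n L P X σ ∧ σ.reg .ok = 1 ∧ σ.vec .lm = lm ∧ σ.vec .rm = rm ∧
      ∀ a < i, σ.vec .mate a = reducedMate P lm rm a) hσ.reg_n (by simp; omega)
      ⟨by simp; omega, by simpa using hσ, by simpa using hok, by simpa using hlm,
        by simpa using hrm, by simp⟩ ?_ ?_
    · rintro i hi k σ hx hn ⟨hk, hσ, hok, hlm, hrm, hi'⟩
      have key : ∀ m, m = reducedMate P lm rm i → ∀ a < i + 1,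
          Function.update (σ.vec .mate) i m a = reducedMate P lm rm a := by
        rintro _ rfl a ha
        rw [Function.update_apply]
        split_ifs with e
        · rw [e]
        · exact hi' a (by omega)
      rw [exec_ite, exec_put, exec_put]
      refine ⟨by simp; omega, fun hb => ⟨by simp; omega, by simpa using hx, by simpa using hn,
        by simp; omega, by simpa using hσ, by simpa using hok, by simpa using hlm,
        by simpa using hrm, ?_⟩, fun hb => ⟨by simp; omega, by simpa using hx, by simpa using hn,
        by simp; omega, by simpa using hσ, by simpa using hok, by simpa using hlm,
        by simpa using hrm, ?_⟩⟩
      · have hb' : lm i < rm i := by simpa [hlm, hrm, hx] using hb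
        simpa [hx, hlm, hσ.tab_pref] using key (P i (lm i)) (by rw [reducedMate, if_pos hb'])
      · have hb' : ¬ lm i < rm i := by simpa [hlm, hrm, hx] using hb
        simpa [hx] using key i (by rw [reducedMate, if_neg hb'])
    · rintro k σ hn ⟨hk, hσ, hok, -, -, hm⟩
      have h1 := h.isMate hX hle
      refine ⟨by omega, X, hX, hσ, .inl ⟨hok, ⟨fun a ha => ?_, fun a ha => ?_, fun a ha => ?_⟩,
        fun a ha p hp hb => h.not_blocksAt hX ha hp ?_⟩⟩
      · rw [hm a ha]
        exact h1.lt a ha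
      · rw [hm a ha, hm _ (h1.lt a ha)]
        exact h1.involutive a ha
      · rw [hm a ha]
        exact h1.acceptable a ha
      · have hlt := hX.lt a ha p hp
        unfold BlocksAt at hb ⊢
        rwa [hm a ha, hm _ hlt] at hb
  · rw [exec_ite, exec_skip]
    exact ⟨by simp; omega, fun hb => by simp [hok] at hb,
      fun _ => ⟨by simp; omega, by simp; omega, X, hX, hσ, .inr ⟨hok, h⟩⟩⟩

end

end AlmostStable

/-! ### Translation between memory contents and matchings -/

namespace SRI

open AlmostStable

variable {n : ℕ} {I : SRI n} {X : ℕ → ℕ → ℕ}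

theorem load_len (a : Fin n) : I.load.vec .len a = (I.pref a).length := by
  simp [load]

theorem load_pref (a : Fin n) {p : ℕ} (hp : p < (I.pref a).length) :
    I.load.tab .pref a p = ((I.pref a)[p] : Fin n) := by
  simp [load, hp]

theorem mem_pref_iff {a b : Fin n} :
    b ∈ I.pref a ↔ ∃ p < I.load.vec .len a, I.load.tab .pref a p = b := by
  rw [List.mem_iff_getElem, load_len]
  constructor
  · rintro ⟨p, hp, rfl⟩
    exact ⟨p, hp, load_pref a hp⟩
  · rintro ⟨p, hp, e⟩
    rw [load_pref a hp] at e
    exact ⟨p, hp, Fin.ext e⟩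

/-- Only positions `q ≤ p` within the list are inspected, so the zeros that `load` stores beyond its
end do no harm. The case where `c` is not on the list, such as `c = a`, is included. -/
theorem prefers_iff {a b c : Fin n} {p : ℕ} (hp : p < I.load.vec .len a)
    (hb : I.load.tab .pref a p = b) :
    I.Prefers a b c ↔ ∀ q ≤ p, I.load.tab .pref a q ≠ c := by
  rw [load_len] at hp
  have hidx : ∀ d q, (hq : q < (I.pref a).length) → I.load.tab .pref a q = (d : Fin n) →
      (I.pref a).idxOf d = q := by
    intro d q hq e
    rw [load_pref a hq] at e
    rw [← Fin.ext e]
    exact (I.nodup a).idxOf_getElem q hq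
  rw [Prefers, hidx b p hp hb]
  constructor
  · intro h q hq e
    have := hidx c q (by omega) e
    omega
  · intro h
    by_contra hc
    have hlt : (I.pref a).idxOf c < (I.pref a).length := by omega
    refine h _ (not_lt.1 hc) ?_
    rw [load_pref a hlt, List.getElem_idxOf]

theorem lists_load (hI : ∀ a, (I.pref a).length ≤ 2) :
    Lists n (I.load.vec .len) (I.load.tab .pref) where
  len_le a ha := (load_len ⟨a, ha⟩).trans_le (hI _)
  lt a ha p hp := by
    have h := load_pref ⟨a, ha⟩ (hp.trans_eq (load_len ⟨a, ha⟩))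
    dsimp only at h
    rw [h]
    exact Fin.is_lt _
  ne a ha p hp e := I.irrefl ⟨a, ha⟩ (mem_pref_iff.2 ⟨p, hp, e⟩)
  inj a ha p hp q hq e := by
    have hp' := hp.trans_eq (load_len ⟨a, ha⟩)
    have hq' := hq.trans_eq (load_len ⟨a, ha⟩)
    have h1 := load_pref ⟨a, ha⟩ hp'
    have h2 := load_pref ⟨a, ha⟩ hq'
    dsimp only at h1 h2
    rw [h1, h2] at e
    exact (I.nodup ⟨a, ha⟩).getElem_inj_iff.1 (Fin.ext e)
  symm a ha p hp := by
    have hp' := hp.trans_eq (load_len ⟨a, ha⟩)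
    have h1 := load_pref ⟨a, ha⟩ hp'
    dsimp only at h1
    rw [h1]
    exact mem_pref_iff.1 (I.symm ⟨a, ha⟩ _ (List.getElem_mem hp'))

theorem env_load : Env n (I.load.vec .len) (I.load.tab .pref) (I.load.tab .cross) I.load :=
  ⟨by simp [load], rfl, rfl, rfl⟩

/-- The partner map of a matching, on the natural numbers. -/
def Matching.mate (M : I.Matching) (a : ℕ) : ℕ := if h : a < n then M.partner ⟨a, h⟩ else a

theorem Matching.mate_coe (M : I.Matching) (a : Fin n) : M.mate a = M.partner a := by
  simp [Matching.mate]

theorem isMate_of_partner {M : I.Matching} {f : ℕ → ℕ} (hf : ∀ a : Fin n, f a = M.partner a) :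
    IsMate n (I.load.vec .len) (I.load.tab .pref) f where
  lt a ha := by
    rw [hf ⟨a, ha⟩]
    exact Fin.is_lt _
  involutive a ha := by rw [hf ⟨a, ha⟩, hf, M.involutive]
  acceptable a ha hne := by
    rw [hf ⟨a, ha⟩] at hne ⊢
    exact mem_pref_iff.1 (M.acceptable ⟨a, ha⟩ fun e => hne (congrArg Fin.val e))

theorem exists_matching {f : ℕ → ℕ} (hf : IsMate n (I.load.vec .len) (I.load.tab .pref) f) :
    ∃ M : I.Matching, ∀ a : Fin n, f a = M.partner a := by
  refine ⟨⟨fun a => ⟨f a, hf.lt a a.2⟩, fun a => Fin.ext (hf.involutive a a.2), fun a hne => ?_⟩,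
    fun a => rfl⟩
  exact mem_pref_iff.2 (hf.acceptable a a.2 fun e => hne (Fin.ext e))

theorem blocks_iff (hX : CrossLists n (I.load.vec .len) (I.load.tab .pref) X) {M : I.Matching}
    {f : ℕ → ℕ} (hf : ∀ a : Fin n, f a = M.partner a) {a b : Fin n} {p : ℕ}
    (hp : p < I.load.vec .len a) (hb : I.load.tab .pref a p = b) :
    M.Blocks a b ↔ BlocksAt (I.load.tab .pref) X f a p := by
  have h1 := hX.X_lt a a.2 p hp
  have h2 := hX.P_X a a.2 p hp
  have h3 := hX.ne a a.2 p hp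
  rw [hb] at h1 h2 h3
  have h4 : a ≠ b := fun e => h3 (e ▸ rfl)
  simp only [Matching.Blocks, BlocksAt, prefers_iff hp hb, prefers_iff h1 h2, hb, hf]
  tauto

theorem isStable_iff (hX : CrossLists n (I.load.vec .len) (I.load.tab .pref) X) {M : I.Matching}
    {f : ℕ → ℕ} (hf : ∀ a : Fin n, f a = M.partner a) :
    M.IsStable ↔ ∀ a < n, ∀ p < I.load.vec .len a, ¬ BlocksAt (I.load.tab .pref) X f a p := by
  classical
  simp only [Matching.IsStable, Matching.bp, Finset.filter_eq_empty_iff, Finset.mem_univ,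
    forall_true_left]
  constructor
  · intro h a ha p hp hb
    have hlt := hX.lt a ha p hp
    exact h (x := s(⟨a, ha⟩, ⟨_, hlt⟩))
      ⟨⟨a, ha⟩, ⟨_, hlt⟩, rfl, (blocks_iff (a := ⟨a, ha⟩) (b := ⟨_, hlt⟩) hX hf hp rfl).2 hb⟩
  · rintro h e ⟨a, b, -, hab⟩
    obtain ⟨p, hp, hb⟩ := mem_pref_iff.1 hab.mem
    exact h a a.2 p hp ((blocks_iff hX hf hp hb).1 hab)

theorem not_solvable_of_oddParty
    (hX : CrossLists n (I.load.vec .len) (I.load.tab .pref) X)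
    (h : OddParty n (I.load.vec .len) (I.load.tab .pref)) : ¬ I.Solvable := by
  rintro ⟨M, hM⟩
  obtain ⟨a, ha, p, hp, hb⟩ := h.exists_blocksAt hX (isMate_of_partner M.mate_coe)
  exact (isStable_iff hX M.mate_coe).1 hM a ha p hp hb

end SRI

/-! ### Maximum-cardinality matching by walks along paths and cycles -/

namespace AlmostStable

open Ram

section

variable {n : ℕ} {L : ℕ → ℕ} {P X : ℕ → ℕ → ℕ}

theorem Lists.eq_of_three (hL : Lists n L P) {a p q r : ℕ} (ha : a < n) (hp : p < L a)
    (hq : q < L a) (hr : r < L a) : P a p = P a q ∨ P a q = P a r ∨ P a p = P a r := by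
  have := hL.len_le a ha
  obtain h | h | h : p = q ∨ q = r ∨ p = r := by omega
  · exact .inl (h ▸ rfl)
  · exact .inr (.inl (h ▸ rfl))
  · exact .inr (.inr (h ▸ rfl))

/-- A walk from `s` is about to visit `x`; `vis₀` marks the agents visited before the walk. -/
structure Pending (n : ℕ) (L : ℕ → ℕ) (P : ℕ → ℕ → ℕ) (vis₀ vis : ℕ → ℕ) (s x : ℕ) : Prop where
  lt : x < n
  lt_s : s < n
  vis_eq : vis x = 0
  sub : ∀ a, vis₀ a ≠ 0 → vis a ≠ 0
  out : (x = s ∧ ∀ a < n, vis a ≠ 0 → vis₀ a ≠ 0) ∨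
    (vis s ≠ 0 ∧ ∃ l, (∃ p < L x, P x p = l) ∧ vis l ≠ 0 ∧
      (∀ a < n, vis a ≠ 0 → vis₀ a = 0 → ∀ p < L a, vis (P a p) = 0 →
        a = s ∨ a = l ∧ P a p = x) ∧
      (l = s ∨ ∃ p < L s, vis (P s p) ≠ 0))

/-- The list of `x` is used up by the agent before her and the one after her. So among the agents
visited in this walk, only `s` and `x` can still have unvisited neighbours, and `x` only the next
agent. -/
theorem Pending.advance (hL : Lists n L P) {vis₀ vis : ℕ → ℕ} {s x p : ℕ}
    (h : Pending n L P vis₀ vis s x) (hp : p < L x)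
    (hz : Function.update vis x 1 (P x p) = 0) :
    Pending n L P vis₀ (Function.update vis x 1) s (P x p) := by
  have hmono : ∀ a, vis a ≠ 0 → Function.update vis x 1 a ≠ 0 := fun a ha => by
    rw [Function.update_apply]
    split_ifs <;> simp_all
  have hanti : ∀ a, Function.update vis x 1 a = 0 → a ≠ x ∧ vis a = 0 := fun a ha => by
    rw [Function.update_apply] at ha
    split_ifs at ha with e
    exact ⟨e, ha⟩
  refine ⟨hL.lt x h.lt p hp, h.lt_s, hz, fun a ha => hmono a (h.sub a ha), .inr ⟨?_, x,
    hL.symm x h.lt p hp, by simp, fun a ha hva hva₀ q hq hvq => ?_, ?_⟩⟩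
  · rcases h.out with ⟨rfl, -⟩ | ⟨h1, -⟩
    · simp
    · exact hmono s h1
  · by_cases hax : a = x
    · subst hax
      rcases h.out with ⟨h1, -⟩ | ⟨-, l, ⟨r, hr, rfl⟩, h2, -⟩
      · exact .inl h1
      · refine .inr ⟨rfl, ?_⟩
        rcases hL.eq_of_three ha hp hq hr with e | e | e
        · exact e.symm
        · exact absurd (hanti _ hvq).2 (e ▸ h2)
        · exact absurd (hanti _ hz).2 (e ▸ h2)
    · have hva' : vis a ≠ 0 := by rwa [Function.update_of_ne hax] at hva
      have hvq' := hanti _ hvq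
      rcases h.out with ⟨-, h1⟩ | ⟨-, l, -, -, h1, -⟩
      · exact absurd hva₀ (h1 a ha hva')
      · exact (h1 a ha hva' hva₀ q hq hvq'.2).imp_right fun e => absurd e.2 hvq'.1
  · rcases h.out with ⟨h1, -⟩ | ⟨-, l, ⟨r, hr, hrl⟩, -, -, rfl | ⟨q, hq, hq'⟩⟩
    · exact .inl h1
    · obtain ⟨q, hq, e⟩ := hL.symm x h.lt r hr
      rw [hrl] at hq e
      exact .inr ⟨q, hq, by simp [e]⟩
    · exact .inr ⟨q, hq, hmono _ hq'⟩

/-- Only `s` could still have an unvisited neighbour. If `s` is the end of a path, her only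
neighbour has been visited. Otherwise no unvisited agent is the end of a path, so `x` has a second
neighbour; this must be `s`, and the walk has gone around a cycle. -/
theorem Pending.closed (hL : Lists n L P) {vis₀ vis : ℕ → ℕ} {s x : ℕ}
    (h : Pending n L P vis₀ vis s x)
    (hx : ∀ p < L x, Function.update vis x 1 (P x p) ≠ 0)
    (h₀ : ∀ a < n, vis₀ a ≠ 0 → ∀ p < L a, vis₀ (P a p) ≠ 0)
    (hmode : L s = 1 ∨ ∀ a < n, vis a = 0 → L a ≠ 1) :
    ∀ a < n, Function.update vis x 1 a ≠ 0 → ∀ p < L a,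
      Function.update vis x 1 (P a p) ≠ 0 := by
  have hmono : ∀ a, vis a ≠ 0 → Function.update vis x 1 a ≠ 0 := fun a ha => by
    rw [Function.update_apply]
    split_ifs <;> simp_all
  have hanti : ∀ a, Function.update vis x 1 a = 0 → a ≠ x ∧ vis a = 0 := fun a ha => by
    rw [Function.update_apply] at ha
    split_ifs at ha with e
    exact ⟨e, ha⟩
  intro a ha hva p hp hw
  obtain ⟨hwx, hw'⟩ := hanti _ hw
  have hax : a ≠ x := fun e => hx p (e ▸ hp) (e ▸ hw)
  have hva' : vis a ≠ 0 := by rwa [Function.update_of_ne hax] at hva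
  have hva₀ : vis₀ a = 0 := by
    by_contra hc
    exact h.sub _ (h₀ a ha hc p hp) hw'
  rcases h.out with ⟨-, h1⟩ | ⟨h1, l, ⟨r, hr, hrl⟩, hl, h2, h3⟩
  · exact h1 a ha hva' hva₀
  · obtain rfl : a = s := (h2 a ha hva' hva₀ p hp hw').resolve_right fun e => hwx e.2
    have hLx : L x = 2 := by
      rcases hmode with h4 | h4
      · exfalso
        rcases h3 with rfl | ⟨q, hq, hq'⟩
        · obtain ⟨q, hq, e⟩ := hL.symm x h.lt r hr
          rw [hrl] at hq e
          have : p = q := by omega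
          exact hwx (by rw [this, e])
        · have : p = q := by omega
          exact hq' (this ▸ hw')
      · have := h4 x h.lt h.vis_eq
        have := hL.len_le x h.lt
        omega
    obtain ⟨r', hr', hne⟩ : ∃ r' < L x, r' ≠ r := ⟨1 - r, by omega, by omega⟩
    have hbl : P x r' ≠ l := fun e => hne (hL.inj x h.lt _ hr' _ hr (e.trans hrl.symm))
    have hbn := hL.lt x h.lt r' hr'
    have hvb : vis (P x r') ≠ 0 := by
      have := hx r' hr'
      rwa [Function.update_of_ne (hL.ne x h.lt r' hr')] at this
    obtain ⟨t, ht, hPt⟩ := hL.symm x h.lt r' hr'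
    have hvb₀ : vis₀ (P x r') = 0 := by
      by_contra hc
      have := h₀ _ hbn hc t ht
      rw [hPt] at this
      exact h.sub _ this h.vis_eq
    have hbs : P x r' = a := (h2 _ hbn hvb hvb₀ t ht (by rw [hPt, h.vis_eq])).resolve_right
      fun e => hbl e.1
    rw [hbs] at ht hPt hbl
    -- Now `s` has the neighbour `x`, another one visited before, and the supposed unvisited one:
    -- too many for her list.
    obtain ⟨q, hq, hq'⟩ := h3.resolve_left fun e => hbl e.symm
    rcases hL.eq_of_three ha hp hq ht with e | e | e
    · exact hq' (e ▸ hw')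
    · rw [e, hPt] at hq'
      exact hq' h.vis_eq
    · exact hwx (e.trans hPt)

/-- The relation of being on each other's lists. -/
def Adjacent (n : ℕ) (L : ℕ → ℕ) (P : ℕ → ℕ → ℕ) (a b : ℕ) : Prop :=
  a < n ∧ ∃ p < L a, P a p = b

/-- The state between two walks: whole components have been visited, and every one of them has at
most one unmatched agent. -/
structure Walked (n : ℕ) (L : ℕ → ℕ) (P : ℕ → ℕ → ℕ) (vis f : ℕ → ℕ) : Prop where
  isMate : IsMate n L P f
  unvisited : ∀ a < n, vis a = 0 → f a = a
  closed : ∀ a < n, vis a ≠ 0 → ∀ p < L a, vis (P a p) ≠ 0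
  unique : ∀ a < n, ∀ b < n, vis a ≠ 0 → vis b ≠ 0 → f a = a → f b = b →
    Relation.ReflTransGen (Adjacent n L P) a b → a = b

/-- The state within a walk: everybody visited in the course of it is matched. -/
structure Walking (n : ℕ) (L : ℕ → ℕ) (P : ℕ → ℕ → ℕ) (vis₀ f₀ vis f : ℕ → ℕ) : Prop where
  isMate : IsMate n L P f
  unvisited : ∀ a < n, vis a = 0 → f a = a
  matched : ∀ a < n, vis a ≠ 0 → vis₀ a = 0 → f a ≠ a
  old : ∀ a < n, vis₀ a ≠ 0 → f a = f₀ a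

theorem Walked.walking {vis f : ℕ → ℕ} (h : Walked n L P vis f) : Walking n L P vis f vis f :=
  ⟨h.isMate, h.unvisited, fun _ _ h1 h2 => absurd h2 h1, fun _ _ _ => rfl⟩

/-- The agents visited before are closed under adjacency, so connected agents are both old or both
new. Old ones are covered by the previous state, and the only new agent who may be unmatched is `x`.
-/
theorem Walked.finish (hL : Lists n L P) {vis₀ f₀ vis f : ℕ → ℕ} (h : Walked n L P vis₀ f₀)
    (hmate : IsMate n L P f) (hunv : ∀ a < n, vis a = 0 → f a = a)
    (hclosed : ∀ a < n, vis a ≠ 0 → ∀ p < L a, vis (P a p) ≠ 0)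
    (hold : ∀ a < n, vis₀ a ≠ 0 → f a = f₀ a) (x : ℕ)
    (hnew : ∀ a < n, vis a ≠ 0 → vis₀ a = 0 → f a = a → a = x) : Walked n L P vis f := by
  refine ⟨hmate, hunv, hclosed, fun a ha b hb hva hvb hfa hfb hab => ?_⟩
  have hiff : vis₀ a = 0 ↔ vis₀ b = 0 := by
    clear hfb hvb hb
    induction hab with
    | refl => rfl
    | tail _ h1 ih =>
      obtain ⟨h2, p, hp, rfl⟩ := h1
      rw [ih]
      constructor
      · intro h3
        by_contra hc
        obtain ⟨q, hq, e⟩ := hL.symm _ h2 p hp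
        have := h.closed _ (hL.lt _ h2 p hp) hc q hq
        rw [e] at this
        exact this h3
      · intro h3
        by_contra hc
        exact h.closed _ h2 hc p hp h3
  by_cases h1 : vis₀ a = 0
  · rw [hnew a ha hva h1 hfa, hnew b hb hvb (hiff.1 h1) hfb]
  · have h2 := mt hiff.2 h1
    rw [hold a ha h1] at hfa
    rw [hold b hb h2] at hfb
    exact h.unique a ha b hb h1 h2 hfa hfb hab

theorem Walking.match (hL : Lists n L P) {vis₀ f₀ vis f : ℕ → ℕ} {x y p : ℕ}
    (h : Walking n L P vis₀ f₀ vis f) (hsub : ∀ a, vis₀ a ≠ 0 → vis a ≠ 0) (hx : x < n)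
    (hvx : vis x = 0) (hp : p < L x) (hy : y = P x p)
    (hvy : Function.update vis x 1 y = 0) :
    Walking n L P vis₀ f₀ (Function.update (Function.update vis x 1) y 1)
      (Function.update (Function.update f x y) y x) := by
  have hyx : y ≠ x := hy ▸ hL.ne x hx p hp
  have hyn : y < n := hy ▸ hL.lt x hx p hp
  rw [Function.update_of_ne hyx] at hvy
  have hfx := h.unvisited x hx hvx
  have hfy := h.unvisited y hyn hvy
  obtain ⟨q, hq, hPq⟩ := hL.symm x hx p hp
  rw [← hy] at hq hPq
  refine ⟨⟨fun a ha => ?_, fun a ha => ?_, fun a ha => ?_⟩, fun a ha => ?_, fun a ha => ?_,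
    fun a ha h0 => ?_⟩
  · have := h.isMate.lt a ha
    simp only [Function.update_apply]
    grind
  · have := h.isMate.involutive a ha
    simp only [Function.update_apply]
    grind
  · have := h.isMate.acceptable a ha
    simp only [Function.update_apply]
    grind
  · have := h.unvisited a ha
    simp only [Function.update_apply]
    grind
  · have := h.matched a ha
    simp only [Function.update_apply]
    grind
  · have := h.old a ha h0
    have := hsub a h0
    simp only [Function.update_apply]
    grind

/-- The number of agents that have not been visited. -/
def unvisitedCard (n : ℕ) (vis : ℕ → ℕ) : ℕ := ((Finset.range n).filter fun a => vis a = 0).card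

theorem unvisitedCard_update {vis : ℕ → ℕ} {x : ℕ} (hx : x < n) (h : vis x = 0) :
    unvisitedCard n (Function.update vis x 1) + 1 = unvisitedCard n vis := by
  have : ((Finset.range n).filter fun a => Function.update vis x 1 a = 0) =
      ((Finset.range n).filter fun a => vis a = 0).erase x := by
    ext a
    simp only [Function.update_apply, Finset.mem_filter, Finset.mem_erase]
    grind
  rw [unvisitedCard, this, Finset.card_erase_add_one (by simp [hx, h])]
  rfl

theorem Env.congr {σ σ' : Store} (h : Env n L P X σ) (hn : σ'.reg .n = σ.reg .n)
    (hv : σ'.vec .len = σ.vec .len) (ht : σ'.tab = σ.tab) : Env n L P X σ' :=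
  ⟨hn.trans h.1, hv.trans h.2, ht ▸ h.3, ht ▸ h.4⟩

/-- The result of looking for an unvisited agent in the first `m` positions of the list of `x`. -/
def Searched (L : ℕ → ℕ) (P : ℕ → ℕ → ℕ) (vis : ℕ → ℕ) (x m : ℕ) (τ : Store) : Prop :=
  τ.reg .f = 1 ∧ (∃ p < L x, τ.reg .y = P x p ∧ vis (P x p) = 0) ∨
    τ.reg .f = 0 ∧ ∀ p < m, vis (P x p) ≠ 0

theorem exec_freeNeighbour (hL : Lists n L P) {σ : Store} {k k' : ℕ} (hk : k' + 60 ≤ k)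
    (hσ : Env n L P X σ) (hx : σ.reg .x < n) :
    Exec freeNeighbour (fun k τ => k' ≤ k ∧ τ.vec = σ.vec ∧ τ.tab = σ.tab ∧
      (∀ v, v ≠ .p → v ≠ .f → v ≠ .y → τ.reg v = σ.reg v) ∧
      Searched L P (σ.vec .vis) (σ.reg .x) (L (σ.reg .x)) τ) k σ := by
  have hLx := hL.len_le _ hx
  rw [freeNeighbour]
  simp only [exec_seq, exec_set]
  refine ⟨by simp; omega, by simp; omega, ?_⟩
  refine Exec.while (fun k τ => k' + 5 + 22 * (L (σ.reg .x) - τ.reg .p) ≤ k ∧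
      τ.reg .p ≤ L (σ.reg .x) ∧ τ.vec = σ.vec ∧ τ.tab = σ.tab ∧
      (∀ v, v ≠ .p → v ≠ .f → v ≠ .y → τ.reg v = σ.reg v) ∧
      Searched L P (σ.vec .vis) (σ.reg .x) (τ.reg .p) τ) ?_ ?_
  · exact ⟨by simp; omega, by simp, by simp, by simp, by simp +contextual, .inr ⟨by simp, by simp⟩⟩
  · rintro k τ ⟨hk, hp, hv, ht, hr, h⟩
    have hx' : τ.reg .x = σ.reg .x := hr .x (by simp) (by simp) (by simp)
    have hp' : τ.tab .pref = P := ht ▸ hσ.tab_pref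
    have hl' : τ.vec .len = L := hv ▸ hσ.vec_len
    refine ⟨by simp; omega, fun hb => ?_, fun hb => ?_⟩
    · have hlt : τ.reg .p < L (σ.reg .x) := by simpa [hl', hx'] using hb
      simp only [exec_seq, exec_ite, exec_set, exec_skip]
      refine ⟨by simp; omega, fun hb => ?_, fun hb => ?_⟩
      · have hb' : σ.vec .vis (P (σ.reg .x) (τ.reg .p)) = 0 := by
          simpa [hp', hx', hv] using hb
        refine ⟨by simp; omega, by simp; omega, by simp; omega, by simp; omega, by simp; omega,
          by simpa using hv, by simpa using ht, by simp +contextual [hr], .inl ⟨by simp,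
          τ.reg .p, hlt, by simp [hp', hx'], hb'⟩⟩
      · have hb' : σ.vec .vis (P (σ.reg .x) (τ.reg .p)) ≠ 0 := by
          simpa [hp', hx', hv] using hb
        refine ⟨by simp; omega, by simp; omega, by simp; omega, by simp; omega,
          by simpa using hv, by simpa using ht, by simp +contextual [hr], ?_⟩
        refine h.imp (fun h => by simpa using h) fun h => ⟨by simpa using h.1, fun p hp => ?_⟩
        rcases Nat.lt_succ_iff_lt_or_eq.1 (by simpa using hp) with hp | rfl
        · exact h.2 p hp
        · exact hb'
    · have hge : ¬ τ.reg .p < L (σ.reg .x) := by simpa [hl', hx'] using hb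
      exact ⟨by simp; omega, hv, ht, hr, h.imp_right fun h => ⟨h.1, fun p hp => h.2 p (by omega)⟩⟩

/-- Each round visits `x` and, if possible, matches her to the next agent, so that between rounds
every newly visited agent is matched. Only the last agent of the walk can stay unmatched. Every new
visit releases `200` credits. -/
theorem exec_walk (hL : Lists n L P) {vis₀ f₀ : ℕ → ℕ} (h : Walked n L P vis₀ f₀) {s : ℕ}
    (hs : s < n) (hvs : vis₀ s = 0) (hmode : L s = 1 ∨ ∀ a < n, vis₀ a = 0 → L a ≠ 1)
    {σ : Store} {k k' : ℕ} (hσ : Env n L P X σ) (hsσ : σ.reg .s = s) (hvis : σ.vec .vis = vis₀)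
    (hmate : σ.vec .mate = f₀) (hk : k' + 200 * unvisitedCard n vis₀ + 20 ≤ k) :
    Exec walk (fun k σ => k' + 200 * unvisitedCard n (σ.vec .vis) ≤ k ∧ Env n L P X σ ∧
      σ.reg .s = s ∧ Walked n L P (σ.vec .vis) (σ.vec .mate) ∧
      (∀ a, vis₀ a ≠ 0 → σ.vec .vis a ≠ 0) ∧ σ.vec .vis s ≠ 0) k σ := by
  rw [walk]
  simp only [exec_seq, exec_set]
  refine ⟨by simp; omega, by simp; omega, ?_⟩
  refine Exec.while (fun k σ => Env n L P X σ ∧ σ.reg .s = s ∧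
    (∀ a, vis₀ a ≠ 0 → σ.vec .vis a ≠ 0) ∧
    (σ.reg .go = 1 ∧ k' + 200 * unvisitedCard n (σ.vec .vis) + 10 ≤ k ∧
      Pending n L P vis₀ (σ.vec .vis) s (σ.reg .x) ∧
      Walking n L P vis₀ f₀ (σ.vec .vis) (σ.vec .mate) ∨
    σ.reg .go = 0 ∧ k' + 200 * unvisitedCard n (σ.vec .vis) + 10 ≤ k ∧
      Walked n L P (σ.vec .vis) (σ.vec .mate) ∧ σ.vec .vis s ≠ 0)) ?_ ?_
  · refine ⟨by simpa using hσ, by simpa using hsσ, by simp [hvis], .inl ⟨by simp, by simp [hvis]; omega,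
      ⟨by simpa [hsσ] using hs, hs, by simpa [hsσ, hvis] using hvs, by simp [hvis],
        .inl ⟨by simpa using hsσ, by simp [hvis]⟩⟩, by simpa [hvis, hmate] using h.walking⟩⟩
  · rintro k σ ⟨hσ, hsσ, hsub, ⟨hgo, hk, hP, hW⟩ | ⟨hgo, hk, hW, hvs⟩⟩
    · refine ⟨by simp; omega, fun _ => ?_, fun hb => by simp [hgo] at hb⟩
      have hx := hP.lt
      have hvx := hP.vis_eq
      have hcard := unvisitedCard_update hx hvx
      have hmode' : L s = 1 ∨ ∀ a < n, σ.vec .vis a = 0 → L a ≠ 1 :=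
        hmode.imp_right fun h a ha hva => h a ha (by_contra fun hc => hsub a hc hva)
      generalize hx_eq : σ.reg .x = x at *
      generalize hvis_eq : σ.vec .vis = vis at *
      generalize hf_eq : σ.vec .mate = f at *
      have hmono : ∀ (vis : ℕ → ℕ) x, ∀ a, vis a ≠ 0 → Function.update vis x 1 a ≠ 0 :=
        fun vis x a ha => by
          rw [Function.update_apply]
          split_ifs <;> simp_all
      rw [exec_seq, exec_put]
      refine ⟨by simp; omega, ?_⟩
      rw [exec_seq]
      refine Exec.mono (exec_freeNeighbour (X := X) hL
        (k' := k' + 200 * unvisitedCard n (Function.update vis x 1) + 130)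
        (by simp; omega) (by simpa using hσ) (by simpa [hx_eq] using hx)) ?_
      rintro k τ ⟨hk, hv, ht, hr, hf⟩
      simp [hx_eq, hvis_eq] at hf
      unfold Searched at hf
      have hτ : Env n L P X τ :=
        hσ.congr (by simpa using hr .n) (by simp [hv]) (by simpa using ht)
      have hτx : τ.reg .x = x := by simp [hr, hx_eq]
      have hτs : τ.reg .s = s := by simp [hr, hsσ]
      have hτvis : τ.vec .vis = Function.update vis x 1 := by simp [hv, hvis_eq, hx_eq]
      have hτf : τ.vec .mate = f := by simp [hv, hf_eq]
      rw [exec_ite]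
      refine ⟨by simp; omega, fun hb => ?_, fun hb => ?_⟩
      · rcases hf with ⟨hf, p, hp, hy, hvy⟩ | ⟨hf, -⟩
        swap
        · simp [hf] at hb
        generalize hy_eq : τ.reg .y = y at *
        have hyn : y < n := hy ▸ hL.lt x hx p hp
        have hP' := hP.advance hL hp hvy
        have hW' := hW.match hL hsub hx hvx hp hy (hy ▸ hvy)
        rw [← hy] at hP' hvy
        have hcard' := unvisitedCard_update hyn hvy
        simp only [exec_seq, exec_put, exec_set]
        refine ⟨by simp; omega, by simp; omega, by simp; omega, by simp; omega, ?_⟩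
        refine Exec.mono (exec_freeNeighbour (X := X) hL
          (k' := k' + 200 * unvisitedCard n (Function.update (Function.update vis x 1) y 1) + 30)
          (by simp; omega) (by simpa using hτ) (by simpa [hy_eq] using hyn)) ?_
        rintro k ρ ⟨hk, hv, ht, hr, hf⟩
        simp [hy_eq, hτvis] at hf
        unfold Searched at hf
        have hρ : Env n L P X ρ :=
          hτ.congr (by simpa using hr .n) (by simp [hv]) (by simpa using ht)
        have hρs : ρ.reg .s = s := by simp [hr, hτs]
        have hρgo : ρ.reg .go = 1 := by simp [*]
        have hρvis : ρ.vec .vis = Function.update (Function.update vis x 1) y 1 := by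
          simp [hv, hτvis, hy_eq]
        have hρf : ρ.vec .mate = Function.update (Function.update f x y) y x := by
          simp [hv, hτf, hy_eq, hτx]
        have hsub' : ∀ a, vis₀ a ≠ 0 → ρ.vec .vis a ≠ 0 := fun a ha => by
          rw [hρvis]
          exact hmono _ _ a (hmono _ _ a (hsub a ha))
        rw [exec_ite, exec_set, exec_set]
        refine ⟨by simp; omega, fun hb => ?_, fun hb => ?_⟩
        · rcases hf with ⟨hf, q, hq, hz, hvz⟩ | ⟨hf, -⟩
          swap
          · simp [hf] at hb
          have hP'' := hP'.advance hL hq hvz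
          rw [← hz, ← hρvis] at hP''
          rw [← hρvis, ← hρf] at hW'
          exact ⟨by simp; omega, by simpa using hρ, by simpa using hρs, by simpa using hsub',
            .inl ⟨by simpa using hρgo, by simp [hρvis]; omega, by simpa using hP'',
              by simpa using hW'⟩⟩
        · rcases hf with ⟨hf, -⟩ | ⟨-, hf⟩
          · simp [hf] at hb
          have hcl := hP'.closed hL hf h.closed (hmode'.imp_right fun h a ha hva =>
            h a ha (by_contra fun hc => hmono _ x a hc hva))
          -- Here no newly visited agent is unmatched, so the exceptional agent `0` is a dummy.
          have hend := h.finish hL hW'.isMate hW'.unvisited hcl hW'.old 0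
            fun a ha h1 h2 h3 => absurd h3 (hW'.matched a ha h1 h2)
          have hsv : ρ.vec .vis s ≠ 0 := by
            rw [hρvis]
            rcases hP'.out with ⟨rfl, -⟩ | ⟨h1, -⟩
            · simp
            · exact hmono _ _ _ h1
          rw [← hρvis, ← hρf] at hend
          exact ⟨by simp; omega, by simpa using hρ, by simpa using hρs, by simpa using hsub',
            .inr ⟨by simp, by simp [hρvis]; omega, by simpa using hend, by simpa using hsv⟩⟩
      · rcases hf with ⟨hf, -⟩ | ⟨-, hf⟩
        · simp [hf] at hb
        have hcl := hP.closed hL hf h.closed hmode'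
        have hend : Walked n L P (Function.update vis x 1) f := by
          refine h.finish hL hW.isMate (fun a ha hva => hW.unvisited a ha ?_) hcl hW.old x
            fun a ha h1 h2 h3 => ?_
          · exact by_contra fun hc => hmono _ x a hc hva
          · by_contra hc
            rw [Function.update_of_ne hc] at h1
            exact hW.matched a ha h1 h2 h3
        have hsv : τ.vec .vis s ≠ 0 := by
          rw [hτvis]
          rcases hP.out with ⟨rfl, -⟩ | ⟨h1, -⟩
          · simp
          · exact hmono _ _ _ h1
        have hsub' : ∀ a, vis₀ a ≠ 0 → τ.vec .vis a ≠ 0 := fun a ha => by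
          rw [hτvis]
          exact hmono _ _ a (hsub a ha)
        rw [← hτvis, ← hτf] at hend
        rw [exec_set]
        exact ⟨by simp; omega, by simpa using hτ, by simpa using hτs, by simpa using hsub',
          .inr ⟨by simp, by simp [hτvis]; omega, by simpa using hend, by simpa using hsv⟩⟩
    · exact ⟨by simp; omega, fun hb => by simp [hgo] at hb,
        fun _ => ⟨by simp; omega, hσ, hsσ, hW, hsub, hvs⟩⟩

/-- The order of the passes matters: after the first one no unvisited agent has a list of length
one, which a walk from an arbitrary agent needs in order to exhaust its component. -/
theorem exec_maxCard (hL : Lists n L P) {σ : Store} {k k' : ℕ} (hk : k' + 400 * n + 100 ≤ k)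
    (hσ : Env n L P X σ) :
    Exec maxCard (fun k σ => k' ≤ k ∧ Env n L P X σ ∧ IsMate n L P (σ.vec .mate) ∧
      ∀ a < n, ∀ b < n, σ.vec .mate a = a → σ.vec .mate b = b →
        Relation.ReflTransGen (Adjacent n L P) a b → a = b) k σ := by
  rw [maxCard, exec_seq]
  refine exec_forAgents (N := n) (by simp) (fun i k σ => k' + 380 * n + 50 + 10 * (n - i) ≤ k ∧
    Env n L P X σ ∧ ∀ a < i, σ.vec .vis a = 0 ∧ σ.vec .mate a = a) hσ.reg_n (by omega)
    ⟨by omega, by simpa using hσ, by simp⟩ ?_ ?_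
  · rintro i hi k σ hx hn ⟨hk, hσ, h⟩
    simp only [exec_seq, exec_put]
    refine ⟨by simp; omega, by simp; omega, by simpa using hx, by simpa using hn,
      by simp; omega, by simpa using hσ, fun a ha => ?_⟩
    simp [Function.update_apply, hx]
    by_cases e : a = i
    · simp [e]
    · simpa [e] using h a (by omega)
  · rintro k σ hn ⟨hk, hσ, h⟩
    have hunv : unvisitedCard n (σ.vec .vis) ≤ n :=
      (Finset.card_filter_le _ _).trans (Finset.card_range n).le
    rw [exec_seq]
    refine exec_forAgents (N := n) (by simp) (fun i k σ => k' + 70 * n + 20 + 50 * (n - i) +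
      200 * unvisitedCard n (σ.vec .vis) ≤ k ∧ Env n L P X σ ∧
      Walked n L P (σ.vec .vis) (σ.vec .mate) ∧ ∀ a < i, L a = 1 → σ.vec .vis a ≠ 0) hσ.reg_n
      (by omega) ⟨by simp; omega, by simpa using hσ, ?_, by simp⟩ ?_ ?_
    · simp
      refine ⟨⟨fun a ha => ?_, fun a ha => ?_, fun a ha hne => ?_⟩, fun a ha _ => (h a ha).2,
        fun a ha hva => ?_, fun a ha b _ hva => ?_⟩
      · rwa [(h a ha).2]
      · rw [(h a ha).2, (h a ha).2]
      · exact absurd (h a ha).2 hne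
      · exact absurd (h a ha).1 hva
      · exact absurd (h a ha).1 hva
    · rintro i hi k σ hs hn ⟨hk, hσ, h, hi'⟩
      rw [exec_ite, exec_skip]
      refine ⟨by simp; omega, fun hb => ?_, fun hb => ?_⟩
      · have hb' : L i = 1 ∧ σ.vec .vis i = 0 := by simpa [hσ.vec_len, hs] using hb
        refine Exec.mono (exec_walk hL h hi hb'.2 (.inl hb'.1) hσ hs rfl rfl
          (k' := k' + 70 * n + 20 + 50 * (n - (i + 1))) (by simp; omega)) ?_
        rintro k τ ⟨hk, hτ, hs, hW, hsub, hsv⟩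
        refine ⟨hs, hτ.reg_n, by simp; omega, by simpa using hτ, by simpa using hW,
          fun a ha ha1 => ?_⟩
        rcases Nat.lt_succ_iff_lt_or_eq.1 ha with ha | rfl
        · exact hsub a (hi' a ha ha1)
        · exact hsv
      · have hb' : L i = 1 → ¬ σ.vec .vis i = 0 := by simpa [hσ.vec_len, hs] using hb
        refine ⟨by simp; omega, hs, hn, by simp; omega, by simpa using hσ, by simpa using h,
          fun a ha ha1 => ?_⟩
        rcases Nat.lt_succ_iff_lt_or_eq.1 ha with ha | rfl
        · exact hi' a ha ha1
        · exact hb' ha1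
    · rintro k σ hn ⟨hk, hσ, h, h1⟩
      refine exec_forAgents (N := n) (by simp) (fun i k σ => k' + 50 * (n - i) +
        200 * unvisitedCard n (σ.vec .vis) ≤ k ∧ Env n L P X σ ∧
        Walked n L P (σ.vec .vis) (σ.vec .mate) ∧ (∀ a < n, σ.vec .vis a = 0 → L a ≠ 1) ∧
        ∀ a < i, σ.vec .vis a ≠ 0) hσ.reg_n (by omega)
        ⟨by simp; omega, by simpa using hσ, by simpa using h,
          fun a ha h2 h3 => h1 a ha h3 h2, by simp⟩ ?_ ?_
      · rintro i hi k σ hs hn ⟨hk, hσ, h, h1, hi'⟩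
        rw [exec_ite, exec_skip]
        refine ⟨by simp; omega, fun hb => ?_, fun hb => ?_⟩
        · have hb' : σ.vec .vis i = 0 := by simpa [hs] using hb
          refine Exec.mono (exec_walk hL h hi hb' (.inr h1) hσ hs rfl rfl
            (k' := k' + 50 * (n - (i + 1))) (by simp; omega)) ?_
          rintro k τ ⟨hk, hτ, hs, hW, hsub, hsv⟩
          refine ⟨hs, hτ.reg_n, by simp; omega, by simpa using hτ, by simpa using hW,
            fun a ha h2 => h1 a ha (by_contra fun hc => hsub a hc h2), fun a ha => ?_⟩
          rcases Nat.lt_succ_iff_lt_or_eq.1 ha with ha | rfl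
          · exact hsub a (hi' a ha)
          · exact hsv
        · have hb' : ¬ σ.vec .vis i = 0 := by simpa [hs] using hb
          refine ⟨by simp; omega, hs, hn, by simp; omega, by simpa using hσ, by simpa using h,
            by simpa using h1, fun a ha => ?_⟩
          rcases Nat.lt_succ_iff_lt_or_eq.1 ha with ha | rfl
          · exact hi' a ha
          · exact hb'
      · rintro k σ hn ⟨hk, hσ, h, -, hv⟩
        exact ⟨by omega, hσ, h.isMate, fun a ha b hb => h.unique a ha b hb (hv a ha) (hv b hb)⟩

end

end AlmostStable

/-! ### Maximality of the matching by parity -/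

namespace SRI

open AlmostStable

variable {n : ℕ} {I : SRI n}

/-- If `u` is the only unmatched agent of her component, the component has odd size, so every other
matching leaves somebody in it unmatched as well. Choosing such an agent for each `u` is injective,
because different `u` lie in different components. -/
theorem Matching.isMaximumCardinality_of_connected {M : I.Matching}
    (h : ∀ a b, M.partner a = a → M.partner b = b →
      Relation.ReflTransGen (fun a b => b ∈ I.pref a) a b → a = b) :
    M.IsMaximumCardinality := by
  classical
  rw [Matching.isMaximumCardinality_iff]
  intro M'
  have hsymm : Std.Symm fun a b => b ∈ I.pref a := ⟨fun a b hab => I.symm a b hab⟩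
  have hclosed : ∀ (N : I.Matching) u a, Relation.ReflTransGen (fun a b => b ∈ I.pref a) u a →
      Relation.ReflTransGen (fun a b => b ∈ I.pref a) u (N.partner a) := by
    intro N u a hua
    by_cases e : N.partner a = a
    · rwa [e]
    · exact hua.tail (N.acceptable a e)
  have hex : ∀ u, M.partner u = u → ∃ v, M'.partner v = v ∧
      Relation.ReflTransGen (fun a b => b ∈ I.pref a) u v := by
    intro u hu
    by_contra! hc
    set C := Finset.univ.filter fun a =>
      Relation.ReflTransGen (fun a b => b ∈ I.pref a) u a with hC
    -- If `M'` had no fixed point on the component, it would pair up its agents, while `M` pairs up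
    -- all of them except `u`. Modulo two these counts disagree.
    have h1 : ∑ a ∈ C, (1 : ZMod 2) = 0 :=
      Finset.sum_involution (fun a _ => M'.partner a) (fun _ _ => by decide)
        (fun a ha _ e => hc a e (by simpa [hC] using ha))
        (fun a ha => by simpa [hC] using hclosed M' u a (by simpa [hC] using ha))
        (fun a _ => M'.involutive a)
    have h2 : ∑ a ∈ C.erase u, (1 : ZMod 2) = 0 := by
      refine Finset.sum_involution (fun a _ => M.partner a) (fun _ _ => by decide)
        (fun a ha _ e => ?_) (fun a ha => ?_) (fun a _ => M.involutive a)
      · simp only [hC, Finset.mem_erase, Finset.mem_filter, Finset.mem_univ, true_and] at ha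
        exact ha.1 (h u a hu e ha.2).symm
      · simp only [hC, Finset.mem_erase, Finset.mem_filter, Finset.mem_univ, true_and] at ha ⊢
        refine ⟨fun e => ha.1 ?_, hclosed M u a ha.2⟩
        rw [← M.involutive a, e, hu]
    have h3 : u ∈ C := by simp [hC, Relation.ReflTransGen.refl]
    rw [← Finset.add_sum_erase C _ h3, h2] at h1
    exact absurd h1 (by decide)
  choose! φ hφ using hex
  refine Finset.card_le_card_of_injOn φ (fun u hu => ?_) fun u hu v hv huv => ?_
  · exact Matching.mem_single.2 (hφ u (Matching.mem_single.1 hu)).1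
  · have h1 := Matching.mem_single.1 hu
    have h2 := Matching.mem_single.1 hv
    refine h u v h1 h2 ((hφ u h1).2.trans ?_)
    rw [huv]
    exact Relation.ReflTransGen.stdSymm.symm _ _ (hφ v h2).2

theorem isMaximumCardinality_of_adjacent {M : I.Matching} {f : ℕ → ℕ}
    (hf : ∀ a : Fin n, f a = M.partner a)
    (h : ∀ a < n, ∀ b < n, f a = a → f b = b → Relation.ReflTransGen
      (Adjacent n (I.load.vec .len) (I.load.tab .pref)) a b → a = b) :
    M.IsMaximumCardinality := by
  refine Matching.isMaximumCardinality_of_connected fun a b ha hb hab => Fin.ext ?_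
  refine h a a.2 b b.2 (by rw [hf, ha]) (by rw [hf, hb]) ?_
  exact hab.lift Fin.val fun c d hcd => ⟨c.2, mem_pref_iff.1 hcd⟩

end SRI

/-! ### Counting the blocking pairs of an unmatched agent -/

namespace AlmostStable

open Ram

section

variable {n : ℕ} {L : ℕ → ℕ} {P X : ℕ → ℕ → ℕ}

/-- The blocking pairs of `x` with the agents in the first `m` positions of her list have been
counted. -/
def Counted (P X : ℕ → ℕ → ℕ) (f : ℕ → ℕ) (x m : ℕ) (τ : Store) : Prop :=
  τ.reg .c ≤ m ∧ (τ.reg .c = m ↔ ∀ p < m, BlocksAt P X f x p) ∧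
    (0 < τ.reg .c → ∃ p < m, τ.reg .r = P x p ∧ BlocksAt P X f x p)

/-- An unmatched `x` prefers everybody on her list to her present state, and position `X x p` holds
`x` herself, who is not the partner of the other agent. So only strictly earlier positions need
checking. -/
theorem blocksAt_iff_of_single (hX : CrossLists n L P X) {f : ℕ → ℕ} (hf : IsMate n L P f)
    {x p : ℕ} (hx : x < n) (hfx : f x = x) (hp : p < L x) :
    BlocksAt P X f x p ↔ ∀ q < X x p, P (P x p) q ≠ f (P x p) := by
  constructor
  · exact fun h q hq => h.2 q hq.le
  · refine fun h => ⟨fun q hq e => hX.ne x hx q (by omega) (e.trans hfx), fun q hq => ?_⟩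
    rcases hq.lt_or_eq with hq | rfl
    · exact h q hq
    · rw [hX.P_X x hx p hp]
      intro e
      have := hf.involutive _ (hX.lt x hx p hp)
      rw [← e, hfx] at this
      exact hX.ne x hx p hp this.symm

theorem exec_countBlocking (hX : CrossLists n L P X) {f : ℕ → ℕ} (hf : IsMate n L P f) {x : ℕ}
    (hx : x < n) (hfx : f x = x) {σ : Store} {k k' : ℕ} (hk : k' + 150 ≤ k)
    (hσ : Env n L P X σ) (hσx : σ.reg .x = x) (hσf : σ.vec .mate = f) :
    Exec countBlocking (fun k τ => k' ≤ k ∧ τ.vec = σ.vec ∧ τ.tab = σ.tab ∧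
      τ.reg .n = n ∧ τ.reg .x = x ∧ τ.reg .top = σ.reg .top ∧ Counted P X f x (L x) τ) k σ := by
  have hLx := hX.len_le x hx
  rw [countBlocking]
  simp only [exec_seq, exec_set]
  refine ⟨by simp; omega, by simp; omega, ?_⟩
  refine Exec.while (fun k τ => k' + 5 + 70 * (L x - τ.reg .p) ≤ k ∧ τ.reg .p ≤ L x ∧
    τ.vec = σ.vec ∧ τ.tab = σ.tab ∧ τ.reg .n = n ∧ τ.reg .x = x ∧ τ.reg .top = σ.reg .top ∧
    Counted P X f x (τ.reg .p) τ) ?_ ?_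
  · exact ⟨by simp; omega, by simp, by simp, by simp, by simpa using hσ.reg_n, by simpa using hσx,
      by simp, by simp [Counted]⟩
  · rintro k τ ⟨hk, hp, hv, ht, hn, hx', htop, hc⟩
    refine ⟨by simp; omega, fun hb => ?_, fun hb => ?_⟩
    · have hp' : τ.reg .p < L x := by simpa [hv, hσ.vec_len, hx'] using hb
      have hXp := hX.X_lt x hx _ hp'
      have hLy := hX.len_le _ (hX.lt x hx _ hp')
      have hblock := blocksAt_iff_of_single hX hf hx hfx hp'
      generalize hpe : τ.reg .p = p at *
      simp only [exec_seq, exec_set]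
      refine ⟨by simp; omega, by simp; omega, ?_⟩
      refine Exec.while (fun k ρ => k' + 5 + 70 * (L x - (p + 1)) + 36 + 17 * (X x p - ρ.reg .q)
          ≤ k ∧ ρ.reg .q ≤ X x p ∧ (∀ q < ρ.reg .q, P (P x p) q ≠ f (P x p)) ∧
        ρ.vec = σ.vec ∧ ρ.tab = σ.tab ∧ ρ.reg .n = n ∧ ρ.reg .x = x ∧
        ρ.reg .top = σ.reg .top ∧ ρ.reg .p = p ∧ ρ.reg .y = P x p ∧ Counted P X f x p ρ) ?_ ?_
      · exact ⟨by simp; omega, by simp, by simp, by simpa using hv, by simpa using ht,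
          by simpa using hn, by simpa using hx', by simpa using htop, by simpa using hpe,
          by simp [hx', hpe, ht, hσ.tab_pref], by simpa [Counted] using hc⟩
      · rintro k ρ ⟨hk, hq, hqP, hv, ht, hn, hx', htop, hpe, hy, hc⟩
        refine ⟨by simp; omega, fun hb => ?_, fun hb => ?_⟩
        · have hb' : ρ.reg .q < X x p ∧ P (P x p) (ρ.reg .q) ≠ f (P x p) := by
            simpa [hv, ht, hσ.tab_pref, hσ.tab_cross, hx', hy, hpe, hσf] using hb
          rw [exec_set]
          refine ⟨by simp; omega, by simp; omega, by simp; omega, fun q hq => ?_,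
            by simpa using hv, by simpa using ht, by simpa using hn, by simpa using hx',
            by simpa using htop, by simpa using hpe, by simpa using hy,
            by simpa [Counted] using hc⟩
          rcases Nat.lt_succ_iff_lt_or_eq.1 (by simpa using hq) with hq | rfl
          · exact hqP q hq
          · exact hb'.2
        · have hb' : ρ.reg .q < X x p → P (P x p) (ρ.reg .q) = f (P x p) := by
            simpa [hv, ht, hσ.tab_pref, hσ.tab_cross, hx', hy, hpe, hσf] using hb
          obtain ⟨hc1, hc2, hc3⟩ := hc
          simp only [exec_seq, exec_ite, exec_set, exec_skip]
          refine ⟨by simp; omega, fun hb => ?_, fun hb => ?_⟩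
          · have hqX : ρ.reg .q = X x p := by simpa [ht, hσ.tab_cross, hx', hpe] using hb
            have hB := hblock.2 (hqX ▸ hqP)
            refine ⟨by simp; omega, by simp; omega, by simp; omega, by simp; omega, by simp; omega,
              by simpa using hv, by simpa using ht, by simpa using hn, by simpa using hx',
              by simpa using htop, ?_⟩
            simp only [Counted, Store.reg_set, reduceCtorEq, if_true, if_false, Exp.eval, hpe, hy]
            refine ⟨by omega, ?_, fun _ => ⟨p, by omega, rfl, hB⟩⟩
            rw [Nat.add_right_cancel_iff, hc2]
            constructor
            · intro h q hq
              rcases Nat.lt_succ_iff_lt_or_eq.1 hq with hq | rfl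
              · exact h q hq
              · exact hB
            · exact fun h q hq => h q (by omega)
          · have hqX : ρ.reg .q ≠ X x p := by simpa [ht, hσ.tab_cross, hx', hpe] using hb
            have hqlt : ρ.reg .q < X x p := by omega
            have hB : ¬ BlocksAt P X f x p := fun h => hblock.1 h _ hqlt (hb' hqlt)
            refine ⟨by simp; omega, by simp; clear hc3; omega, by simp; clear hc3; omega,
              by simp; omega, by simpa using hv,
              by simpa using ht, by simpa using hn, by simpa using hx', by simpa using htop, ?_⟩
            simp only [Counted, Store.reg_set, reduceCtorEq, if_true, if_false, Exp.eval, hpe]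
            refine ⟨by omega, ⟨fun h => by omega, fun h => absurd (h p (by omega)) hB⟩,
              fun h => ?_⟩
            obtain ⟨q, hq, h⟩ := hc3 h
            exact ⟨q, by omega, h⟩
    · have hp' : τ.reg .p = L x := by
        have : ¬ τ.reg .p < L x := by simpa [hv, hσ.vec_len, hx'] using hb
        omega
      exact ⟨by simp; omega, hv, ht, hn, hx', htop, hp' ▸ hc⟩

end

end AlmostStable

/-! ### The rematching loop with a stack, and the whole program -/

namespace SRI

open AlmostStable Ram

variable {n : ℕ} {I : SRI n} {X : ℕ → ℕ → ℕ}

theorem card_bpOf_eq_two_iff_blocksAt (hI : ∀ a, (I.pref a).length ≤ 2)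
    (hX : CrossLists n (I.load.vec .len) (I.load.tab .pref) X) {M : I.Matching} {f : ℕ → ℕ}
    (hf : ∀ a : Fin n, f a = M.partner a) (a : Fin n) :
    (M.bpOf a).card = 2 ↔ I.load.vec .len a = 2 ∧
      ∀ p < I.load.vec .len a, BlocksAt (I.load.tab .pref) X f a p := by
  rw [M.card_bpOf_eq_two_iff (hI a), load_len]
  refine and_congr_right fun _ => ⟨fun h p hp => ?_, fun h b hb => ?_⟩
  · rw [← load_len] at hp
    have hlt := hX.lt a a.2 p hp
    exact (blocks_iff (b := ⟨_, hlt⟩) hX hf hp rfl).1 (h _ (mem_pref_iff.2 ⟨p, hp, rfl⟩))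
  · obtain ⟨p, hp, e⟩ := mem_pref_iff.1 hb
    exact (blocks_iff hX hf hp e).2 (h p (by rwa [← load_len]))

/-- The stack holds distinct unmatched agents, among them everybody who is in two blocking pairs. -/
structure Stacked (M : I.Matching) (f stk : ℕ → ℕ) (top : ℕ) : Prop where
  partner : ∀ a : Fin n, f a = M.partner a
  lt : ∀ j < top, stk j < n
  single : ∀ j < top, f (stk j) = stk j
  distinct : ∀ i j, i < j → j < top → stk i ≠ stk j
  mem : ∀ a, (M.bpOf a).card = 2 → ∃ j < top, stk j = a

theorem Stacked.pop {M : I.Matching} {f stk : ℕ → ℕ} {top : ℕ} (h : Stacked M f stk (top + 1))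
    (hn : ∀ a : Fin n, stk top = a → (M.bpOf a).card ≠ 2) : Stacked M f stk top := by
  refine ⟨h.partner, fun j hj => h.lt j (by omega), fun j hj => h.single j (by omega),
    fun i j hij hj => h.distinct i j hij (by omega), fun a ha => ?_⟩
  obtain ⟨j, hj, e⟩ := h.mem a ha
  refine ⟨j, (Nat.lt_succ_iff_lt_or_eq.1 hj).resolve_right fun e' => ?_, e⟩
  exact hn a (e' ▸ e) ha

/-- The agent who loses her partner need not be pushed, because she is not in two blocking pairs.
The other agents on the stack stay unmatched: they differ from `i` by distinctness, and from `r`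
because `r` was matched. -/
theorem Stacked.rematch (hI : ∀ a, (I.pref a).length ≤ 2) {M : I.Matching}
    (hM : M.IsMaximumCardinality) {f stk : ℕ → ℕ} {top : ℕ} (h : Stacked M f stk (top + 1))
    {i r : Fin n} (hi : stk top = i) (h2 : (M.bpOf i).card = 2) (hir : M.Blocks i r) :
    ∃ M' : I.Matching, I.RematchStep M M' ∧ M'.IsMaximumCardinality ∧
      Stacked M' (Function.update (Function.update (Function.update f i r) r i) (f r) (f r))
        stk top := by
  obtain ⟨M', hM'⟩ := exists_rematches hI hM h2 hir
  have h1 := Matching.partner_eq_self_of_card_bpOf (hI i) h2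
  have hr := hM.ne_of_mem hir.mem h1
  refine ⟨M', ⟨i, r, h2, hir, hM'⟩, hM'.isMaximumCardinality hI hM h2 hir, fun a => ?_,
    fun j hj => h.lt j (by omega), fun j hj => ?_, fun i j hij hj => h.distinct i j hij (by omega),
    fun a ha => ?_⟩
  · rw [rematches_iff.1 hM', h.partner r]
    simp only [Function.update_apply, h.partner a, Fin.val_inj]
    split_ifs <;> rfl
  · have h3 := h.single j (by omega)
    have h4 : stk j ≠ i := hi ▸ h.distinct j top hj (by omega)
    have h5 : stk j ≠ r := fun e => by
      rw [e, h.partner] at h3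
      exact hr (Fin.ext h3)
    simp only [Function.update_apply, if_neg h4, if_neg h5, h3]
    split_ifs with e
    · exact e.symm
    · rfl
  · obtain ⟨h3, h4⟩ := hM'.card_bpOf_eq_two hI hM h2 hir ha
    obtain ⟨j, hj, e⟩ := h.mem a h4
    refine ⟨j, (Nat.lt_succ_iff_lt_or_eq.1 hj).resolve_right fun e' => h3 (Fin.ext ?_), e⟩
    rw [← e, e', hi]

theorem exec_rematch (hI : ∀ a, (I.pref a).length ≤ 2)
    (hX : CrossLists n (I.load.vec .len) (I.load.tab .pref) X) {M₀ : I.Matching}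
    (hM₀ : M₀.IsMaximumCardinality) {σ : Store} {k k' : ℕ} (hk : k' + 300 * n + 100 ≤ k)
    (hσ : Env n (I.load.vec .len) (I.load.tab .pref) X σ)
    (hf₀ : ∀ a : Fin n, σ.vec .mate a = M₀.partner a) :
    Exec rematch (fun k σ => k' ≤ k ∧ ∃ M : I.Matching,
      (∀ a : Fin n, σ.vec .mate a = M.partner a) ∧
      Relation.ReflTransGen I.RematchStep M₀ M ∧ I.RematchDone M) k σ := by
  rw [AlmostStable.rematch]
  simp only [exec_seq, exec_set]
  refine ⟨by simp; omega, ?_⟩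
  refine exec_forAgents (N := n) (by simp) (fun i k τ => k' + 250 * n + 20 + 20 * (n - i) ≤ k ∧
    Env n (I.load.vec .len) (I.load.tab .pref) X τ ∧ τ.vec .mate = σ.vec .mate ∧
    τ.reg .top ≤ i ∧
    (∀ j < τ.reg .top, τ.vec .stk j < i ∧ σ.vec .mate (τ.vec .stk j) = τ.vec .stk j) ∧
    (∀ j' j, j' < j → j < τ.reg .top → τ.vec .stk j' ≠ τ.vec .stk j) ∧
    ∀ a < i, σ.vec .mate a = a → ∃ j < τ.reg .top, τ.vec .stk j = a)
    (by simpa using hσ.reg_n) (by simp; omega)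
    ⟨by simp; omega, by simpa using hσ, by simp, by simp, by simp, by simp, by simp⟩ ?_ ?_
  · rintro i hi k τ hx hn ⟨hk, hτ, hmate, htop, h1, h2, h3⟩
    simp only [exec_ite, exec_seq, exec_put, exec_set, exec_skip]
    refine ⟨by simp; omega, fun hb => ?_, fun hb => ?_⟩
    · have hb' : σ.vec .mate i = i := by simpa [hx, hmate] using hb
      refine ⟨by simp; omega, by simp; omega, by simpa using hx, by simpa using hn,
        by simp; omega, by simpa using hτ, by simpa using hmate, by simpa using htop, ?_, ?_, ?_⟩
      · simp only [Store.reg_set, Store.reg_put, Store.vec_set, Store.vec_put, Exp.eval, hx,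
          reduceCtorEq, if_true, if_false]
        intro j hj
        rcases Nat.lt_succ_iff_lt_or_eq.1 hj with hj | rfl
        · rw [Function.update_of_ne hj.ne]
          exact ⟨(h1 j hj).1.trans (by omega), (h1 j hj).2⟩
        · rw [Function.update_self]
          exact ⟨by omega, hb'⟩
      · simp only [Store.reg_set, Store.reg_put, Store.vec_set, Store.vec_put, Exp.eval, hx,
          reduceCtorEq, if_true, if_false]
        intro j' j hj' hj
        rw [Function.update_of_ne (show j' ≠ τ.reg .top by omega)]
        rcases Nat.lt_succ_iff_lt_or_eq.1 hj with hj | rfl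
        · rw [Function.update_of_ne hj.ne]
          exact h2 j' j hj' hj
        · rw [Function.update_self]
          exact (h1 j' hj').1.ne
      · simp only [Store.reg_set, Store.reg_put, Store.vec_set, Store.vec_put, Exp.eval, hx,
          reduceCtorEq, if_true, if_false]
        intro a ha hfa
        rcases Nat.lt_succ_iff_lt_or_eq.1 ha with ha | rfl
        · obtain ⟨j, hj, e⟩ := h3 a ha hfa
          exact ⟨j, by omega, by rwa [Function.update_of_ne hj.ne]⟩
        · exact ⟨τ.reg .top, by omega, Function.update_self _ _ _⟩
    · have hb' : σ.vec .mate i ≠ i := by simpa [hx, hmate] using hb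
      refine ⟨by simp; omega, hx, hn, by simp; omega, by simpa using hτ, by simpa using hmate,
        by simp; omega, ?_, by simpa using h2, ?_⟩
      · simp only [Store.reg_set, Store.vec_set, reduceCtorEq, if_false]
        exact fun j hj => ⟨(h1 j hj).1.trans (by omega), (h1 j hj).2⟩
      · simp only [Store.reg_set, Store.vec_set, reduceCtorEq, if_false]
        intro a ha hfa
        rcases Nat.lt_succ_iff_lt_or_eq.1 ha with ha | rfl
        · exact h3 a ha hfa
        · exact absurd hfa hb'
  · rintro k τ hn ⟨hk, hτ, hmate, htop, h1, h2, h3⟩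
    -- Every pass pops one agent and pushes none. When the stack is empty, nobody can be in two
    -- blocking pairs.
    refine Exec.while (fun k τ => k' + 230 * τ.reg .top + 5 ≤ k ∧
      Env n (I.load.vec .len) (I.load.tab .pref) X τ ∧ ∃ M : I.Matching,
        M.IsMaximumCardinality ∧ Relation.ReflTransGen I.RematchStep M₀ M ∧
        Stacked M (τ.vec .mate) (τ.vec .stk) (τ.reg .top)) ?_ ?_
    · refine ⟨by omega, hτ, M₀, hM₀, .refl, hmate ▸ hf₀, fun j hj => (h1 j hj).1,
        fun j hj => hmate ▸ (h1 j hj).2, h2, fun a ha => h3 a a.2 ?_⟩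
      rw [hf₀, Matching.partner_eq_self_of_card_bpOf (hI a) ha]
    · rintro k τ ⟨hk, hτ, M, hM, hrt, hS⟩
      refine ⟨by simp; omega, fun hb => ?_, fun hb => ?_⟩
      · obtain ⟨top, htop⟩ : ∃ top, τ.reg .top = top + 1 :=
          Nat.exists_eq_add_one.2 (by simpa using hb)
        rw [htop] at hS
        have hx := hS.lt top (by omega)
        have hfx := hS.single top (by omega)
        generalize hf : τ.vec .mate = f at *
        generalize hstk : τ.vec .stk = stk at *
        simp only [exec_seq, exec_set]
        refine ⟨by simp; omega, by simp; omega, ?_⟩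
        refine Exec.mono (exec_countBlocking (k' := k' + 230 * top + 5 + 30) hX
          (isMate_of_partner hS.partner) hx hfx (by simp; omega) (by simpa using hτ)
          (by simp [hstk, htop]) (by simpa using hf)) ?_
        rintro k ρ ⟨hk, hv, ht, hn, hxr, htopr, hc1, hc2, hc3⟩
        have hρ : Env n (I.load.vec .len) (I.load.tab .pref) X ρ :=
          hτ.congr (hn.trans hτ.reg_n.symm) (by simp [hv]) (by simpa using ht)
        have hρf : ρ.vec .mate = f := by simp [hv, hf]
        have hρstk : ρ.vec .stk = stk := by simp [hv, hstk]
        have hρtop : ρ.reg .top = top := by simp [htopr, htop]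
        have hcard := card_bpOf_eq_two_iff_blocksAt hI hX hS.partner ⟨stk top, hx⟩
        have hLx := (lists_load hI).len_le _ hx
        -- The counter is at most the length of the list, which is at most two, and equals it only
        -- if everybody on the list blocks.
        have hcard' : (M.bpOf ⟨stk top, hx⟩).card = 2 ↔ ρ.reg .c = 2 := by
          rw [hcard, ← hc2]
          dsimp only
          clear hc3
          omega
        simp only [exec_ite, exec_seq, exec_put, exec_set, exec_skip]
        refine ⟨by simp; clear hc3; omega, fun hb => ?_, fun hb => ?_⟩
        · have hb' : ρ.reg .c = 2 := by simpa using hb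
          obtain ⟨p, hp, hr, hB⟩ := hc3 (by omega)
          have hrn := hX.lt _ hx p hp
          have hbl := (blocks_iff (a := ⟨stk top, hx⟩) (b := ⟨_, hrn⟩) hX hS.partner hp rfl).2 hB
          obtain ⟨M', hstep, hM', hS'⟩ := hS.rematch hI hM (i := ⟨stk top, hx⟩) rfl
            (hcard'.2 hb') hbl
          refine ⟨by simp; omega, by simp; omega, by simp; omega, by simp; omega,
            by simp [hρtop]; omega, by simpa using hρ, M', hM', hrt.tail hstep, ?_⟩
          simpa [hρf, hρstk, hρtop, hxr, hr] using hS'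
        · have hb' : ¬ ρ.reg .c = 2 := by simpa using hb
          refine ⟨by simp; clear hc3; omega, by simp [hρtop]; clear hc3; omega, hρ, M, hM, hrt, ?_⟩
          rw [hρf, hρstk, hρtop]
          refine hS.pop fun a ha h2 => hb' (hcard'.1 ?_)
          rwa [show (⟨stk top, hx⟩ : Fin n) = a from Fin.ext ha]
      · have htop : τ.reg .top = 0 := by simpa using hb
        refine ⟨by simp; omega, M, hS.partner, hrt, fun a ha => ?_⟩
        obtain ⟨j, hj, -⟩ := hS.mem a ha
        omega

theorem exec_algorithm (hI : ∀ a, (I.pref a).length ≤ 2) :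
    Exec algorithm (fun _ σ => ∃ M : I.Matching,
      (∀ a : Fin n, σ.vec .mate a = M.partner a) ∧ I.CanReturn M) (2000 * (n + 1)) I.load := by
  have hL := lists_load hI
  rw [algorithm, exec_seq]
  refine Exec.mono (exec_irving hL (k' := 1000 * n + 1000) (by omega) env_load) ?_
  rintro k σ ⟨hk, X, hX, hσ, ⟨hok, hf, hst⟩ | ⟨hok, hodd⟩⟩
  · rw [exec_ite, exec_skip]
    refine ⟨by simp; omega, fun _ => ⟨by simp; omega, ?_⟩, fun hb => by simp [hok] at hb⟩
    obtain ⟨M, hM⟩ := exists_matching hf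
    exact ⟨M, hM, .inl ((isStable_iff hX hM).2 hst)⟩
  · rw [exec_ite, exec_seq]
    refine ⟨by simp; omega, fun hb => by simp [hok] at hb, fun _ => ?_⟩
    refine Exec.mono (exec_maxCard hL (k' := 300 * n + 100) (by simp; omega) hσ) ?_
    rintro k σ ⟨hk, hσ, hf, hconn⟩
    obtain ⟨M₀, hM₀⟩ := exists_matching hf
    have hmax := isMaximumCardinality_of_adjacent hM₀ hconn
    refine Exec.mono (exec_rematch hI hX hmax (k' := 0) (by omega) hσ hM₀) ?_
    rintro k σ ⟨-, M, hM, hrt, hdone⟩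
    exact ⟨M, hM, .inr ⟨not_solvable_of_oddParty hX hodd, M₀, hmax, hrt, hdone⟩⟩

end SRI

theorem mainTheorem8 :
    ∃ C : ℕ, ∀ (n : ℕ) (I : SRI n), (∀ a, (I.pref a).length ≤ 2) →
      -- the optimum is at most one
      I.minimax ≤ 1 ∧
      -- whatever the choices made, the rematching loop stops after at most `n` iterations, each of
      -- which again leaves a matching, and what the algorithm returns is an optimal solution
      (∀ (M : ℕ → I.Matching) (m : ℕ), ¬ I.Solvable → (M 0).IsMaximumCardinality →
        (∀ j < m, I.RematchStep (M j) (M (j + 1))) →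
          m ≤ n ∧ ∀ i r, ((M m).bpOf i).card = 2 → (M m).Blocks i r →
            ∃ M' : I.Matching, I.Rematches (M m) i r M') ∧
      (∀ M : I.Matching, I.CanReturn M → I.IsOptimal M) ∧
      -- the program makes a linear number of steps and outputs an optimal solution that the
      -- algorithm can return
      ∃ (t : ℕ) (σ : Ram.Store) (M : I.Matching),
        Ram.Run AlmostStable.algorithm I.load t σ ∧ t ≤ C * (n + 1) ∧
        (∀ a : Fin n, σ.vec .mate a = M.partner a) ∧
        I.CanReturn M ∧ I.IsOptimal M := by
  refine ⟨2000, fun n I hI => ?_⟩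
  obtain ⟨t, k, σ, hrun, ht, M, hM, hret⟩ := SRI.exec_algorithm hI
  -- The bound on the optimum is witnessed by the output of the program itself.
  refine ⟨(ciInf_le' _ M).trans (hret.worst_le_one hI), fun M m _ h0 hstep => ?_,
    fun M hM => hM.isOptimal hI, t, σ, M, hrun, by omega, hM, hret, hret.isOptimal hI⟩
  obtain ⟨hmax, hm⟩ := SRI.rematch_terminates hI h0 hstep
  exact ⟨hm, fun i r hi hir => SRI.exists_rematches hI hmax hi hir⟩
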